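/- Let $n \ge 1$, and let $g = -dt^2 + (dx^1)^2 + \dots + (dx^n)^2$ be the Minkowski metric on $\mathbb{R}^{1+n}$, with coordinates $(t,x) \in \mathbb{R} \times \mathbb{R}^n$ and wave operator $\Box = -\partial_t^2 + \partial_{x^1}^2 + \dots + \partial_{x^n}^2$. A set $\mathcal{U} \subseteq \mathbb{R}^{1+n}$ is a *generalized timelike cylinder* (GTC) if: (i) its boundary $\partial\mathcal{U}$ is a smooth timelike hypersurface of $\mathbb{R}^{1+n}$, with $\mathcal{U}$ lying locally on one side of it (that is, near each boundary point $\mathcal{U} = \{\rho < 0\}$ for a smooth function $\rho$ with $d\rho \neq 0$, and the normals of $\partial\mathcal{U}$ are spacelike); (ii) for every $\tau \in \mathbb{R}$, the slice $\Omega_\tau = \{ y \in \mathbb{R}^n : (\tau,y) \in \mathcal{U} \}$ is nonempty, bounded and open; (iii) there is a smooth future-directed timelike vector field $Z$ on $\bar{\mathcal{U}}$ that is tangent to $\partial\mathcal{U}$ along $\partial\mathcal{U}$. Let $\mathcal{N}$ denote the outward-pointing $g$-unit normal to $\partial\mathcal{U}$, write $\mathcal{U}_\tau = \mathcal{U} \cap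 \{t = \tau\}$, and for $P = (t_0,x_0)$ let $f_P(t,x) = \tfrac14 ( |x-x_0|^2 - (t-t_0)^2 )$. **Theorem.** Let $\mathcal{U}$ be a GTC in $\mathbb{R}^{1+n}$, let $x_0 \in \mathbb{R}^n$, and let $\tau_- < \tau_+$ satisfy $$ \tau_+ - \tau_- > R_+ + R_- , \qquad R_\pm := \sup_{(\tau_\pm, y) \in \partial\mathcal{U}} |y - x_0| . $$ Let $t_0 \in (\tau_-, \tau_+)$ be such that $\tau_+ - t_0 > R_+$ and $t_0 - \tau_- > R_-$, and put $P = (t_0,x_0)$. Then there is a constant $C > 0$, depending only on $\mathcal{U}$, $(t_0,x_0)$ and $\tau_+ - \tau_-$, such that every $\phi \in C^\infty(\bar{\mathcal{U}})$ with $\Box\phi = 0$ on $\mathcal{U}$ and $\phi = 0$ on $\partial\mathcal{U}$ satisfies both estimates $$ \int_{\mathcal{U}_{\tau_+}} \Big( (\partial_t\phi)^2 + \sum_{i=1}^n (\partial_{x^i}\phi)^2 + \phi^2 \Big) \le C \int_{\Gamma_*} |\mathcal{N}\phi|^2 , \qquad \int_{\mathcal{U}_{\tau_-}} \Big( (\partial_t\phi)^2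 + \sum_{i=1}^n (\partial_{x^i}\phi)^2 + \phi^2 \Big) \le C \int_{\Gamma_*} |\mathcal{N}\phi|^2 , $$ where $$ \Gamma_* := \{ (\tau,y) \in \partial\mathcal{U} : \tau_- < \tau < \tau_+ , \ \mathcal{N} f_P|_{(\tau,y)} > 0 \} , $$ and where the integrals over $\mathcal{U}_{\tau_\pm}$ and $\Gamma_*$ are taken with respect to the volume measures induced by $g$. -/

import Mathlib

open Set MeasureTheory
open scoped ContDiff ENNReal NNReal

noncomputable section

/-- The space `ℝ^{1+n}`; a point is a pair `(t, x)`. The product topology and smooth structure are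
used; the (sup) norm of the product plays no role. -/
abbrev Spacetime (n : ℕ) : Type := ℝ × EuclideanSpace ℝ (Fin n)

namespace Spacetime

variable {n : ℕ}

/-- The coordinate vector `∂_t`. -/
def eT : Spacetime n := (1, 0)

/-- The coordinate vector `∂_{x^i}`. -/
def eX (i : Fin n) : Spacetime n := (0, EuclideanSpace.single i 1)

/-- The Minkowski metric `g = -dt² + (dx¹)² + ⋯ + (dxⁿ)²`. -/
def mink (v w : Spacetime n) : ℝ := -(v.1 * w.1) + inner ℝ v.2 w.2

/-- The vector of partial derivatives `(∂_t h, ∂_{x^1} h, …, ∂_{x^n} h)` at `p`. -/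
def grad (h : Spacetime n → ℝ) (p : Spacetime n) : Spacetime n :=
  (fderiv ℝ h p eT, WithLp.toLp 2 fun i => fderiv ℝ h p (eX i))

/-- `|∇_{t,x} h|² = (∂_t h)² + (∂_{x^1} h)² + ⋯ + (∂_{x^n} h)²`. -/
def gradSq (h : Spacetime n → ℝ) (p : Spacetime n) : ℝ :=
  (fderiv ℝ h p eT) ^ 2 + ∑ i, (fderiv ℝ h p (eX i)) ^ 2

/-- The wave operator `□ h = -∂_t² h + ∂_{x^1}² h + ⋯ + ∂_{x^n}² h`. -/
def box (h : Spacetime n → ℝ) (p : Spacetime n) : ℝ :=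
  -(fderiv ℝ (fderiv ℝ h) p eT eT) + ∑ i, fderiv ℝ (fderiv ℝ h) p (eX i) (eX i)

/-- The shifted hyperbolic function `f_P = (|x - x(P)|² - (t - t(P))²) / 4`. -/
def hyp (P q : Spacetime n) : ℝ := (‖q.2 - P.2‖ ^ 2 - (q.1 - P.1) ^ 2) / 4

/-- `ρ` is a smooth defining function of `U` near the boundary point `p`: near `p` it is smooth,
it has non-vanishing differential at its zero `p`, and `U` is the set where it is negative. -/
def IsDefiningFunctionAt (U : Set (Spacetime n)) (p : Spacetime n) (ρ : Spacetime n → ℝ) : Prop :=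
  ρ p = 0 ∧ fderiv ℝ ρ p ≠ 0 ∧
    ∃ W : Set (Spacetime n), IsOpen W ∧ p ∈ W ∧ ContDiffOn ℝ ∞ ρ W ∧
      U ∩ W = {q | q ∈ W ∧ ρ q < 0}

/-- The time slice `Ω_τ = {y | (τ, y) ∈ U}`. -/
def slice (U : Set (Spacetime n)) (τ : ℝ) : Set (EuclideanSpace ℝ (Fin n)) := {y | (τ, y) ∈ U}

/-- `Z` is a generator of `U`: a smooth future-directed timelike vector field on the closure of `U`
that is tangent to the boundary of `U`. -/
structure IsGenerator (U : Set (Spacetime n)) (Z : Spacetime n → Spacetime n) : Prop where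
  smooth : ContDiffOn ℝ ∞ Z (closure U)
  timelike : ∀ p ∈ closure U, mink (Z p) (Z p) < 0
  future : ∀ p ∈ closure U, 0 < (Z p).1
  tangent : ∀ p ∈ frontier U, ∀ ρ, IsDefiningFunctionAt U p ρ → fderiv ℝ ρ p (Z p) = 0

/-- Generalized timelike cylinders. The boundary is a smooth hypersurface with `U` on one side of
it, and it is timelike: its normals are spacelike, i.e. `g⁻¹(dρ, dρ) > 0` for the differential of a
defining function `ρ`. (On covectors the inverse metric has the same expression as `g`.) -/
structure IsGTC (U : Set (Spacetime n)) : Prop where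
  smooth_boundary : ∀ p ∈ frontier U, ∃ ρ, IsDefiningFunctionAt U p ρ
  timelike_boundary : ∀ p ∈ frontier U, ∀ ρ, IsDefiningFunctionAt U p ρ →
    0 < mink (grad ρ p) (grad ρ p)
  slice_nonempty : ∀ τ, (slice U τ).Nonempty
  slice_bounded : ∀ τ, Bornology.IsBounded (slice U τ)
  slice_open : ∀ τ, IsOpen (slice U τ)
  generator : ∃ Z, IsGenerator U Z

open Classical in
/-- The Euclidean outer unit normal of `U` at the boundary point `p`: the normalized Euclidean
gradient of a defining function (any two of them have positively proportional gradients at `p`). -/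
def euclNormal (U : Set (Spacetime n)) (p : Spacetime n) : Spacetime n :=
  if h : ∃ ρ, IsDefiningFunctionAt U p ρ then
    (√((grad h.choose p).1 ^ 2 + ‖(grad h.choose p).2‖ ^ 2))⁻¹ • grad h.choose p
  else 0

/-- The Minkowski outer unit normal `𝒩` of `U`: the metric dual `(-ν^t, ν^x)` of the Euclidean outer
normal `(ν^t, ν^x)`, rescaled so that `g(𝒩, 𝒩) = 1`. -/
def minkNormal (U : Set (Spacetime n)) (p : Spacetime n) : Spacetime n :=
  (√(mink (euclNormal U p) (euclNormal U p)))⁻¹ • (-(euclNormal U p).1, (euclNormal U p).2)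

/-- The `n`-dimensional surface measure for the Euclidean metric of `ℝ^{1+n}`. -/
def euclSurfaceMeasure (n : ℕ) : Measure (Spacetime n) :=
  Measure.map WithLp.ofLp
    (Measure.euclideanHausdorffMeasure n : Measure (WithLp 2 (Spacetime n)))

/-- The integral of a nonnegative function `h` over a subset `Γ` of the boundary of `U`, with respect
to the volume measure of the metric that the Minkowski metric induces on the boundary. That measure
has density `√(g(ν, ν))` with respect to the Euclidean surface measure, where `ν` is the Euclidean
unit normal. -/
def boundaryIntegral (U Γ : Set (Spacetime n)) (h : Spacetime n → ℝ) : ℝ≥0∞ :=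
  ∫⁻ p in Γ, ENNReal.ofReal (h p * √(mink (euclNormal U p) (euclNormal U p)))
    ∂(euclSurfaceMeasure n)

/-- `∫_{U_τ} (|∇_{t,x} φ|² + φ²)`. -/
def sliceEnergy (U : Set (Spacetime n)) (φ : Spacetime n → ℝ) (τ : ℝ) : ℝ≥0∞ :=
  ∫⁻ y in slice U τ, ENNReal.ofReal (gradSq φ (τ, y) + φ (τ, y) ^ 2)

/-- The derivative `𝒩φ` at a boundary point, of a function `φ` that is smooth on the closure. -/
def normalDeriv (U : Set (Spacetime n)) (φ : Spacetime n → ℝ) (p : Spacetime n) : ℝ :=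
  fderivWithin ℝ φ (closure U) p (minkNormal U p)

/-- `sup {|y - x₀| : (τ, y) ∈ ∂U}`. -/
def boundaryRadius (U : Set (Spacetime n)) (x₀ : EuclideanSpace ℝ (Fin n)) (τ : ℝ) : ℝ :=
  sSup ((fun y => ‖y - x₀‖) '' {y | (τ, y) ∈ frontier U})

/-- `Γ_* = {(τ, y) ∈ ∂U : τ₋ < τ < τ₊, 𝒩 f_P > 0}`. -/
def observationRegion (U : Set (Spacetime n)) (P : Spacetime n) (τm τp : ℝ) : Set (Spacetime n) :=
  {p | p ∈ frontier U ∧ τm < p.1 ∧ p.1 < τp ∧ 0 < fderiv ℝ (hyp P) p (minkNormal U p)}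

end Spacetime

end

/-!
Multiplying `□φ = 0` by `Xφ + (n-1)/2 φ`, where `X = (t - t₀, x - x₀)` generates the scalings about
`P = (t₀, x₀)`, gives a divergence-free current. Its flux through `∂U`, where `φ = 0`, is
`|𝒩φ|²` times a quantity with the sign of `𝒩 f_P`, so the part of `∂U` outside `Γ_*` helps. On a
slice the density of the current becomes, after an integration by parts of `φ ∂_r φ` (a virial
identity), a quadratic form that is coercive when the slice lies strictly inside the cone of `P`,
with a constant governed by the gap `|τ - t₀| - R`. Since `φ` vanishes on `∂U`, to which the
generator `Z` is tangent, Grönwall's inequality for the flux of `Z` compares the energies of any two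
slices, so it is enough that one of the gaps at `τ₊` and `τ₋` be bounded below; for `τ₊ - τ₋` fixed
this holds uniformly because the boundary radius is `1`-Lipschitz in time.
-/

open Filter Topology

lemma tendsto_add_smul_nhdsGT {E : Type*} [AddCommGroup E] [TopologicalSpace E] [ContinuousAdd E]
    [Module ℝ E] [ContinuousSMul ℝ E] (p v : E) :
    Tendsto (fun s : ℝ => p + s • v) (𝓝[>] 0) (𝓝 p) := by
  have hcont : Continuous fun s : ℝ => p + s • v := by fun_prop
  simpa using (hcont.tendsto 0).mono_left nhdsWithin_le_nhds

lemma eventually_neg_of_hasFDerivAt {E : Type*} [NormedAddCommGroup E] [NormedSpace ℝ E]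
    {f : E → ℝ} {f' : E →L[ℝ] ℝ} {p v : E} (hf : HasFDerivAt f f' p) (h0 : f p = 0)
    (hv : f' v < 0) : ∀ᶠ s in 𝓝[>] (0 : ℝ), f (p + s • v) < 0 := by
  have hslope : Tendsto (fun s : ℝ => s⁻¹ • (f (p + s • v) - f p)) (𝓝[>] 0) (𝓝 (f' v)) := by
    simpa using (hf.hasLineDerivAt v).tendsto_slope_zero.mono_left (nhdsGT_le_nhdsNE 0)
  filter_upwards [hslope.eventually (gt_mem_nhds hv), self_mem_nhdsWithin] with s hs hs0
  rw [h0, sub_zero, smul_eq_mul] at hs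
  exact neg_of_mul_neg_right hs (inv_nonneg.2 (le_of_lt hs0))

lemma exists_pos_eq_mul_of_neg_imp_nonpos {E : Type*} [AddCommGroup E] [Module ℝ E]
    {A B : E →ₗ[ℝ] ℝ} (hA : A ≠ 0) (hB : B ≠ 0) (h : ∀ v, A v < 0 → B v ≤ 0) :
    ∃ c : ℝ, 0 < c ∧ ∀ v, B v = c * A v := by
  obtain ⟨v₀, hv₀⟩ : ∃ v, A v < 0 :=
    (LinearMap.surjective hA (-1)).imp fun v hv => by linarith
  have hker_nonpos : ∀ u, A u = 0 → B u ≤ 0 := by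
    intro u hu
    by_contra! hBu
    have hle := h (v₀ + ((1 + |B v₀|) / B u) • u) (by simpa [hu] using hv₀)
    rw [map_add, map_smul, smul_eq_mul, div_mul_cancel₀ _ hBu.ne'] at hle
    linarith [neg_abs_le (B v₀)]
  have hker : ∀ u, A u = 0 → B u = 0 := fun u hu =>
    le_antisymm (hker_nonpos u hu) (by simpa using hker_nonpos (-u) (by simp [hu]))
  have hmul : ∀ v, B v = B v₀ / A v₀ * A v := by
    intro v
    have hv := hker (v - (A v / A v₀) • v₀) (by
      rw [map_sub, map_smul, smul_eq_mul, div_mul_cancel₀ _ hv₀.ne, sub_self])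
    rw [map_sub, map_smul, smul_eq_mul, sub_eq_zero] at hv
    rw [hv]
    ring
  refine ⟨B v₀ / A v₀, lt_of_le_of_ne (div_nonneg_of_nonpos (h v₀ hv₀) hv₀.le) fun hc => ?_, hmul⟩
  exact hB (LinearMap.ext fun v => by rw [hmul, ← hc, zero_mul, LinearMap.zero_apply])

namespace Spacetime

variable {n : ℕ} {U : Set (Spacetime n)} {p : Spacetime n} {ρ : Spacetime n → ℝ}

/-- The Euclidean inner product of `ℝ^{1+n}`, which the product type `Spacetime n` does not carry as
an instance. -/
noncomputable def edot (v w : Spacetime n) : ℝ := v.1 * w.1 + inner ℝ v.2 w.2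

lemma edot_comm (v w : Spacetime n) : edot v w = edot w v := by
  simp only [edot, real_inner_comm, mul_comm]

lemma edot_smul_right (c : ℝ) (v w : Spacetime n) : edot v (c • w) = c * edot v w := by
  simp only [edot, Prod.smul_fst, Prod.smul_snd, inner_smul_right, smul_eq_mul]
  ring

lemma edot_self (v : Spacetime n) : edot v v = v.1 ^ 2 + ‖v.2‖ ^ 2 := by
  rw [edot, real_inner_self_eq_norm_sq, sq v.1]

lemma edot_self_pos {v : Spacetime n} (hv : v ≠ 0) : 0 < edot v v := by
  rw [edot_self]
  by_cases h : v.2 = 0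
  · have : v.1 ≠ 0 := fun h1 => hv (Prod.ext h1 h)
    positivity
  · have := norm_pos_iff.2 h
    positivity

lemma edot_eq_sum (v w : Spacetime n) : edot v w = v.1 * w.1 + ∑ i, v.2 i * w.2 i := by
  simp [edot, PiLp.inner_apply, mul_comm]

lemma eq_sum_coord (v : Spacetime n) : v = v.1 • eT + ∑ i, v.2 i • eX i := by
  ext1
  · simp [eT, eX, Prod.fst_sum]
  · ext j
    simp [eT, eX, Prod.snd_sum, Pi.single_apply]

lemma clm_apply_eq_sum (A : Spacetime n →L[ℝ] ℝ) (v : Spacetime n) :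
    A v = v.1 * A eT + ∑ i, v.2 i * A (eX i) := by
  conv_lhs => rw [eq_sum_coord v]
  simp [map_sum]

lemma edot_grad (h : Spacetime n → ℝ) (p v : Spacetime n) :
    edot v (grad h p) = fderiv ℝ h p v := by
  rw [clm_apply_eq_sum, edot_eq_sum]
  simp [grad]

lemma mink_self (v : Spacetime n) : mink v v = ‖v.2‖ ^ 2 - v.1 ^ 2 := by
  rw [mink, real_inner_self_eq_norm_sq]
  ring

namespace IsDefiningFunctionAt

lemma contDiffAt (h : IsDefiningFunctionAt U p ρ) : ContDiffAt ℝ ∞ ρ p := by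
  obtain ⟨-, -, W, hW, hp, hs, -⟩ := h
  exact hs.contDiffAt (hW.mem_nhds hp)

lemma hasFDerivAt (h : IsDefiningFunctionAt U p ρ) : HasFDerivAt ρ (fderiv ℝ ρ p) p :=
  (h.contDiffAt.differentiableAt (by simp)).hasFDerivAt

lemma eventually_mem_iff (h : IsDefiningFunctionAt U p ρ) : ∀ᶠ q in 𝓝 p, (q ∈ U ↔ ρ q < 0) := by
  obtain ⟨-, -, W, hW, hp, -, hUW⟩ := h
  filter_upwards [hW.mem_nhds hp] with q hq
  simpa [hq] using Set.ext_iff.1 hUW q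

lemma notMem (h : IsDefiningFunctionAt U p ρ) : p ∉ U := by
  rw [h.eventually_mem_iff.self_of_nhds, h.1]
  exact lt_irrefl _

lemma eventually_mem (h : IsDefiningFunctionAt U p ρ) {v : Spacetime n}
    (hv : fderiv ℝ ρ p v < 0) : ∀ᶠ s in 𝓝[>] (0 : ℝ), p + s • v ∈ U := by
  filter_upwards [(tendsto_add_smul_nhdsGT p v).eventually h.eventually_mem_iff,
    eventually_neg_of_hasFDerivAt h.hasFDerivAt h.1 hv] with s hiff hneg
  exact hiff.2 hneg

lemma eventually_notMem (h : IsDefiningFunctionAt U p ρ) {v : Spacetime n}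
    (hv : 0 < fderiv ℝ ρ p v) : ∀ᶠ s in 𝓝[>] (0 : ℝ), p + s • v ∉ U := by
  have hneg := eventually_neg_of_hasFDerivAt (v := v) h.hasFDerivAt.neg (by simp [h.1])
    (by simpa using hv)
  filter_upwards [(tendsto_add_smul_nhdsGT p v).eventually h.eventually_mem_iff, hneg]
    with s hiff hneg
  rw [hiff, not_lt]
  simpa using hneg.le

lemma exists_fderiv_neg (h : IsDefiningFunctionAt U p ρ) : ∃ v, fderiv ℝ ρ p v < 0 :=
  (LinearMap.surjective (f := (fderiv ℝ ρ p).toLinearMap) (by exact_mod_cast h.2.1) (-1)).imp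
    fun v hv => by
      have : fderiv ℝ ρ p v = -1 := hv
      linarith

lemma mem_closure (h : IsDefiningFunctionAt U p ρ) : p ∈ closure U := by
  obtain ⟨v, hv⟩ := h.exists_fderiv_neg
  exact mem_closure_of_tendsto (tendsto_add_smul_nhdsGT p v) (h.eventually_mem hv)

lemma mem_frontier (h : IsDefiningFunctionAt U p ρ) : p ∈ frontier U :=
  ⟨h.mem_closure, fun hi => h.notMem (interior_subset hi)⟩

lemma eventually_isDefiningFunctionAt (h : IsDefiningFunctionAt U p ρ) :
    ∀ᶠ q in 𝓝 p, ρ q = 0 → IsDefiningFunctionAt U q ρ := by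
  have hcont : ContinuousAt (fderiv ℝ ρ) p :=
    (h.contDiffAt.fderiv_right (m := 0) (by norm_cast)).continuousAt
  have hne := hcont.eventually_ne h.2.1
  obtain ⟨-, -, W, hW, hp, hs, hUW⟩ := h
  filter_upwards [hne, hW.mem_nhds hp] with q hq hqW hq0
  exact ⟨hq0, hq, W, hW, hqW, hs, hUW⟩

lemma uniqueDiffWithinAt (h : IsDefiningFunctionAt U p ρ) :
    UniqueDiffWithinAt ℝ (closure U) p := by
  refine ⟨?_, subset_closure h.mem_closure⟩
  have hcone : {v | fderiv ℝ ρ p v < 0} ⊆ tangentConeAt ℝ (closure U) p := by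
    intro v hv
    refine mem_tangentConeAt_of_add_smul_mem (l := 𝓝[>] (0 : ℝ)) (c := id) ?_ ?_
    · exact tendsto_id.mono_left (nhdsGT_le_nhdsNE 0)
    · exact (h.eventually_mem hv).mono fun s hs => subset_closure hs
  have hopen : IsOpen {v | fderiv ℝ ρ p v < 0} :=
    isOpen_lt (fderiv ℝ ρ p).continuous continuous_const
  obtain ⟨v, hv⟩ := h.exists_fderiv_neg
  rw [Submodule.eq_top_of_nonempty_interior' (Submodule.span ℝ (tangentConeAt ℝ (closure U) p))
    ⟨v, mem_interior.2 ⟨_, hcone.trans Submodule.subset_span, hopen, hv⟩⟩]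
  exact dense_univ

lemma exists_fderiv_eq_mul (h : IsDefiningFunctionAt U p ρ) {ρ' : Spacetime n → ℝ}
    (h' : IsDefiningFunctionAt U p ρ') :
    ∃ c : ℝ, 0 < c ∧ ∀ v, fderiv ℝ ρ' p v = c * fderiv ℝ ρ p v := by
  refine exists_pos_eq_mul_of_neg_imp_nonpos (A := (fderiv ℝ ρ p).toLinearMap)
    (B := (fderiv ℝ ρ' p).toLinearMap) (by exact_mod_cast h.2.1) (by exact_mod_cast h'.2.1) ?_
  intro v hv
  by_contra! hv'
  obtain ⟨s, hmem, hnotMem⟩ := ((h.eventually_mem hv).and (h'.eventually_notMem hv')).exists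
  exact hnotMem hmem

lemma grad_ne_zero (h : IsDefiningFunctionAt U p ρ) : grad ρ p ≠ 0 := fun h0 =>
  h.2.1 <| ContinuousLinearMap.ext fun v => by
    rw [← edot_grad, h0]
    simp [edot]

lemma edot_euclNormal_self (h : IsDefiningFunctionAt U p ρ) :
    edot (euclNormal U p) (euclNormal U p) = 1 := by
  have hex : ∃ ρ, IsDefiningFunctionAt U p ρ := ⟨ρ, h⟩
  have hpos := edot_self_pos hex.choose_spec.grad_ne_zero
  rw [euclNormal, dif_pos hex, edot_smul_right, edot_comm, edot_smul_right, ← edot_self,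
    ← mul_assoc, ← mul_inv, Real.mul_self_sqrt hpos.le, inv_mul_cancel₀ hpos.ne']

lemma exists_fderiv_eq_edot (h : IsDefiningFunctionAt U p ρ) :
    ∃ c : ℝ, 0 < c ∧ ∀ v, fderiv ℝ ρ p v = c * edot v (euclNormal U p) := by
  have hex : ∃ ρ, IsDefiningFunctionAt U p ρ := ⟨ρ, h⟩
  have hsqrt := Real.sqrt_pos.2 (edot_self_pos hex.choose_spec.grad_ne_zero)
  obtain ⟨c, hc, hcv⟩ := hex.choose_spec.exists_fderiv_eq_mul h
  refine ⟨c * √(edot (grad hex.choose p) (grad hex.choose p)), mul_pos hc hsqrt, fun v => ?_⟩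
  rw [euclNormal, dif_pos hex, edot_smul_right, ← edot_self, hcv, mul_assoc,
    ← mul_assoc (√_), mul_inv_cancel₀ hsqrt.ne', one_mul, edot_grad]

end IsDefiningFunctionAt

namespace IsGTC

lemma isOpen (hU : IsGTC U) : IsOpen U := by
  rw [← disjoint_frontier_iff_isOpen, Set.disjoint_left]
  intro p hp
  obtain ⟨ρ, hρ⟩ := hU.smooth_boundary p hp
  exact hρ.notMem

lemma mem_frontier_iff (hU : IsGTC U) : p ∈ frontier U ↔ p ∈ closure U ∧ p ∉ U := by
  rw [hU.isOpen.frontier_eq, Set.mem_sdiff]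

lemma closure_mem_nhds (hU : IsGTC U) (hp : p ∈ U) : closure U ∈ 𝓝 p :=
  mem_of_superset (hU.isOpen.mem_nhds hp) subset_closure

lemma uniqueDiffOn (hU : IsGTC U) : UniqueDiffOn ℝ (closure U) := by
  intro p hp
  by_cases hpU : p ∈ U
  · exact uniqueDiffWithinAt_of_mem_nhds (hU.closure_mem_nhds hpU)
  · obtain ⟨ρ, hρ⟩ := hU.smooth_boundary p (hU.mem_frontier_iff.2 ⟨hp, hpU⟩)
    exact hρ.uniqueDiffWithinAt

lemma abs_grad_fst_lt_norm_grad_snd (hU : IsGTC U) (h : IsDefiningFunctionAt U p ρ) :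
    |(grad ρ p).1| < ‖(grad ρ p).2‖ := by
  have hspace := hU.timelike_boundary p h.mem_frontier ρ h
  rw [mink_self] at hspace
  exact abs_lt_of_sq_lt_sq (by linarith) (norm_nonneg _)

end IsGTC

end Spacetime

lemma not_isLocalMax_norm_sub {E : Type*} [NormedAddCommGroup E] [NormedSpace ℝ E] [Nontrivial E]
    (x₀ y : E) : ¬ IsLocalMax (fun z => ‖z - x₀‖) y := by
  intro hmax
  obtain ⟨u, hu⟩ : ∃ u : E, ∀ s : ℝ, 0 < s → ‖y - x₀‖ < ‖y + s • u - x₀‖ := by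
    by_cases hy : y = x₀
    · obtain ⟨u, hu⟩ := exists_ne (0 : E)
      exact ⟨u, fun s hs => by simp [hy, hs.ne', hu]⟩
    · refine ⟨y - x₀, fun s hs => ?_⟩
      have hpos := norm_pos_iff.2 (sub_ne_zero.2 hy)
      rw [show y + s • (y - x₀) - x₀ = (1 + s) • (y - x₀) by module, norm_smul,
        Real.norm_of_nonneg (by linarith)]
      nlinarith
  obtain ⟨s, hle, hs⟩ := (((tendsto_add_smul_nhdsGT y u).eventually hmax).and
    self_mem_nhdsWithin).exists
  exact (hu s hs).not_ge hle

lemma isClosed_setOf_exists_norm_sub_le {E : Type*} [NormedAddCommGroup E]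
    [ProperSpace E] {F : Set (ℝ × E)} (hF : IsClosed F) (y : E) (b : ℝ) :
    IsClosed ({r | ∃ y', (r, y') ∈ F ∧ ‖y' - y‖ ≤ r} ∩ Icc 0 b) := by
  have hcompact : IsCompact ((Icc 0 b ×ˢ Metric.closedBall y b) ∩
      (F ∩ {q : ℝ × E | ‖q.2 - y‖ ≤ q.1})) :=
    (isCompact_Icc.prod (isCompact_closedBall y b)).inter_right
      (hF.inter (isClosed_le (by fun_prop) continuous_fst))
  convert (hcompact.image continuous_fst).isClosed using 1
  ext r
  simp only [mem_inter_iff, mem_ofPred_eq, mem_image, mem_prod, Metric.mem_closedBall,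
    dist_eq_norm, Prod.exists]
  constructor
  · rintro ⟨⟨y', hF, hle⟩, hr⟩
    exact ⟨r, y', ⟨⟨hr, hle.trans hr.2⟩, hF, hle⟩, rfl⟩
  · rintro ⟨r', y', ⟨⟨hr, -⟩, hF, hle⟩, rfl⟩
    exact ⟨⟨y', hF, hle⟩, hr⟩

namespace Spacetime.IsGTC

variable {n : ℕ} {U : Set (Spacetime n)} {p : Spacetime n}

-- As the boundary is timelike, the inward spatial normal with a time component `|σ| ≤ 1` added
-- still points into `U`.
lemma exists_velocity_eventually_mem (hU : IsGTC U) (hp : p ∈ closure U) {σ : ℝ} (hσ : |σ| ≤ 1) :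
    ∃ w : EuclideanSpace ℝ (Fin n), ‖w‖ ≤ 1 ∧
      ∀ᶠ s in 𝓝[>] (0 : ℝ), p + s • ((σ, w) : Spacetime n) ∈ U := by
  by_cases hpU : p ∈ U
  · exact ⟨0, by simp, (tendsto_add_smul_nhdsGT _ _).eventually (hU.isOpen.mem_nhds hpU)⟩
  obtain ⟨ρ, hρ⟩ := hU.smooth_boundary _ (hU.mem_frontier_iff.2 ⟨hp, hpU⟩)
  have hlt := hU.abs_grad_fst_lt_norm_grad_snd hρ
  set g := grad ρ p with hg
  have hpos : 0 < ‖g.2‖ := (abs_nonneg _).trans_lt hlt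
  refine ⟨-(‖g.2‖⁻¹ • g.2), ?_, hρ.eventually_mem ?_⟩
  · rw [norm_neg, norm_smul, norm_inv, norm_norm, inv_mul_cancel₀ hpos.ne']
  · have htime : σ * g.1 ≤ |g.1| := (le_abs_self _).trans <| by
      rw [abs_mul]
      exact mul_le_of_le_one_left (abs_nonneg _) hσ
    have hspace : ‖g.2‖⁻¹ * ‖g.2‖ ^ 2 = ‖g.2‖ := by field_simp
    rw [← edot_grad, ← hg, edot, inner_neg_left, inner_smul_left, real_inner_self_eq_norm_sq,
      conj_trivial, hspace]
    linarith

lemma mem_closure_slice (hU : IsGTC U) {τ : ℝ} {y : EuclideanSpace ℝ (Fin n)}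
    (hy : (τ, y) ∈ closure U) : y ∈ closure (slice U τ) := by
  obtain ⟨w, -, hw⟩ := hU.exists_velocity_eventually_mem hy (σ := 0) (by simp)
  exact mem_closure_of_tendsto (tendsto_add_smul_nhdsGT y w)
    (hw.mono fun s hs => by simpa [slice] using hs)

lemma exists_mem_closure_add_mul (hU : IsGTC U) {τ σ r : ℝ} {y : EuclideanSpace ℝ (Fin n)}
    (hy : (τ, y) ∈ closure U) (hσ : |σ| ≤ 1) (hr : 0 ≤ r) :
    ∃ y', (τ + σ * r, y') ∈ closure U ∧ ‖y' - y‖ ≤ r := by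
  have hclosed : IsClosed {q : Spacetime n | (τ + σ * q.1, q.2) ∈ closure U} :=
    isClosed_closure.preimage (by fun_prop)
  refine IsClosed.Icc_subset_of_forall_exists_gt (isClosed_setOf_exists_norm_sub_le hclosed y r)
    ⟨y, by simpa using hy, by simp⟩ ?_ (right_mem_Icc.2 hr)
  rintro r₁ ⟨⟨y₁, hmem, hle⟩, -⟩ r₂ hr₂
  obtain ⟨w, hw, hev⟩ := hU.exists_velocity_eventually_mem hmem hσ
  obtain ⟨s, hs, hs0, hs1⟩ := (hev.and (Ioo_mem_nhdsGT (sub_pos.2 hr₂))).exists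
  refine ⟨r₁ + s, ⟨y₁ + s • w, subset_closure ?_, ?_⟩, by linarith, by linarith⟩
  · convert hs using 1
    ext1
    · simp
      ring
    · simp
  · calc ‖y₁ + s • w - y‖ = ‖(y₁ - y) + s • w‖ := by rw [add_sub_right_comm]
      _ ≤ ‖y₁ - y‖ + ‖s • w‖ := norm_add_le _ _
      _ ≤ r₁ + s := by
        rw [norm_smul, Real.norm_of_nonneg hs0.le]
        nlinarith

lemma exists_mem_closure_norm_sub_le (hU : IsGTC U) {τ : ℝ} {y : EuclideanSpace ℝ (Fin n)}
    (hy : (τ, y) ∈ closure U) (τ' : ℝ) :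
    ∃ y', (τ', y') ∈ closure U ∧ ‖y' - y‖ ≤ |τ' - τ| := by
  rcases le_total τ τ' with h | h
  · simpa [abs_of_nonneg (sub_nonneg.2 h)] using
      hU.exists_mem_closure_add_mul hy (σ := 1) (by simp) (sub_nonneg.2 h)
  · simpa [abs_of_nonpos (sub_nonpos.2 h)] using
      hU.exists_mem_closure_add_mul hy (σ := -1) (by simp) (sub_nonneg.2 h)

lemma exists_mem_frontier_forall_norm_sub_le (hU : IsGTC U) (hn : 1 ≤ n)
    (x₀ : EuclideanSpace ℝ (Fin n)) (τ : ℝ) :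
    ∃ y, (τ, y) ∈ frontier U ∧ ∀ z, (τ, z) ∈ closure U → ‖z - x₀‖ ≤ ‖y - x₀‖ := by
  obtain ⟨y, hy, hmax⟩ := (hU.slice_bounded τ).isCompact_closure.exists_isMaxOn
    (hU.slice_nonempty τ).closure (f := fun y => ‖y - x₀‖) (by fun_prop)
  have hmaps : MapsTo (fun z => (τ, z)) (slice U τ) U := fun z hz => hz
  refine ⟨y, hU.mem_frontier_iff.2 ⟨hmaps.closure (by fun_prop) hy, fun hyU => ?_⟩,
    fun z hz => hmax (hU.mem_closure_slice hz)⟩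
  have : Nonempty (Fin n) := ⟨⟨0, hn⟩⟩
  refine not_isLocalMax_norm_sub x₀ y ?_
  filter_upwards [(hU.slice_open τ).mem_nhds hyU] with z hz
  exact hmax (subset_closure hz)

lemma norm_sub_le_boundaryRadius (hU : IsGTC U) (hn : 1 ≤ n) {x₀ y : EuclideanSpace ℝ (Fin n)}
    {τ : ℝ} (hy : (τ, y) ∈ closure U) : ‖y - x₀‖ ≤ boundaryRadius U x₀ τ := by
  obtain ⟨z, hz, hmax⟩ := hU.exists_mem_frontier_forall_norm_sub_le hn x₀ τ
  refine (hmax y hy).trans (le_csSup ⟨‖z - x₀‖, ?_⟩ ⟨z, hz, rfl⟩)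
  rintro _ ⟨w, hw, rfl⟩
  exact hmax w (frontier_subset_closure hw)

lemma boundaryRadius_pos (hU : IsGTC U) (hn : 1 ≤ n) (x₀ : EuclideanSpace ℝ (Fin n)) (τ : ℝ) :
    0 < boundaryRadius U x₀ τ := by
  have : Nonempty (Fin n) := ⟨⟨0, hn⟩⟩
  by_contra! hradius
  have hsub : slice U τ ⊆ {x₀} := fun y hy => sub_eq_zero.1 <| norm_le_zero_iff.1 <|
    (hU.norm_sub_le_boundaryRadius hn (subset_closure hy)).trans hradius
  rw [(hU.slice_nonempty τ).subset_singleton_iff] at hsub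
  exact not_isOpen_singleton x₀ (hsub ▸ hU.slice_open τ)

lemma boundaryRadius_le_add (hU : IsGTC U) (hn : 1 ≤ n) (x₀ : EuclideanSpace ℝ (Fin n))
    (τ τ' : ℝ) : boundaryRadius U x₀ τ ≤ boundaryRadius U x₀ τ' + |τ' - τ| := by
  obtain ⟨z, hz, -⟩ := hU.exists_mem_frontier_forall_norm_sub_le hn x₀ τ
  refine csSup_le ⟨_, z, hz, rfl⟩ ?_
  rintro _ ⟨y, hy, rfl⟩
  obtain ⟨y', hy', hle⟩ := hU.exists_mem_closure_norm_sub_le (frontier_subset_closure hy) τ'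
  calc ‖y - x₀‖ = ‖(y' - x₀) - (y' - y)‖ := by rw [sub_sub_sub_cancel_left]
    _ ≤ ‖y' - x₀‖ + ‖y' - y‖ := norm_sub_le _ _
    _ ≤ _ := add_le_add (hU.norm_sub_le_boundaryRadius hn hy') hle

lemma isCompact_slab (hU : IsGTC U) (hn : 1 ≤ n) (a b : ℝ) :
    IsCompact (closure U ∩ Prod.fst ⁻¹' Icc a b) := by
  refine IsCompact.of_isClosed_subset ((isCompact_Icc (a := a) (b := b)).prod (isCompact_closedBall
    (0 : EuclideanSpace ℝ (Fin n)) (boundaryRadius U 0 a + (b - a))))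
    (isClosed_closure.inter (isClosed_Icc.preimage continuous_fst)) ?_
  rintro ⟨t, y⟩ ⟨hmem, hta : a ≤ t, htb : t ≤ b⟩
  refine ⟨⟨hta, htb⟩, ?_⟩
  have hnorm := hU.norm_sub_le_boundaryRadius hn (x₀ := 0) hmem
  have hradius := hU.boundaryRadius_le_add hn 0 t a
  rw [abs_of_nonpos (by linarith)] at hradius
  rw [sub_zero] at hnorm
  rw [mem_closedBall_zero_iff]
  linarith

end Spacetime.IsGTC

section ImplicitFunction

variable {E : Type*} [NormedAddCommGroup E]

lemma exists_contDiff_eventuallyEq_of_contDiffAt [InnerProductSpace ℝ E] [FiniteDimensional ℝ E]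
    {m : ℕ} {f : E → ℝ} {x : E} (hf : ContDiffAt ℝ m f x) :
    ∃ g : E → ℝ, ContDiff ℝ m g ∧ g =ᶠ[𝓝 x] f := by
  obtain ⟨r, hr, hball⟩ := Metric.eventually_nhds_iff_ball.1 (hf.eventually (by simp))
  let b : ContDiffBump x := ⟨r / 4, r / 2, by positivity, by linarith⟩
  refine ⟨fun y => b y * f y, contDiff_iff_contDiffAt.2 fun y => ?_, ?_⟩
  · by_cases hy : y ∈ tsupport (fun y => b y * f y)
    · have hy' : y ∈ tsupport b := closure_mono (Function.support_mul_subset_left _ _) hy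
      rw [b.tsupport_eq] at hy'
      exact b.contDiff.contDiffAt.mul
        (hball y (Metric.closedBall_subset_ball (half_lt_self hr) hy'))
    · exact contDiffAt_const.congr_of_eventuallyEq (notMem_tsupport_iff_eventuallyEq.1 hy)
  · filter_upwards [b.eventuallyEq_one] with y hy
    simp [hy]

lemma exists_contDiff_implicit [InnerProductSpace ℝ E] [FiniteDimensional ℝ E]
    {f : E × ℝ → ℝ} {u : E × ℝ} (hf : ContDiffAt ℝ 2 f u) (h0 : f u = 0)
    (hu : fderiv ℝ f u (0, 1) ≠ 0) :
    ∃ ψ : E → ℝ, ContDiff ℝ 2 ψ ∧ ψ u.1 = u.2 ∧ ∀ᶠ y in 𝓝 u.1, f (y, ψ y) = 0 := by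
  have hinv : (fderiv ℝ f u ∘L .inr ℝ E ℝ).IsInvertible := by
    refine ContinuousLinearMap.IsInvertible.of_inverse
      (g := (fderiv ℝ f u (0, 1))⁻¹ • ContinuousLinearMap.id ℝ ℝ) ?_ ?_
    · ext
      simp [hu]
    · ext
      simp [hu]
  obtain ⟨ψ, hψ, heq⟩ := exists_contDiff_eventuallyEq_of_contDiffAt (m := 2)
    (hf.contDiffAt_implicitFunction (by simp) hinv)
  refine ⟨ψ, hψ, heq.self_of_nhds.trans (hf.implicitFunction_apply_self _ _), ?_⟩
  filter_upwards [hf.eventually_apply_implicitFunction (by simp) hinv, heq] with y hy hψy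
  rw [hψy, hy, h0]

variable [NormedSpace ℝ E]

lemma eventually_neg_iff_lt_of_implicit {f : E × ℝ → ℝ} {ψ : E → ℝ} {u : E × ℝ}
    (hf : ContDiffAt ℝ 1 f u) (hu : 0 < fderiv ℝ f u (0, 1)) (hψ : ContinuousAt ψ u.1)
    (hψu : ψ u.1 = u.2) (hzero : ∀ᶠ y in 𝓝 u.1, f (y, ψ y) = 0) :
    ∀ᶠ z in 𝓝 u, (f z < 0 ↔ z.2 < ψ z.1) := by
  have hpos : ∀ᶠ z in 𝓝 u, 0 < fderiv ℝ f z (0, 1) :=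
    ((hf.fderiv_right (m := 0) (by norm_num)).continuousAt.clm_apply
      continuousAt_const).eventually (lt_mem_nhds hu)
  have hdiff : ∀ᶠ z in 𝓝 u, DifferentiableAt ℝ f z :=
    (hf.eventually (by simp)).mono fun z hz => hz.differentiableAt (by simp)
  obtain ⟨r, hr, hball⟩ := Metric.eventually_nhds_iff_ball.1 (hpos.and hdiff)
  have hψr : ∀ᶠ y in 𝓝 u.1, ψ y ∈ Metric.ball u.2 r :=
    hψ.eventually (by rw [hψu]; exact Metric.ball_mem_nhds u.2 hr)
  filter_upwards [Metric.ball_mem_nhds u hr,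
    (continuous_fst.tendsto u).eventually (hψr.and hzero)] with z hz ⟨hzψ, hz0⟩
  rw [← ball_prod_same] at hz
  have hmem : ∀ s ∈ Metric.ball u.2 r, (z.1, s) ∈ Metric.ball u r := fun s hs => by
    rw [← ball_prod_same]
    exact ⟨hz.1, hs⟩
  have hderiv : ∀ s ∈ Metric.ball u.2 r,
      HasDerivAt (fun s => f (z.1, s)) (fderiv ℝ f (z.1, s) (0, 1)) s := fun s hs =>
    (hball _ (hmem s hs)).2.hasFDerivAt.comp_hasDerivAt s
      ((hasDerivAt_const s z.1).prodMk (hasDerivAt_id s))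
  have hmono : StrictMonoOn (fun s => f (z.1, s)) (Metric.ball u.2 r) := by
    refine strictMonoOn_of_deriv_pos (convex_ball _ _)
      (fun s hs => (hderiv s hs).continuousAt.continuousWithinAt) fun s hs => ?_
    rw [Metric.isOpen_ball.interior_eq] at hs
    rw [(hderiv s hs).deriv]
    exact (hball _ (hmem s hs)).1
  simpa only [hz0] using hmono.lt_iff_lt hz.2 hzψ

lemma fderiv_apply_of_implicit {f : E × ℝ → ℝ} {ψ : E → ℝ} {y : E}
    (hf : DifferentiableAt ℝ f (y, ψ y)) (hψ : DifferentiableAt ℝ ψ y)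
    (hzero : ∀ᶠ y in 𝓝 y, f (y, ψ y) = 0) (v : E × ℝ) :
    fderiv ℝ f (y, ψ y) v = fderiv ℝ f (y, ψ y) (0, 1) * (v.2 - fderiv ℝ ψ y v.1) := by
  have hcomp := hf.hasFDerivAt.comp y ((hasFDerivAt_id y).prodMk hψ.hasFDerivAt)
  have hconst : HasFDerivAt (fun y => f (y, ψ y)) (0 : E →L[ℝ] ℝ) y :=
    (hasFDerivAt_const 0 y).congr_of_eventuallyEq hzero
  have htangent : fderiv ℝ f (y, ψ y) (v.1, fderiv ℝ ψ y v.1) = 0 := by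
    simpa using DFunLike.congr_fun (hcomp.unique hconst) v.1
  have hv : v = (v.1, fderiv ℝ ψ y v.1) + (v.2 - fderiv ℝ ψ y v.1) • ((0, 1) : E × ℝ) := by
    ext <;> simp
  conv_lhs => rw [hv]
  rw [map_add, htangent, map_smul, smul_eq_mul, zero_add, mul_comm]

lemma exists_contDiff_implicit_graph {F : Type*} [NormedAddCommGroup F] [InnerProductSpace ℝ F]
    [FiniteDimensional ℝ F] {f : F × ℝ → ℝ} {u : F × ℝ} (hf : ContDiffAt ℝ 2 f u) (h0 : f u = 0)
    (hu : 0 < fderiv ℝ f u (0, 1)) :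
    ∃ ψ : F → ℝ, ContDiff ℝ 2 ψ ∧ ∀ᶠ z in 𝓝 u, (f z < 0 ↔ z.2 < ψ z.1) ∧
      (z.2 = ψ z.1 → f z = 0 ∧ 0 < fderiv ℝ f z (0, 1) ∧
        ∀ v, fderiv ℝ f z v = fderiv ℝ f z (0, 1) * (v.2 - fderiv ℝ ψ z.1 v.1)) := by
  obtain ⟨ψ, hψ, hψu, hzero⟩ := exists_contDiff_implicit hf h0 hu.ne'
  have hpos : ∀ᶠ z in 𝓝 u, 0 < fderiv ℝ f z (0, 1) :=
    ((hf.fderiv_right (m := 1) (by norm_num)).continuousAt.clm_apply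
      continuousAt_const).eventually (lt_mem_nhds hu)
  refine ⟨ψ, hψ, ?_⟩
  filter_upwards [eventually_neg_iff_lt_of_implicit (hf.of_le (by norm_num)) hu
      hψ.continuous.continuousAt hψu hzero, hpos, hf.eventually (by simp),
    (continuous_fst.tendsto u).eventually (eventually_eventually_nhds.2 hzero)]
    with ⟨y, s⟩ hsign hposz hfz hzeroz
  refine ⟨hsign, fun hs => ?_⟩
  obtain rfl : s = ψ y := hs
  exact ⟨hzeroz.self_of_nhds, hposz, fderiv_apply_of_implicit (hfz.differentiableAt two_ne_zero)
    (hψ.differentiable two_ne_zero y) hzeroz⟩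

end ImplicitFunction

namespace Spacetime

variable {n : ℕ} {U : Set (Spacetime n)} {p : Spacetime n}

/-- The linear map that exchanges `t` with `ε xₖ`; for `ε = ±1` it is a Euclidean reflection, used
to write a timelike boundary as a graph over the hyperplane `xₖ = 0`. -/
noncomputable def flip (k : Fin n) (ε : ℝ) : Spacetime n →L[ℝ] Spacetime n :=
  (ε • (EuclideanSpace.proj k ∘L ContinuousLinearMap.snd ℝ ℝ (EuclideanSpace ℝ (Fin n)))).prod
    (ContinuousLinearMap.snd ℝ ℝ _ +
      (ε • ContinuousLinearMap.fst ℝ ℝ _ -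
        EuclideanSpace.proj k ∘L ContinuousLinearMap.snd ℝ ℝ _).smulRight
        (EuclideanSpace.single k (1 : ℝ)))

lemma flip_fst (k : Fin n) (ε : ℝ) (p : Spacetime n) : (flip k ε p).1 = ε * p.2 k := by
  simp [flip]

lemma flip_snd (k : Fin n) (ε : ℝ) (p : Spacetime n) (i : Fin n) :
    (flip k ε p).2 i = if i = k then ε * p.1 else p.2 i := by
  rcases eq_or_ne i k with rfl | h
  · simp [flip]
  · simp [flip, h]

lemma flip_flip (k : Fin n) {ε : ℝ} (hε : ε * ε = 1) (p : Spacetime n) :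
    flip k ε (flip k ε p) = p := by
  ext1
  · rw [flip_fst, flip_snd, if_pos rfl, ← mul_assoc, hε, one_mul]
  · ext i
    rw [flip_snd, flip_fst, flip_snd]
    split_ifs with h
    · rw [← mul_assoc, hε, one_mul, h]
    · rfl

lemma flip_eT (k : Fin n) (ε : ℝ) : flip k ε eT = ε • eX k := by
  ext1
  · simp [flip_fst, eT, eX]
  · ext i
    rw [flip_snd]
    by_cases h : i = k <;> simp [eT, eX, h]

lemma flip_eX_self (k : Fin n) (ε : ℝ) : flip k ε (eX k) = ε • eT := by
  ext1
  · simp [flip_fst, eT, eX]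
  · ext i
    rw [flip_snd]
    by_cases h : i = k <;> simp [eT, eX, h]

lemma flip_eX_of_ne {k i : Fin n} (h : i ≠ k) (ε : ℝ) : flip k ε (eX i) = eX i := by
  ext1
  · simp [flip_fst, eX, h.symm]
  · ext j
    rw [flip_snd]
    rcases eq_or_ne j k with rfl | hj
    · simp [eX, h.symm]
    · simp [eX, hj]

lemma edot_flip (k : Fin n) {ε : ℝ} (hε : ε * ε = 1) (v w : Spacetime n) :
    edot (flip k ε v) (flip k ε w) = edot v w := by
  have hrest : ∑ i ∈ Finset.univ.erase k, (flip k ε v).2 i * (flip k ε w).2 i =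
      ∑ i ∈ Finset.univ.erase k, v.2 i * w.2 i := by
    refine Finset.sum_congr rfl fun i hi => ?_
    rw [flip_snd, flip_snd, if_neg (Finset.ne_of_mem_erase hi),
      if_neg (Finset.ne_of_mem_erase hi)]
  rw [edot_eq_sum, edot_eq_sum, ← Finset.add_sum_erase _ _ (Finset.mem_univ k), hrest,
    ← Finset.add_sum_erase _ (fun i => v.2 i * w.2 i) (Finset.mem_univ k)]
  simp only [flip_fst, flip_snd, if_true]
  linear_combination (v.2 k * w.2 k + v.1 * w.1) * hε

instance isAddHaarMeasure_volume : (volume : Measure (Spacetime n)).IsAddHaarMeasure :=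
  Measure.prod.instIsAddHaarMeasure (volume : Measure ℝ)
    (volume : Measure (EuclideanSpace ℝ (Fin n)))

lemma measurePreserving_flip (k : Fin n) {ε : ℝ} (hε : ε * ε = 1) :
    MeasurePreserving (flip k ε : Spacetime n → Spacetime n) := by
  refine ⟨(flip k ε).continuous.measurable, ?_⟩
  have hdet : (flip k ε).toLinearMap.det * (flip k ε).toLinearMap.det = 1 := by
    rw [← map_mul, ← LinearMap.det_id (A := ℝ) (M := Spacetime n)]
    exact congrArg LinearMap.det (LinearMap.ext (flip_flip k hε))
  have habs : |(flip k ε).toLinearMap.det| = 1 := by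
    rcases mul_self_eq_one_iff.1 hdet with h | h <;> simp [h]
  have hmap := Measure.map_linearMap_addHaar_eq_smul_addHaar (volume : Measure (Spacetime n))
    (f := (flip k ε).toLinearMap) (fun h => by simp [h] at hdet)
  rwa [abs_inv, habs, inv_one, ENNReal.ofReal_one, one_smul] at hmap

/-- `W` is an open set in which, after the linear change of coordinates `L`, the set `U` is the
region below the graph of `ψ`, and the differential of `s - ψ(y)` is conormal to the graph. -/
structure IsGraphPatch (U W : Set (Spacetime n)) (L : Spacetime n →L[ℝ] Spacetime n)
    (ψ : EuclideanSpace ℝ (Fin n) → ℝ) : Prop where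
  isOpen : IsOpen W
  mem_iff : ∀ q ∈ W, (q ∈ U ↔ (L q).1 < ψ (L q).2)
  exists_fderiv_eq : ∀ q ∈ W, (L q).1 = ψ (L q).2 → ∃ ρ, IsDefiningFunctionAt U q ρ ∧
    ∃ c : ℝ, 0 < c ∧ ∀ v, fderiv ℝ ρ q v = c * ((L v).1 - fderiv ℝ ψ (L q).2 (L v).2)

lemma IsGTC.exists_fderiv_flip_eT_pos (hU : IsGTC U) {ρ : Spacetime n → ℝ}
    (hρ : IsDefiningFunctionAt U p ρ) :
    ∃ (k : Fin n) (ε : ℝ), ε * ε = 1 ∧ 0 < fderiv ℝ ρ p (flip k ε eT) := by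
  obtain ⟨k, hk⟩ : ∃ k, fderiv ℝ ρ p (eX k) ≠ 0 := by
    by_contra! hzero
    have hgrad : (grad ρ p).2 = 0 := by
      ext i
      simp [grad, hzero]
    have hlt := hU.abs_grad_fst_lt_norm_grad_snd hρ
    rw [hgrad, norm_zero] at hlt
    exact hlt.not_ge (abs_nonneg _)
  rcases lt_or_gt_of_ne hk with h | h
  · exact ⟨k, -1, by norm_num, by simpa [flip_eT] using h⟩
  · exact ⟨k, 1, by norm_num, by simpa [flip_eT] using h⟩

lemma IsDefiningFunctionAt.exists_graphPatch {ρ : Spacetime n → ℝ}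
    (hρ : IsDefiningFunctionAt U p ρ) (k : Fin n) {ε : ℝ} (hε : ε * ε = 1)
    (hpos : 0 < fderiv ℝ ρ p (flip k ε eT)) :
    ∃ (ψ : EuclideanSpace ℝ (Fin n) → ℝ) (W : Set (Spacetime n)),
      ContDiff ℝ 2 ψ ∧ p ∈ W ∧ IsGraphPatch U W (flip k ε) ψ := by
  let N : Spacetime n ≃L[ℝ] EuclideanSpace ℝ (Fin n) × ℝ :=
    (ContinuousLinearEquiv.equivOfInverse (flip k ε) (flip k ε) (flip_flip k hε)
      (flip_flip k hε)).trans (.prodComm ℝ ℝ _)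
  set f : EuclideanSpace ℝ (Fin n) × ℝ → ℝ := ρ ∘ N.symm with hf
  have hfN : ∀ q, f (N q) = ρ q := fun q => by simp [hf]
  have hfderiv : ∀ q v, fderiv ℝ f (N q) v = fderiv ℝ ρ q (N.symm v) := fun q v => by
    rw [hf, N.symm.comp_right_fderiv, N.symm_apply_apply]
    rfl
  have hfC2 : ContDiffAt ℝ 2 f (N p) :=
    ContDiffAt.comp _ (by rw [N.symm_apply_apply]; exact hρ.contDiffAt.of_le (by norm_cast))
      N.symm.contDiff.contDiffAt
  obtain ⟨ψ, hψ, hgraph⟩ := exists_contDiff_implicit_graph hfC2 ((hfN p).trans hρ.1)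
    (by rw [hfderiv]; exact hpos)
  obtain ⟨W, hW, hWo, hpW⟩ := eventually_nhds_iff.1 <| hρ.eventually_mem_iff.and <|
    hρ.eventually_isDefiningFunctionAt.and ((N.continuous.tendsto p).eventually hgraph)
  refine ⟨ψ, W, hψ, hpW, hWo, fun q hq => ?_, fun q hq hqψ => ?_⟩
  · obtain ⟨hmem, -, hlt, -⟩ := hW q hq
    rw [hfN] at hlt
    exact hmem.trans hlt
  · obtain ⟨-, hdef, -, hN⟩ := hW q hq
    obtain ⟨hzero, hposq, hv⟩ := hN hqψ
    refine ⟨ρ, hdef (by rwa [hfN] at hzero), _, hposq, fun v => ?_⟩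
    have hNv := hv (N v)
    rw [hfderiv q (N v), N.symm_apply_apply] at hNv
    exact hNv

lemma IsGTC.exists_graphPatch (hU : IsGTC U) (hp : p ∈ frontier U) :
    ∃ (k : Fin n) (ε : ℝ) (ψ : EuclideanSpace ℝ (Fin n) → ℝ) (W : Set (Spacetime n)),
      ε * ε = 1 ∧ ContDiff ℝ 2 ψ ∧ p ∈ W ∧ IsGraphPatch U W (flip k ε) ψ := by
  obtain ⟨ρ, hρ⟩ := hU.smooth_boundary p hp
  obtain ⟨k, ε, hε, hpos⟩ := hU.exists_fderiv_flip_eT_pos hρ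
  obtain ⟨ψ, W, h⟩ := hρ.exists_graphPatch k hε hpos
  exact ⟨k, ε, ψ, W, hε, h⟩

end Spacetime

section HalfSpace

lemma integrableOn_fderiv_apply {E F : Type*} [NormedAddCommGroup E] [NormedSpace ℝ E]
    [MeasurableSpace E] [BorelSpace E] [NormedAddCommGroup F] [NormedSpace ℝ F]
    {μ : Measure E} [IsFiniteMeasureOnCompacts μ] {V : E → F} {D O : Set E}
    (hD : UniqueDiffOn ℝ D) (hDc : IsClosed D) (hO : IsOpen O) (hOD : O ⊆ D)
    (hV : ContDiffOn ℝ 1 V D) (hc : HasCompactSupport V) (v : E) :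
    IntegrableOn (fun p => fderiv ℝ V p v) O μ := by
  have hcont : ContinuousOn (fun p => fderivWithin ℝ V D p v) (tsupport V ∩ D) :=
    ((hV.continuousOn_fderivWithin hD (by simp)).clm_apply continuousOn_const).mono
      inter_subset_right
  have hint : IntegrableOn (fun p => fderivWithin ℝ V D p v) (O ∩ tsupport V) μ :=
    (hcont.integrableOn_compact (hc.isCompact.inter_right hDc)).mono_set fun p hp =>
      ⟨hp.2, hOD hp.1⟩
  have hmeas : MeasurableSet (O ∩ tsupport V) :=
    hO.measurableSet.inter (isClosed_tsupport V).measurableSet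
  refine (hint.congr_fun (fun p hp => ?_) hmeas).of_forall_sdiff_eq_zero hO.measurableSet
    fun p hp => ?_
  · rw [fderivWithin_of_mem_nhds (mem_of_superset (hO.mem_nhds hp.1) hOD)]
  · have hp' : p ∉ tsupport V := fun h => hp.2 ⟨hp.1, h⟩
    rw [(notMem_tsupport_iff_eventuallyEq.1 hp').fderiv_eq]
    simp

variable {E : Type*} [NormedAddCommGroup E] [NormedSpace ℝ E] {g : ℝ × E → ℝ}

lemma differentiableAt_of_contDiffOn_halfSpace {F : Type*} [NormedAddCommGroup F]
    [NormedSpace ℝ F] {g : ℝ × E → F} (hg : ContDiffOn ℝ 1 g (Prod.fst ⁻¹' Iic 0))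
    {q : ℝ × E} (hq : q.1 < 0) : DifferentiableAt ℝ g q := by
  have hq' : Prod.fst ⁻¹' Iic (0 : ℝ) ∈ 𝓝 q := continuous_fst.continuousAt (Iic_mem_nhds hq)
  exact (hg.contDiffAt hq').differentiableAt one_ne_zero

lemma integrableOn_fderiv_apply_halfSpace [MeasurableSpace E] [BorelSpace E]
    [SecondCountableTopology E] {μ : Measure E} [IsFiniteMeasureOnCompacts μ] [SFinite μ]
    (hg : ContDiffOn ℝ 1 g (Prod.fst ⁻¹' Iic 0)) (hc : HasCompactSupport g) (v : ℝ × E) :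
    IntegrableOn (fun q => fderiv ℝ g q v) (Prod.fst ⁻¹' Iio 0) (volume.prod μ) := by
  refine integrableOn_fderiv_apply ?_ (isClosed_Iic.preimage continuous_fst)
    (isOpen_Iio.preimage continuous_fst) (preimage_mono Iio_subset_Iic_self) hg hc v
  rw [← prod_univ]
  exact (uniqueDiffOn_Iic 0).prod uniqueDiffOn_univ

lemma restrict_halfSpace {E : Type*} [MeasurableSpace E] (μ : Measure E) [SFinite μ] :
    (volume.prod μ).restrict (Prod.fst ⁻¹' Iio 0) =
      ((volume : Measure ℝ).restrict (Iio 0)).prod μ := by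
  rw [← prod_univ, ← Measure.prod_restrict, Measure.restrict_univ]

lemma setIntegral_halfSpace_fderiv_one_zero [MeasurableSpace E] [BorelSpace E]
    [SecondCountableTopology E] {μ : Measure E} [IsFiniteMeasureOnCompacts μ] [SFinite μ]
    (hg : ContDiffOn ℝ 1 g (Prod.fst ⁻¹' Iic 0)) (hc : HasCompactSupport g) :
    ∫ q in Prod.fst ⁻¹' Iio 0, fderiv ℝ g q (1, 0) ∂(volume.prod μ) = ∫ y, g (0, y) ∂μ := by
  have hint := integrableOn_fderiv_apply_halfSpace (μ := μ) hg hc (1, 0)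
  rw [IntegrableOn, restrict_halfSpace] at hint
  rw [restrict_halfSpace, integral_prod_symm _ hint]
  refine integral_congr_ae ?_
  filter_upwards [hint.prod_left_ae] with y hy
  have hlim : Tendsto (fun s : ℝ => g (s, y)) atBot (𝓝 0) := by
    obtain ⟨R, hR⟩ := (hc.isCompact.image continuous_fst).bddBelow
    refine tendsto_const_nhds.congr' ?_
    filter_upwards [eventually_lt_atBot R] with s hs
    exact (image_eq_zero_of_notMem_tsupport fun h => hs.not_ge (hR ⟨_, h, rfl⟩)).symm
  have hcont : ContinuousWithinAt (fun s : ℝ => g (s, y)) (Iic 0) 0 :=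
    (hg.continuousOn (0, y) (by simp)).comp (f := fun s : ℝ => (s, y)) (by fun_prop) fun s hs => hs
  have hderiv : ∀ s ∈ Iio (0 : ℝ),
      HasDerivAt (fun s : ℝ => g (s, y)) (fderiv ℝ g (s, y) (1, 0)) s := fun s hs =>
    (differentiableAt_of_contDiffOn_halfSpace (q := (s, y)) hg hs).hasFDerivAt.comp_hasDerivAt s
      ((hasDerivAt_id s).prodMk (hasDerivAt_const s y))
  rw [← integral_Iic_eq_integral_Iio]
  simpa using integral_Iic_of_hasDerivAt_of_tendsto hcont hderiv
    ((integrableOn_Iic_iff_integrableOn_Iio).2 hy) hlim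

variable [FiniteDimensional ℝ E] [MeasurableSpace E] [BorelSpace E] {μ : Measure E}
  [μ.IsAddHaarMeasure]

lemma integral_fderiv_apply_eq_zero {g : E → ℝ} (hg : Differentiable ℝ g) {v : E}
    (hint : Integrable g μ) (hint' : Integrable (fun y => fderiv ℝ g y v) μ) :
    ∫ y, fderiv ℝ g y v ∂μ = 0 := by
  simpa using integral_mul_fderiv_eq_neg_fderiv_mul_of_integrable (μ := μ) (f := fun _ => (1 : ℝ))
    (g := g) (v := v) (by simp) (by simpa using hint') (by simpa using hint)
    (fun x _ => differentiableAt_const _) (fun x _ => hg x)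

lemma setIntegral_halfSpace_fderiv_zero_right (hg : ContDiffOn ℝ 1 g (Prod.fst ⁻¹' Iic 0))
    (hc : HasCompactSupport g) (v : E) :
    ∫ q in Prod.fst ⁻¹' Iio 0, fderiv ℝ g q (0, v) ∂(volume.prod μ) = 0 := by
  have hint := integrableOn_fderiv_apply_halfSpace (μ := μ) hg hc (0, v)
  rw [IntegrableOn, restrict_halfSpace] at hint
  rw [restrict_halfSpace, integral_prod _ hint]
  refine integral_eq_zero_of_ae ?_
  filter_upwards [hint.prod_right_ae, ae_restrict_mem measurableSet_Iio] with s hs hs0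
  have hslice : ∀ y, HasFDerivAt (fun y => g (s, y))
      (fderiv ℝ g (s, y) ∘L .inr ℝ ℝ E) y := fun y =>
    (differentiableAt_of_contDiffOn_halfSpace (q := (s, y)) hg hs0).hasFDerivAt.comp y
      (hasFDerivAt_prodMk_right s y)
  have hpartial : ∀ y, fderiv ℝ g (s, y) (0, v) = fderiv ℝ (fun y => g (s, y)) y v := fun y => by
    rw [(hslice y).fderiv]
    simp
  have hdiff : Differentiable ℝ fun y => g (s, y) := fun y => (hslice y).differentiableAt
  simp only [hpartial] at hs ⊢
  refine integral_fderiv_apply_eq_zero hdiff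
    (hdiff.continuous.integrable_of_hasCompactSupport ?_) hs
  exact HasCompactSupport.intro (hc.isCompact.image continuous_snd) fun y hy =>
    image_eq_zero_of_notMem_tsupport fun h => hy ⟨_, h, rfl⟩

end HalfSpace

namespace Spacetime

variable {n : ℕ} {V : Spacetime n → Spacetime n}

/-- The divergence of a vector field. -/
noncomputable def diverg (V : Spacetime n → Spacetime n) (p : Spacetime n) : ℝ :=
  (fderiv ℝ V p eT).1 + ∑ i, (fderiv ℝ V p (eX i)).2 i

lemma diverg_eq_fderiv_add_sum {p : Spacetime n} (hV : DifferentiableAt ℝ V p) :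
    diverg V p = fderiv ℝ (fun q => (V q).1) p eT +
      ∑ i, fderiv ℝ (fun q => (V q).2 i) p (eX i) := by
  have hX : ∀ i, HasFDerivAt (fun q => (V q).2 i)
      ((EuclideanSpace.proj i : _ →L[ℝ] ℝ) ∘L .snd ℝ ℝ _ ∘L fderiv ℝ V p) p := fun i =>
    (EuclideanSpace.proj i : _ →L[ℝ] ℝ).hasFDerivAt.comp p hV.hasFDerivAt.snd
  rw [hV.hasFDerivAt.fst.fderiv]
  simp only [fun i => (hX i).fderiv]
  rfl

lemma integral_diverg_halfSpace (hV : ContDiffOn ℝ 1 V (Prod.fst ⁻¹' Iic 0))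
    (hc : HasCompactSupport V) :
    ∫ q in Prod.fst ⁻¹' Iio 0, diverg V q = ∫ y, (V (0, y)).1 := by
  have hT : ContDiffOn ℝ 1 (fun q => (V q).1) (Prod.fst ⁻¹' Iic 0) := hV.fst
  have hX : ∀ i, ContDiffOn ℝ 1 (fun q => (V q).2 i) (Prod.fst ⁻¹' Iic 0) := fun i =>
    (EuclideanSpace.proj i : _ →L[ℝ] ℝ).contDiff.comp_contDiffOn hV.snd
  have hTc : HasCompactSupport fun q => (V q).1 := hc.comp_left (g := Prod.fst) rfl
  have hXc : ∀ i, HasCompactSupport fun q => (V q).2 i := fun i =>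
    hc.comp_left (g := fun v : Spacetime n => v.2 i) rfl
  have hdiverg : ∀ q ∈ (Prod.fst ⁻¹' Iio 0 : Set (Spacetime n)), diverg V q = _ := fun q hq =>
    diverg_eq_fderiv_add_sum (differentiableAt_of_contDiffOn_halfSpace hV hq)
  rw [setIntegral_congr_fun (isOpen_Iio.preimage continuous_fst).measurableSet hdiverg,
    Measure.volume_eq_prod, integral_add (integrableOn_fderiv_apply_halfSpace hT hTc _)
      (integrable_finsetSum _ fun i _ => integrableOn_fderiv_apply_halfSpace (hX i) (hXc i) _),
    integral_finsetSum _ fun i _ => integrableOn_fderiv_apply_halfSpace (hX i) (hXc i) _]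
  simp only [eT, eX, setIntegral_halfSpace_fderiv_one_zero hT hTc,
    setIntegral_halfSpace_fderiv_zero_right (hX _) (hXc _), Finset.sum_const_zero, add_zero]

end Spacetime

namespace Spacetime

variable {n : ℕ} {V : Spacetime n → Spacetime n} {ψ : EuclideanSpace ℝ (Fin n) → ℝ}

/-- The shear that carries the half-space `t < 0` to the region below the graph of `ψ`. -/
def shear (hψ : Continuous ψ) : Spacetime n ≃ₜ Spacetime n where
  toFun q := (q.1 + ψ q.2, q.2)
  invFun q := (q.1 - ψ q.2, q.2)
  left_inv q := by simp
  right_inv q := by simp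
  continuous_toFun := by fun_prop
  continuous_invFun := by fun_prop

lemma measurePreserving_shear (hψ : Continuous ψ) : MeasurePreserving (shear hψ) := by
  have hskew : MeasurePreserving (fun q : EuclideanSpace ℝ (Fin n) × ℝ => (q.1, q.2 + ψ q.1))
      (volume.prod volume) (volume.prod volume) := by
    refine (MeasurePreserving.id volume).skew_product (g := fun y s => s + ψ y) ?_ ?_
    · exact (by fun_prop : Continuous fun q : EuclideanSpace ℝ (Fin n) × ℝ =>
        q.2 + ψ q.1).measurable
    · exact Eventually.of_forall fun y => map_add_right_eq_self volume (ψ y)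
  exact (Measure.measurePreserving_swap.comp hskew).comp Measure.measurePreserving_swap

/-- The pullback of the vector field `V` under the shear along the graph of `ψ`. -/
noncomputable def shearPullback (ψ : EuclideanSpace ℝ (Fin n) → ℝ)
    (V : Spacetime n → Spacetime n) (q : Spacetime n) : Spacetime n :=
  ((V (q.1 + ψ q.2, q.2)).1 - fderiv ℝ ψ q.2 (V (q.1 + ψ q.2, q.2)).2, (V (q.1 + ψ q.2, q.2)).2)

lemma contDiffOn_shearPullback (hψ : ContDiff ℝ 2 ψ) (hV : ContDiffOn ℝ 1 V {q | q.1 ≤ ψ q.2}) :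
    ContDiffOn ℝ 1 (shearPullback ψ V) (Prod.fst ⁻¹' Iic 0) := by
  have hψ1 : ContDiff ℝ 1 ψ := hψ.of_le (by norm_num)
  have hdψ : ContDiff ℝ 1 (fderiv ℝ ψ) := hψ.fderiv_right (by norm_num)
  have hcomp : ContDiffOn ℝ 1 (fun q : Spacetime n => V (q.1 + ψ q.2, q.2)) (Prod.fst ⁻¹' Iic 0) :=
    hV.comp (f := fun q : Spacetime n => (q.1 + ψ q.2, q.2))
      ((contDiff_fst.add (hψ1.comp contDiff_snd)).prodMk contDiff_snd).contDiffOn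
      fun q (hq : q.1 ≤ 0) => add_le_of_nonpos_left hq
  exact (hcomp.fst.sub ((hdψ.comp contDiff_snd).contDiffOn.clm_apply hcomp.snd)).prodMk hcomp.snd

lemma hasCompactSupport_shearPullback (hψ : Continuous ψ) (hc : HasCompactSupport V) :
    HasCompactSupport (shearPullback ψ V) :=
  HasCompactSupport.intro (hc.comp_homeomorph (shear hψ)).isCompact fun q hq => by
    have hzero : V (q.1 + ψ q.2, q.2) = 0 :=
      image_eq_zero_of_notMem_tsupport (f := V ∘ shear hψ) hq
    simp [shearPullback, hzero]

lemma diverg_shearPullback (hψ : ContDiff ℝ 2 ψ) {q : Spacetime n}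
    (hV : DifferentiableAt ℝ V (q.1 + ψ q.2, q.2)) :
    diverg (shearPullback ψ V) q = diverg V (q.1 + ψ q.2, q.2) := by
  set A := fderiv ℝ V (q.1 + ψ q.2, q.2) with hA
  set b := fderiv ℝ ψ q.2 with hb
  have hsnd : HasFDerivAt (fun q : Spacetime n => q.2) (.snd ℝ ℝ _) q := hasFDerivAt_snd
  have hshear : HasFDerivAt (fun q : Spacetime n => (q.1 + ψ q.2, q.2))
      ((.fst ℝ ℝ _ + b ∘L .snd ℝ ℝ _ : Spacetime n →L[ℝ] ℝ).prod (.snd ℝ ℝ _)) q :=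
    (hasFDerivAt_fst.add ((hψ.differentiable (by norm_num) q.2).hasFDerivAt.comp q hsnd)).prodMk
      hsnd
  have hVΨ := hV.hasFDerivAt.comp q hshear
  have hdψ : HasFDerivAt (fun q : Spacetime n => fderiv ℝ ψ q.2)
      (fderiv ℝ (fderiv ℝ ψ) q.2 ∘L .snd ℝ ℝ _) q :=
    (((hψ.fderiv_right (m := 1) (by norm_num)).differentiable
      (by norm_num) q.2).hasFDerivAt).comp q hsnd
  have hD : fderiv ℝ (shearPullback ψ V) q = _ :=
    ((hVΨ.fst.sub (hdψ.clm_apply hVΨ.snd)).prodMk hVΨ.snd).fderiv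
  have hT : (fderiv ℝ (shearPullback ψ V) q eT).1 = (A eT).1 - b (A eT).2 := by
    rw [hD]
    simp [eT, hA, hb]
  have hX : ∀ i, (fderiv ℝ (shearPullback ψ V) q (eX i)).2 i =
      b (EuclideanSpace.single i 1) * (A eT).2 i + (A (eX i)).2 i := by
    intro i
    have hAi : A (b (EuclideanSpace.single i 1), EuclideanSpace.single i 1) =
        b (EuclideanSpace.single i 1) • A eT + A (eX i) := by
      rw [← map_smul, ← map_add]
      simp [eT, eX]
    calc (fderiv ℝ (shearPullback ψ V) q (eX i)).2 i
        = (A (b (EuclideanSpace.single i 1), EuclideanSpace.single i 1)).2 i := by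
          rw [hD]
          simp [eX, hA]
      _ = _ := by
          rw [hAi]
          simp
  have hbA : b (A eT).2 = ∑ i, b (EuclideanSpace.single i 1) * (A eT).2 i := by
    conv_lhs => rw [← (EuclideanSpace.basisFun (Fin n) ℝ).sum_repr (A eT).2]
    simp [map_sum, mul_comm]
  simp only [diverg, hT, hX, Finset.sum_add_distrib, hbA]
  ring

lemma integral_diverg_graph (hψ : ContDiff ℝ 2 ψ) (hV : ContDiffOn ℝ 1 V {q | q.1 ≤ ψ q.2})
    (hc : HasCompactSupport V) :
    ∫ q in {q : Spacetime n | q.1 < ψ q.2}, diverg V q =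
      ∫ y, ((V (ψ y, y)).1 - fderiv ℝ ψ y (V (ψ y, y)).2) := by
  have hopen : IsOpen {q : Spacetime n | q.1 < ψ q.2} :=
    isOpen_lt continuous_fst (hψ.continuous.comp continuous_snd)
  have hpre : shear hψ.continuous ⁻¹' {q | q.1 < ψ q.2} = Prod.fst ⁻¹' Iio 0 := by
    ext q
    exact add_lt_iff_neg_right (ψ q.2)
  have hdiverg : ∀ q ∈ (Prod.fst ⁻¹' Iio 0 : Set (Spacetime n)),
      diverg V (shear hψ.continuous q) = diverg (shearPullback ψ V) q := fun q hq => by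
    rw [← hpre] at hq
    exact (diverg_shearPullback hψ ((hV.contDiffAt (mem_of_superset (hopen.mem_nhds hq)
      fun q (hq : q.1 < ψ q.2) => hq.le)).differentiableAt one_ne_zero)).symm
  rw [← (measurePreserving_shear hψ.continuous).setIntegral_preimage_emb
      (shear hψ.continuous).measurableEmbedding, hpre,
    setIntegral_congr_fun (isOpen_Iio.preimage continuous_fst).measurableSet hdiverg,
    integral_diverg_halfSpace (contDiffOn_shearPullback hψ hV)
      (hasCompactSupport_shearPullback hψ.continuous hc)]
  simp only [shearPullback, zero_add]

lemma lipschitzWith_flip_snd (k : Fin n) {ε : ℝ} (hε : ε * ε = 1) :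
    LipschitzWith 1 fun z : WithLp 2 (Spacetime n) => (flip k ε z.ofLp).2 := by
  refine LipschitzWith.of_dist_le_mul fun z w => ?_
  rw [NNReal.coe_one, one_mul, dist_eq_norm, dist_eq_norm, ← Prod.snd_sub, ← map_sub,
    ← WithLp.ofLp_sub]
  set v := z - w
  have hflip := edot_flip k hε v.ofLp v.ofLp
  rw [edot_self, edot_self] at hflip
  have hnorm : ‖v‖ ^ 2 = v.ofLp.1 ^ 2 + ‖v.ofLp.2‖ ^ 2 := by
    rw [WithLp.prod_norm_sq_eq_of_L2, ← sq_abs v.ofLp.1]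
    rfl
  refine abs_le_of_sq_le_sq' ?_ (norm_nonneg _) |>.2
  nlinarith [sq_nonneg (flip k ε v.ofLp).1]

lemma euclSurfaceMeasure_apply (S : Set (Spacetime n)) :
    euclSurfaceMeasure n S =
      (Measure.euclideanHausdorffMeasure n : Measure (WithLp 2 (Spacetime n)))
        (WithLp.ofLp ⁻¹' S) :=
  (MeasurableEquiv.toLp 2 (Spacetime n)).symm.map_apply S

lemma volume_flip_snd_image_le (k : Fin n) {ε : ℝ} (hε : ε * ε = 1) (S : Set (Spacetime n)) :
    volume ((fun p => (flip k ε p).2) '' S) ≤ euclSurfaceMeasure n S := by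
  have himage : (fun p => (flip k ε p).2) '' S =
      (fun z : WithLp 2 (Spacetime n) => (flip k ε z.ofLp).2) '' (WithLp.ofLp ⁻¹' S) := by
    rw [← image_image (fun p => (flip k ε p).2) WithLp.ofLp,
      image_preimage_eq _ (WithLp.ofLp_surjective 2)]
  rw [himage, euclSurfaceMeasure_apply, ← EuclideanSpace.euclideanHausdorffMeasure_eq_volume n,
    Measure.euclideanHausdorffMeasure_def, Measure.euclideanHausdorffMeasure_def,
    Measure.smul_apply, Measure.smul_apply]
  have hle := (lipschitzWith_flip_snd k hε).hausdorffMeasure_image_le (d := n) (by positivity)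
    (WithLp.ofLp ⁻¹' S)
  rw [ENNReal.coe_one, ENNReal.one_rpow, one_mul] at hle
  exact smul_le_smul_of_nonneg_left hle zero_le

lemma lintegral_comp_graph_le (k : Fin n) {ε : ℝ} (hε : ε * ε = 1) (hψ : Continuous ψ)
    (Γ : Set (Spacetime n)) (h : Spacetime n → ℝ≥0∞) :
    ∫⁻ y in {y | flip k ε (ψ y, y) ∈ Γ}, h (flip k ε (ψ y, y)) ≤
      ∫⁻ p in Γ, h p ∂(euclSurfaceMeasure n) := by
  let G : EuclideanSpace ℝ (Fin n) → Spacetime n := fun y => flip k ε (ψ y, y)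
  let π : Spacetime n → EuclideanSpace ℝ (Fin n) := fun p => (flip k ε p).2
  let Gr : Set (Spacetime n) := {p | (flip k ε p).1 = ψ (flip k ε p).2}
  have hπm : Measurable π := (by fun_prop : Continuous π).measurable
  have hGr : MeasurableSet Gr := (isClosed_eq (by fun_prop) (by fun_prop)).measurableSet
  have hflipG : ∀ y, flip k ε (G y) = (ψ y, y) := fun y => flip_flip k hε _
  have hGπ : ∀ p ∈ Gr, G (π p) = p := fun p (hp : (flip k ε p).1 = ψ (flip k ε p).2) => by
    simp only [G, π, ← hp]
    exact flip_flip k hε p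
  set μ := ((euclSurfaceMeasure n).restrict Γ).restrict Gr with hμ
  have hle : (volume : Measure (EuclideanSpace ℝ (Fin n))).restrict {y | G y ∈ Γ} ≤ μ.map π := by
    refine Measure.le_iff.2 fun B hB => ?_
    rw [Measure.restrict_apply hB, Measure.map_apply hπm hB, hμ,
      Measure.restrict_restrict hGr, Measure.restrict_apply (hπm hB)]
    refine (measure_mono ?_).trans (volume_flip_snd_image_le k hε _)
    rintro y ⟨hyB, hyΓ⟩
    refine ⟨G y, ⟨?_, ?_, hyΓ⟩, congrArg Prod.snd (hflipG y)⟩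
    · simpa only [mem_preimage, π, hflipG] using hyB
    · simp only [Gr, mem_ofPred_eq, hflipG]
  calc ∫⁻ y in {y | G y ∈ Γ}, h (G y) ≤ ∫⁻ y, h (G y) ∂(μ.map π) := lintegral_mono' hle le_rfl
    _ ≤ ∫⁻ p, h (G (π p)) ∂μ := lintegral_map_le _ _
    _ = ∫⁻ p, h p ∂μ := setLIntegral_congr_fun hGr fun p hp => by simp only [hGπ p hp]
    _ ≤ _ := setLIntegral_le_lintegral _ _

end Spacetime

lemma ofReal_integral_le_lintegral_ofReal {α : Type*} [MeasurableSpace α] {μ : Measure α}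
    (f : α → ℝ) : ENNReal.ofReal (∫ x, f x ∂μ) ≤ ∫⁻ x, ENNReal.ofReal (f x) ∂μ := by
  by_cases hf : Integrable f μ
  · rw [integral_eq_lintegral_pos_part_sub_lintegral_neg_part hf]
    exact (ENNReal.ofReal_le_ofReal (sub_le_self _ ENNReal.toReal_nonneg)).trans
      ENNReal.ofReal_toReal_le
  · simp [integral_undef hf]

namespace Spacetime

variable {n : ℕ} {U W : Set (Spacetime n)} {p : Spacetime n} {X Y : Spacetime n → Spacetime n}

lemma diverg_congr (h : X =ᶠ[𝓝 p] Y) : diverg X p = diverg Y p := by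
  rw [diverg, diverg, h.fderiv_eq]

lemma diverg_eq_zero_of_notMem_tsupport (hp : p ∉ tsupport X) : diverg X p = 0 := by
  simp [diverg, (notMem_tsupport_iff_eventuallyEq.1 hp).fderiv_eq]

lemma diverg_sum {ι : Type*} (s : Finset ι) {X : ι → Spacetime n → Spacetime n}
    (hX : ∀ i ∈ s, DifferentiableAt ℝ (X i) p) :
    diverg (fun q => ∑ i ∈ s, X i q) p = ∑ i ∈ s, diverg (X i) p := by
  simp only [diverg, fderiv_fun_sum hX, sum_apply, Prod.fst_sum, Prod.snd_sum, WithLp.ofLp_sum,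
    Finset.sum_apply, Finset.sum_add_distrib]
  rw [Finset.sum_comm]

lemma diverg_flip_conj (k : Fin n) {ε : ℝ} (hε : ε * ε = 1)
    (hX : DifferentiableAt ℝ X (flip k ε p)) :
    diverg (fun q => flip k ε (X (flip k ε q))) p = diverg X (flip k ε p) := by
  set A := fderiv ℝ X (flip k ε p) with hA
  have hconj : HasFDerivAt (fun q => flip k ε (X (flip k ε q))) (flip k ε ∘L A ∘L flip k ε) p :=
    (flip k ε).hasFDerivAt.comp p (hX.hasFDerivAt.comp p (flip k ε).hasFDerivAt)
  have hrest : ∑ i ∈ Finset.univ.erase k, ((flip k ε ∘L A ∘L flip k ε) (eX i)).2 i =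
      ∑ i ∈ Finset.univ.erase k, (A (eX i)).2 i := by
    refine Finset.sum_congr rfl fun i hi => ?_
    have hik := Finset.ne_of_mem_erase hi
    simp only [ContinuousLinearMap.comp_apply, flip_snd, if_neg hik, flip_eX_of_ne hik]
  rw [diverg, hconj.fderiv, diverg, ← hA, ← Finset.add_sum_erase _ _ (Finset.mem_univ k), hrest,
    ← Finset.add_sum_erase (a := k) Finset.univ (fun i => (A (eX i)).2 i) (Finset.mem_univ k)]
  simp only [ContinuousLinearMap.comp_apply, flip_snd, flip_fst, flip_eX_self, flip_eT, map_smul,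
    Prod.smul_fst, Prod.smul_snd, PiLp.smul_apply, smul_eq_mul, if_true]
  linear_combination ((A (eX k)).2 k + (A eT).1) * hε

lemma integral_diverg_eq_zero (hX : ContDiff ℝ 1 X) (hc : HasCompactSupport X) :
    ∫ p, diverg X p = 0 := by
  have hT : ContDiff ℝ 1 fun q => (X q).1 := hX.fst
  have hS : ∀ i, ContDiff ℝ 1 fun q => (X q).2 i := fun i =>
    (EuclideanSpace.proj i : _ →L[ℝ] ℝ).contDiff.comp hX.snd
  have hTc : HasCompactSupport fun q => (X q).1 := hc.comp_left (g := Prod.fst) rfl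
  have hSc : ∀ i, HasCompactSupport fun q => (X q).2 i := fun i =>
    hc.comp_left (g := fun v : Spacetime n => v.2 i) rfl
  have hpartial : ∀ {f : Spacetime n → ℝ}, ContDiff ℝ 1 f → HasCompactSupport f → ∀ v,
      Integrable (fun q => fderiv ℝ f q v) ∧ ∫ q, fderiv ℝ f q v = 0 := fun hf hfc v => by
    have hint := ((hf.continuous_fderiv one_ne_zero).clm_apply
      (continuous_const (y := v))).integrable_of_hasCompactSupport (μ := volume)
      (hfc.fderiv_apply ℝ v)
    exact ⟨hint, integral_fderiv_apply_eq_zero (hf.differentiable one_ne_zero)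
      (hf.continuous.integrable_of_hasCompactSupport hfc) hint⟩
  simp only [diverg_eq_fderiv_add_sum (hX.differentiable one_ne_zero _)]
  rw [integral_add (hpartial hT hTc _).1
      (integrable_finsetSum _ fun i _ => (hpartial (hS i) (hSc i) _).1),
    integral_finsetSum _ fun i _ => (hpartial (hS i) (hSc i) _).1, (hpartial hT hTc _).2,
    Finset.sum_eq_zero fun i _ => (hpartial (hS i) (hSc i) _).2, add_zero]

lemma IsGTC.integrableOn_diverg (hU : IsGTC U) (hX : ContDiffOn ℝ 1 X (closure U))
    (hc : HasCompactSupport X) : IntegrableOn (diverg X) U := by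
  have hint : ∀ v, IntegrableOn (fun p => fderiv ℝ X p v) U :=
    integrableOn_fderiv_apply hU.uniqueDiffOn isClosed_closure hU.isOpen subset_closure hX hc
  exact (hint eT).fst.add <| integrable_finsetSum _ fun i _ =>
    (EuclideanSpace.proj i : _ →L[ℝ] ℝ).integrable_comp (hint (eX i)).snd

variable {k : Fin n} {ε : ℝ} {ψ : EuclideanSpace ℝ (Fin n) → ℝ}

lemma IsGraphPatch.mono {W' : Set (Spacetime n)} {L : Spacetime n →L[ℝ] Spacetime n}
    (h : IsGraphPatch U W L ψ) (hW' : IsOpen W') (hsub : W' ⊆ W) : IsGraphPatch U W' L ψ :=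
  ⟨hW', fun q hq => h.mem_iff q (hsub hq), fun q hq => h.exists_fderiv_eq q (hsub hq)⟩

lemma IsGraphPatch.mem_closure {L : Spacetime n →L[ℝ] Spacetime n} (h : IsGraphPatch U W L ψ)
    (hp : p ∈ W) (hle : (L p).1 ≤ ψ (L p).2) : p ∈ closure U := by
  rcases hle.lt_or_eq with hlt | heq
  · exact subset_closure ((h.mem_iff p hp).2 hlt)
  · obtain ⟨ρ, hρ, -⟩ := h.exists_fderiv_eq p hp heq
    exact hρ.mem_closure

lemma IsGraphPatch.contDiffOn_flip_conj (hε : ε * ε = 1) (h : IsGraphPatch U W (flip k ε) ψ)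
    (hX : ContDiffOn ℝ 1 X (closure U)) (hsupp : tsupport X ⊆ W) :
    ContDiffOn ℝ 1 (fun q => flip k ε (X (flip k ε q))) {q | q.1 ≤ ψ q.2} := by
  intro q hq
  refine (flip k ε).contDiff.contDiffAt.comp_contDiffWithinAt q ?_
  by_cases hqX : flip k ε q ∈ tsupport X
  · have hW : flip k ε ⁻¹' W ∈ 𝓝 q :=
      (flip k ε).continuous.continuousAt (h.isOpen.mem_nhds (hsupp hqX))
    have hmaps : MapsTo (flip k ε) ({q | q.1 ≤ ψ q.2} ∩ flip k ε ⁻¹' W) (closure U) :=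
      fun z hz => h.mem_closure hz.2 (by rw [flip_flip k hε]; exact hz.1)
    exact ((hX _ (hmaps ⟨hq, hsupp hqX⟩)).comp q (flip k ε).contDiff.contDiffWithinAt
      hmaps).mono_of_mem_nhdsWithin (inter_mem_nhdsWithin _ hW)
  · exact (contDiffAt_const.congr_of_eventuallyEq <| (flip k ε).continuous.continuousAt.eventually
      (notMem_tsupport_iff_eventuallyEq.1 hqX)).contDiffWithinAt

lemma IsGraphPatch.setIntegral_diverg_eq (hε : ε * ε = 1) (h : IsGraphPatch U W (flip k ε) ψ)
    (hU : IsOpen U) (hψ : Continuous ψ) (hsupp : tsupport X ⊆ W) :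
    ∫ q in U, diverg X q = ∫ q in {q | q.1 < ψ q.2}, diverg X (flip k ε q) := by
  have hflip := flip_flip (n := n) k hε
  have hopen : IsOpen {q : Spacetime n | q.1 < ψ q.2} :=
    isOpen_lt continuous_fst (hψ.comp continuous_snd)
  have hpre : flip k ε ⁻¹' (flip k ε ⁻¹' {q | q.1 < ψ q.2}) = {q | q.1 < ψ q.2} := by
    ext q
    simp only [mem_preimage, hflip]
  rw [← hpre, (measurePreserving_flip k hε).setIntegral_preimage_emb
      ((flip k ε).continuous.measurableEmbedding (Function.LeftInverse.injective hflip))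
      (diverg X), ← integral_indicator hU.measurableSet,
    ← integral_indicator (hopen.preimage (flip k ε).continuous).measurableSet]
  congr 1
  ext q
  by_cases hq : q ∈ tsupport X
  · exact indicator_eq_indicator (h.mem_iff q (hsupp hq)) rfl
  · simp [indicator, diverg_eq_zero_of_notMem_tsupport hq]

lemma IsGraphPatch.integral_diverg (hε : ε * ε = 1) (hψ : ContDiff ℝ 2 ψ)
    (h : IsGraphPatch U W (flip k ε) ψ) (hU : IsOpen U) (hX : ContDiffOn ℝ 1 X (closure U))
    (hc : HasCompactSupport X) (hsupp : tsupport X ⊆ W) :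
    ∫ q in U, diverg X q = ∫ y, ((flip k ε (X (flip k ε (ψ y, y)))).1 -
      fderiv ℝ ψ y (flip k ε (X (flip k ε (ψ y, y)))).2) := by
  have hflip := flip_flip (n := n) k hε
  have hc' : HasCompactSupport fun q => flip k ε (X (flip k ε q)) :=
    HasCompactSupport.intro (hc.isCompact.image (flip k ε).continuous) fun q hq => by
      rw [image_eq_zero_of_notMem_tsupport fun h => hq ⟨_, h, hflip q⟩, map_zero]
  rw [← integral_diverg_graph hψ (h.contDiffOn_flip_conj hε hX hsupp) hc',
    h.setIntegral_diverg_eq hε hU hψ.continuous hsupp]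
  refine setIntegral_congr_fun (isOpen_lt continuous_fst
    (hψ.continuous.comp continuous_snd)).measurableSet fun q hq => (diverg_flip_conj k hε ?_).symm
  by_cases hqX : flip k ε q ∈ tsupport X
  · have hqU : flip k ε q ∈ U := (h.mem_iff _ (hsupp hqX)).2 (by rw [hflip]; exact hq)
    exact (hX.contDiffAt (mem_of_superset (hU.mem_nhds hqU) subset_closure)).differentiableAt
      one_ne_zero
  · exact (differentiableAt_const (0 : Spacetime n)).congr_of_eventuallyEq
      (notMem_tsupport_iff_eventuallyEq.1 hqX)

lemma abs_fst_le_one_and_norm_snd_le_one {v : Spacetime n} (hv : edot v v = 1) :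
    |v.1| ≤ 1 ∧ ‖v.2‖ ≤ 1 := by
  rw [edot_self] at hv
  exact ⟨abs_le_one_iff_mul_self_le_one.2 (by nlinarith [sq_nonneg ‖v.2‖]),
    by nlinarith [sq_nonneg v.1, norm_nonneg v.2]⟩

lemma IsGraphPatch.exists_eq_edot (hε : ε * ε = 1) (h : IsGraphPatch U W (flip k ε) ψ)
    {y : EuclideanSpace ℝ (Fin n)} (hy : flip k ε (ψ y, y) ∈ W) :
    flip k ε (ψ y, y) ∈ frontier U ∧ ∃ m : ℝ, 0 < m ∧ m ≤ 1 + ‖fderiv ℝ ψ y‖ ∧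
      ∀ v, (flip k ε v).1 - fderiv ℝ ψ y (flip k ε v).2 =
        m * edot v (euclNormal U (flip k ε (ψ y, y))) := by
  have hflip := flip_flip k hε (ψ y, y)
  obtain ⟨ρ, hρ, c, hc, hcv⟩ := h.exists_fderiv_eq _ hy (by rw [hflip])
  obtain ⟨c', hc', hcv'⟩ := hρ.exists_fderiv_eq_edot
  rw [hflip] at hcv
  set ν := euclNormal U (flip k ε (ψ y, y))
  have hform : ∀ v, (flip k ε v).1 - fderiv ℝ ψ y (flip k ε v).2 = c' / c * edot v ν := by
    intro v
    have := (hcv v).symm.trans (hcv' v)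
    field_simp
    linarith
  refine ⟨hρ.mem_frontier, c' / c, div_pos hc' hc, ?_, hform⟩
  have hνν : edot ν ν = 1 := hρ.edot_euclNormal_self
  have hunit := abs_fst_le_one_and_norm_snd_le_one ((edot_flip k hε ν ν).trans hνν)
  have hψν : |fderiv ℝ ψ y (flip k ε ν).2| ≤ ‖fderiv ℝ ψ y‖ :=
    ((fderiv ℝ ψ y).le_opNorm _).trans (mul_le_of_le_one_right (norm_nonneg _) hunit.2)
  have hm := hform ν
  rw [hνν, mul_one] at hm
  linarith [(abs_le.1 hunit.1).2, (abs_le.1 hψν).1]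

/-- The inward flux of `Y` through the boundary of `U` is dominated by `h` on `Γ`, and nonpositive
elsewhere. -/
def InwardFluxLE (U : Set (Spacetime n)) (Y : Spacetime n → Spacetime n) (Γ : Set (Spacetime n))
    (h : Spacetime n → ℝ≥0∞) : Prop :=
  ∀ p ∈ frontier U, ENNReal.ofReal (-edot (Y p) (euclNormal U p)) ≤ Γ.indicator h p

/-- `C` is a constant in the estimate of the total inward flux by a surface integral, for fields
that are localized to `W` by a cutoff function `χ`. -/
def IsFluxConstant (U W : Set (Spacetime n)) (C : ℝ≥0) : Prop :=
  ∀ (Y : Spacetime n → Spacetime n) (Γ : Set (Spacetime n)) (h : Spacetime n → ℝ≥0∞)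
    (χ : Spacetime n → ℝ), ContDiffOn ℝ 1 Y (closure U) → InwardFluxLE U Y Γ h →
    ContDiff ℝ 1 χ → (∀ p, 0 ≤ χ p) → (∀ p, χ p ≤ 1) → HasCompactSupport χ → tsupport χ ⊆ W →
    ENNReal.ofReal (-∫ p in U, diverg (fun p => χ p • Y p) p) ≤
      C * ∫⁻ p in Γ, h p ∂(euclSurfaceMeasure n)

lemma IsFluxConstant.mono {W' : Set (Spacetime n)} {C : ℝ≥0} (h : IsFluxConstant U W C)
    (hW : W' ⊆ W) : IsFluxConstant U W' C :=
  fun Y Γ g χ hY hflux hχ hχ0 hχ1 hχc hχW => h Y Γ g χ hY hflux hχ hχ0 hχ1 hχc (hχW.trans hW)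

lemma isFluxConstant_self (hU : IsOpen U) : IsFluxConstant U U 0 := by
  intro Y Γ h χ hY _ hχ _ _ hχc hχU
  have hsupp : tsupport (fun p => χ p • Y p) ⊆ U := (tsupport_smul_subset_left χ Y).trans hχU
  have hX : ContDiff ℝ 1 fun p => χ p • Y p := by
    refine contDiff_iff_contDiffAt.2 fun p => ?_
    by_cases hp : p ∈ tsupport fun p => χ p • Y p
    · exact hχ.contDiffAt.smul
        (hY.contDiffAt (mem_of_superset (hU.mem_nhds (hsupp hp)) subset_closure))
    · exact contDiffAt_const.congr_of_eventuallyEq (notMem_tsupport_iff_eventuallyEq.1 hp)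
  rw [setIntegral_eq_integral_of_forall_compl_eq_zero fun p hp =>
    diverg_eq_zero_of_notMem_tsupport fun h => hp (hsupp h),
    integral_diverg_eq_zero hX hχc.smul_right]
  simp

lemma IsGraphPatch.ofReal_neg_flux_le (hε : ε * ε = 1) (hW : IsGraphPatch U W (flip k ε) ψ)
    {Γ : Set (Spacetime n)} {h : Spacetime n → ℝ≥0∞} (hflux : InwardFluxLE U Y Γ h) {c M : ℝ}
    (hc0 : 0 ≤ c) (hc1 : c ≤ 1) {y : EuclideanSpace ℝ (Fin n)} (hM : ‖fderiv ℝ ψ y‖ ≤ M)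
    (hp : p = flip k ε (ψ y, y)) (hpW : p ∈ W) :
    ENNReal.ofReal (-((flip k ε (c • Y p)).1 - fderiv ℝ ψ y (flip k ε (c • Y p)).2)) ≤
      ENNReal.ofReal (1 + M) * Γ.indicator h p := by
  subst hp
  obtain ⟨hfr, m, hm0, hm1, hm⟩ := hW.exists_eq_edot hε hpW
  rw [hm, edot_comm, edot_smul_right, edot_comm]
  set e := edot (Y (flip k ε (ψ y, y))) (euclNormal U (flip k ε (ψ y, y)))
  have hcm : m * c ≤ 1 + M := (mul_le_of_le_one_right hm0.le hc1).trans (by linarith)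
  calc ENNReal.ofReal (-(m * (c * e))) = ENNReal.ofReal (m * c) * ENNReal.ofReal (-e) := by
        rw [← ENNReal.ofReal_mul (mul_nonneg hm0.le hc0)]
        ring_nf
    _ ≤ _ := by
        gcongr
        exact hflux _ hfr

lemma IsGraphPatch.exists_isFluxConstant (hε : ε * ε = 1) (hψ : ContDiff ℝ 2 ψ)
    (hW : IsGraphPatch U W (flip k ε) ψ) (hU : IsOpen U) (hWb : Bornology.IsBounded W) :
    ∃ C, IsFluxConstant U W C := by
  obtain ⟨M, hM⟩ := (hWb.isCompact_closure.image
      (by fun_prop : Continuous fun p => (flip k ε p).2)).exists_bound_of_continuousOn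
    (hψ.continuous_fderiv two_ne_zero).continuousOn
  refine ⟨(1 + M).toNNReal, fun Y Γ h χ hY hflux hχ hχ0 hχ1 hχc hχW => ?_⟩
  have hsupp : tsupport (fun p => χ p • Y p) ⊆ W := (tsupport_smul_subset_left χ Y).trans hχW
  rw [hW.integral_diverg hε hψ hU (X := fun p => χ p • Y p) (hχ.contDiffOn.smul hY)
    hχc.smul_right hsupp, ← integral_neg]
  refine (ofReal_integral_le_lintegral_ofReal _).trans ?_
  set G : EuclideanSpace ℝ (Fin n) → Spacetime n := fun y => flip k ε (ψ y, y) with hG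
  have hpointwise : ∀ y, ENNReal.ofReal (-((flip k ε (χ (G y) • Y (G y))).1 -
      fderiv ℝ ψ y (flip k ε (χ (G y) • Y (G y))).2)) ≤
      {y | G y ∈ Γ}.indicator (fun y => ENNReal.ofReal (1 + M) * h (G y)) y := by
    intro y
    by_cases hy : G y ∈ W
    · refine (hW.ofReal_neg_flux_le (p := G y) hε hflux (hχ0 _) (hχ1 _)
        (hM y ⟨G y, subset_closure hy, by simp only [hG, flip_flip k hε]⟩) rfl hy).trans ?_
      by_cases hΓ : G y ∈ Γ <;> simp [hΓ]
    · have hzero : χ (G y) = 0 := image_eq_zero_of_notMem_tsupport fun h => hy (hχW h)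
      simp [hzero]
  refine (lintegral_mono hpointwise).trans ((lintegral_indicator_le _ _).trans ?_)
  rw [lintegral_const_mul' _ _ ENNReal.ofReal_ne_top]
  exact mul_le_mul_right (lintegral_comp_graph_le k hε hψ.continuous Γ h) _

lemma IsGTC.exists_isFluxConstant (hU : IsGTC U) (hp : p ∈ closure U) :
    ∃ (W : Set (Spacetime n)) (C : ℝ≥0), p ∈ W ∧ IsOpen W ∧ Bornology.IsBounded W ∧
      IsFluxConstant U W C := by
  have hbdd : ∀ W : Set (Spacetime n), Bornology.IsBounded (W ∩ Metric.ball p 1) := fun W =>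
    Metric.isBounded_ball.subset inter_subset_right
  by_cases hpU : p ∈ U
  · exact ⟨U ∩ Metric.ball p 1, 0, ⟨hpU, Metric.mem_ball_self one_pos⟩,
      hU.isOpen.inter Metric.isOpen_ball, hbdd U,
      (isFluxConstant_self hU.isOpen).mono inter_subset_left⟩
  · obtain ⟨k, ε, ψ, W, hε, hψ, hpW, hW⟩ := hU.exists_graphPatch (hU.mem_frontier_iff.2 ⟨hp, hpU⟩)
    have hW' := hW.mono (hW.isOpen.inter (Metric.isOpen_ball (x := p) (ε := 1))) inter_subset_left
    obtain ⟨C, hC⟩ := hW'.exists_isFluxConstant hε hψ hU.isOpen (hbdd W)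
    exact ⟨W ∩ Metric.ball p 1, C, ⟨hpW, Metric.mem_ball_self one_pos⟩, hW'.isOpen, hbdd W, hC⟩

lemma IsGTC.integral_diverg_eq_sum (hU : IsGTC U) {ι : Type*} (s : Finset ι)
    {χ : ι → Spacetime n → ℝ} (hχ : ∀ i, ContDiff ℝ 1 (χ i)) (hχc : ∀ i, HasCompactSupport (χ i))
    (hY : ContDiffOn ℝ 1 Y (closure U)) (hsum : ∀ p ∈ U, Y p = ∑ i ∈ s, χ i p • Y p) :
    ∫ p in U, diverg Y p = ∑ i ∈ s, ∫ p in U, diverg (fun p => χ i p • Y p) p := by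
  have hχY : ∀ i, ContDiffOn ℝ 1 (fun p => χ i p • Y p) (closure U) := fun i =>
    (hχ i).contDiffOn.smul hY
  have hdiverg : ∀ p ∈ U, diverg Y p = ∑ i ∈ s, diverg (fun p => χ i p • Y p) p := by
    intro p hp
    rw [diverg_congr (mem_of_superset (hU.isOpen.mem_nhds hp) hsum)]
    exact diverg_sum _ fun i _ => ((hχY i).contDiffAt (mem_of_superset (hU.isOpen.mem_nhds hp)
      subset_closure)).differentiableAt one_ne_zero
  rw [setIntegral_congr_fun hU.isOpen.measurableSet hdiverg,
    integral_finsetSum _ fun i _ => hU.integrableOn_diverg (hχY i) (hχc i).smul_right]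

theorem IsGTC.exists_flux_bound (hU : IsGTC U) (hn : 1 ≤ n) (a b : ℝ) :
    ∃ C : ℝ≥0, ∀ (Y : Spacetime n → Spacetime n) (Γ : Set (Spacetime n)) (h : Spacetime n → ℝ≥0∞),
      ContDiffOn ℝ 1 Y (closure U) → InwardFluxLE U Y Γ h →
      (∀ p ∈ U, p.1 ∉ Icc a b → Y p = 0) →
      ENNReal.ofReal (-∫ p in U, diverg Y p) ≤ C * ∫⁻ p in Γ, h p ∂(euclSurfaceMeasure n) := by
  have hK : IsCompact (closure U ∩ Prod.fst ⁻¹' Icc a b) := hU.isCompact_slab hn a b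
  choose! W C hpW hWo hWb hWC using fun p (hp : p ∈ closure U) => hU.exists_isFluxConstant hp
  obtain ⟨t, htK, hcover⟩ := hK.elim_nhds_subcover W fun p hp =>
    (hWo p hp.1).mem_nhds (hpW p hp.1)
  have ht : ∀ i : t, (i : Spacetime n) ∈ closure U := fun i => (htK i i.2).1
  obtain ⟨χ, hχW⟩ := SmoothPartitionOfUnity.exists_isSubordinate
    (modelWithCornersSelf ℝ (Spacetime n)) hK.isClosed (fun i : t => W i) (fun i => hWo i (ht i))
    (hcover.trans (iUnion₂_subset fun q hq => subset_iUnion (fun i : t => W i) ⟨q, hq⟩))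
  have hχ : ∀ i : t, ContDiff ℝ 1 (χ i) := fun i => (χ i).contMDiff.contDiff.of_le (by norm_cast)
  have hχc : ∀ i : t, HasCompactSupport (χ i) := fun i =>
    (hWb i (ht i)).isCompact_closure.of_isClosed_subset (isClosed_tsupport _)
      ((hχW i).trans subset_closure)
  refine ⟨∑ i : t, C i, fun Y Γ h hY hflux hYzero => ?_⟩
  have hsum : ∀ p ∈ U, Y p = ∑ i : t, χ i p • Y p := by
    intro p hp
    by_cases hpab : p.1 ∈ Icc a b
    · rw [← Finset.sum_smul, ← finsum_eq_sum_of_fintype,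
        χ.sum_eq_one ⟨subset_closure hp, hpab⟩, one_smul]
    · simp [hYzero p hp hpab]
  rw [hU.integral_diverg_eq_sum Finset.univ hχ hχc hY hsum, ← Finset.sum_neg_distrib]
  refine (Finset.le_sum_of_subadditive ENNReal.ofReal ENNReal.ofReal_zero.le
    (fun _ _ => ENNReal.ofReal_add_le) _ _).trans ?_
  push_cast
  rw [Finset.sum_mul]
  exact Finset.sum_le_sum fun i _ => hWC i (ht i) Y Γ h (χ i) hY hflux (hχ i) (χ.nonneg i)
    (χ.le_one i) (hχc i) (hχW i)

end Spacetime

section Cutoff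

/-- A smooth step function rescaled so that it rises from `0` to `1` on the interval
`[c - d * ε, c + (1 - d) * ε]`. -/
noncomputable def smoothStep (c d ε t : ℝ) : ℝ := Real.smoothTransition ((t - c) / ε + d)

lemma deriv_smoothTransition_of_notMem {u : ℝ} (hu : u ∉ Icc (0 : ℝ) 1) :
    deriv Real.smoothTransition u = 0 := by
  rcases lt_or_ge u 0 with h | h
  · have hzero : Real.smoothTransition =ᶠ[𝓝 u] fun _ => 0 := by
      filter_upwards [gt_mem_nhds h] with v hv using Real.smoothTransition.zero_of_nonpos hv.le
    rw [hzero.deriv_eq, deriv_const]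
  · have hone : Real.smoothTransition =ᶠ[𝓝 u] fun _ => 1 := by
      filter_upwards [lt_mem_nhds (not_le.1 fun h' => hu ⟨h, h'⟩)] with v hv
        using Real.smoothTransition.one_of_one_le hv.le
    rw [hone.deriv_eq, deriv_const]

lemma continuous_deriv_smoothTransition : Continuous (deriv Real.smoothTransition) :=
  (Real.smoothTransition.contDiff (n := 1)).continuous_deriv le_rfl

lemma contDiff_smoothStep (c d ε : ℝ) : ContDiff ℝ 1 (smoothStep c d ε) :=
  Real.smoothTransition.contDiff.comp (by fun_prop)

lemma deriv_smoothStep (c d ε t : ℝ) :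
    deriv (smoothStep c d ε) t = ε⁻¹ * deriv Real.smoothTransition ((t - c) / ε + d) := by
  have hlin : HasDerivAt (fun t => (t - c) / ε + d) (1 / ε) t :=
    (((hasDerivAt_id t).sub_const c).div_const ε).add_const d
  have hS : HasDerivAt Real.smoothTransition _ ((t - c) / ε + d) :=
    ((Real.smoothTransition.contDiff (n := 1)).differentiable one_ne_zero _).hasDerivAt
  rw [mul_comm, ← one_div]
  exact (hS.comp t hlin).deriv

variable {H : ℝ → ℝ}

lemma integrable_deriv_smoothStep_mul (hH : Continuous H) (c d : ℝ) {ε : ℝ} (hε : 0 < ε) :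
    Integrable fun t => deriv (smoothStep c d ε) t * H t := by
  refine (((contDiff_smoothStep c d ε).continuous_deriv le_rfl).mul
    hH).integrable_of_hasCompactSupport <| HasCompactSupport.intro
      (isCompact_Icc (a := c - d * ε) (b := c + (1 - d) * ε)) fun t ht => ?_
  rw [Pi.mul_apply, deriv_smoothStep, deriv_smoothTransition_of_notMem, mul_zero, zero_mul]
  contrapose! ht
  have hdiv : (t - c) / ε * ε = t - c := div_mul_cancel₀ _ hε.ne'
  constructor <;> nlinarith [ht.1, ht.2]

lemma integral_deriv_smoothStep_mul (c d : ℝ) {ε : ℝ} (hε : 0 < ε) (H : ℝ → ℝ) :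
    ∫ t, deriv (smoothStep c d ε) t * H t =
      ∫ u in (0 : ℝ)..1, deriv Real.smoothTransition u * H (c + ε * (u - d)) := by
  let g : ℝ → ℝ := fun u => deriv Real.smoothTransition u * H (c + ε * (u - d))
  have hrescale : ∀ t, deriv (smoothStep c d ε) t * H t = ε⁻¹ * g ((t - c) / ε + d) := by
    intro t
    have ht : c + ε * ((t - c) / ε + d - d) = t := by
      field_simp
      ring
    simp only [deriv_smoothStep, g, ht, mul_assoc]
  have hsupp : ∫ u, g u = ∫ u in (0 : ℝ)..1, g u := by
    rw [intervalIntegral.integral_of_le zero_le_one, ← integral_Icc_eq_integral_Ioc,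
      setIntegral_eq_integral_of_forall_compl_eq_zero]
    intro u hu
    simp only [g, deriv_smoothTransition_of_notMem hu, zero_mul]
  simp only [hrescale, integral_const_mul]
  rw [integral_sub_right_eq_self (fun t => g (t / ε + d)) c,
    Measure.integral_comp_div (fun x => g (x + d)) ε, integral_add_right_eq_self g d,
    abs_of_pos hε, smul_eq_mul, ← mul_assoc, inv_mul_cancel₀ hε.ne', one_mul, hsupp]

lemma tendsto_integral_deriv_smoothStep_mul (hH : Continuous H) (c d : ℝ) {ε : ℕ → ℝ}
    (hε0 : ∀ k, 0 < ε k) (hε : Tendsto ε atTop (𝓝 0)) :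
    Tendsto (fun k => ∫ t, deriv (smoothStep c d (ε k)) t * H t) atTop (𝓝 (H c)) := by
  have hcont : Continuous fun e : ℝ =>
      ∫ u in (0 : ℝ)..1, deriv Real.smoothTransition u * H (c + e * (u - d)) := by
    refine intervalIntegral.continuous_parametric_intervalIntegral_of_continuous'
      (f := fun e u => deriv Real.smoothTransition u * H (c + e * (u - d))) ?_ 0 1
    have := continuous_deriv_smoothTransition
    simp only [Function.uncurry_def]
    fun_prop
  have hzero : ∫ u in (0 : ℝ)..1, deriv Real.smoothTransition u * H (c + 0 * (u - d)) = H c := by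
    simp only [zero_mul, add_zero, intervalIntegral.integral_mul_const]
    rw [intervalIntegral.integral_deriv_eq_sub
      (fun x _ => (Real.smoothTransition.contDiff (n := 1)).differentiable one_ne_zero x)
      (continuous_deriv_smoothTransition.intervalIntegrable _ _)]
    simp
  simp only [integral_deriv_smoothStep_mul c d (hε0 _)]
  rw [← hzero]
  exact (hcont.tendsto 0).comp hε

lemma smoothStep_eq_zero {c d ε t : ℝ} (h : (t - c) / ε + d ≤ 0) : smoothStep c d ε t = 0 :=
  Real.smoothTransition.zero_of_nonpos h

lemma smoothStep_eq_one {c d ε t : ℝ} (h : 1 ≤ (t - c) / ε + d) : smoothStep c d ε t = 1 :=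
  Real.smoothTransition.one_of_one_le h

lemma exists_cutoff_seq {a b : ℝ} (hab : a < b) :
    ∃ θ : ℕ → ℝ → ℝ, (∀ k, ContDiff ℝ 1 (θ k)) ∧ (∀ k t, 0 ≤ θ k t) ∧ (∀ k t, θ k t ≤ 1) ∧
      (∀ k t, t ∉ Ioo a b → θ k t = 0) ∧
      ∀ H : ℝ → ℝ, Continuous H →
        Tendsto (fun k => ∫ t, deriv (θ k) t * H t) atTop (𝓝 (H a - H b)) := by
  have hlen : 0 < b - a := sub_pos.2 hab
  let ε : ℕ → ℝ := fun k => (b - a) / (k + 1)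
  have hε0 : ∀ k, 0 < ε k := fun k => by positivity
  have hε : Tendsto ε atTop (𝓝 0) := by
    simpa [ε, div_eq_mul_inv] using
      (tendsto_one_div_add_atTop_nhds_zero_nat (𝕜 := ℝ)).const_mul (b - a)
  have hle : ∀ k t, (t - b) / ε k + 1 ≤ (t - a) / ε k + 0 := by
    intro k t
    have hsplit : (t - a) / ε k = (t - b) / ε k + (k + 1) := by
      simp only [ε]
      field_simp
      ring
    linarith [(Nat.cast_nonneg k : (0 : ℝ) ≤ k)]
  refine ⟨fun k t => smoothStep a 0 (ε k) t - smoothStep b 1 (ε k) t, fun k => ?_, fun k t => ?_,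
    fun k t => ?_, fun k t ht => ?_, fun H hH => ?_⟩
  · exact (contDiff_smoothStep _ _ _).sub (contDiff_smoothStep _ _ _)
  · exact sub_nonneg.2 (Real.smoothTransition.monotone (hle k t))
  · exact (sub_le_self _ (Real.smoothTransition.nonneg _)).trans (Real.smoothTransition.le_one _)
  · beta_reduce
    rcases le_or_gt t a with h | h
    · have hta : (t - a) / ε k + 0 ≤ 0 := by
        rw [add_zero]
        exact div_nonpos_of_nonpos_of_nonneg (sub_nonpos.2 h) (hε0 k).le
      rw [smoothStep_eq_zero hta, smoothStep_eq_zero ((hle k t).trans hta), sub_zero]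
    · have hbt : 1 ≤ (t - b) / ε k + 1 := le_add_of_nonneg_left <|
        div_nonneg (sub_nonneg.2 (not_lt.1 fun h' => ht ⟨h, h'⟩)) (hε0 k).le
      rw [smoothStep_eq_one hbt, smoothStep_eq_one (hbt.trans (hle k t)), sub_self]
  · refine ((tendsto_integral_deriv_smoothStep_mul hH a 0 hε0 hε).sub
      (tendsto_integral_deriv_smoothStep_mul hH b 1 hε0 hε)).congr fun k => ?_
    rw [← integral_sub (integrable_deriv_smoothStep_mul hH a 0 (hε0 k))
      (integrable_deriv_smoothStep_mul hH b 1 (hε0 k))]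
    refine integral_congr_ae (Eventually.of_forall fun t => ?_)
    simp only [← sub_mul]
    rw [deriv_fun_sub ((contDiff_smoothStep _ _ _).differentiable one_ne_zero t)
      ((contDiff_smoothStep _ _ _).differentiable one_ne_zero t)]

end Cutoff

lemma measure_eq_zero_of_forall_line_subsingleton {E : Type*} [NormedAddCommGroup E]
    [NormedSpace ℝ E] [MeasurableSpace E] [BorelSpace E] [FiniteDimensional ℝ E] (μ : Measure E)
    [μ.IsAddHaarMeasure] {s : Set E} (hs : MeasurableSet s) {v : E}
    (h : ∀ z, {c : ℝ | z + c • v ∈ s}.Subsingleton) : μ s = 0 := by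
  let u : ℕ → ℝ := fun m => 1 / ((m : ℝ) + 1)
  have hlim : Tendsto (fun m => u m • v) atTop (𝓝 ((0 : ℝ) • v)) :=
    tendsto_one_div_add_atTop_nhds_zero_nat.smul_const v
  refine Measure.addHaar_eq_zero_of_disjoint_translates μ (fun m => u m • v)
    (Metric.isBounded_range_of_tendsto _ hlim) (fun i j hij => ?_) hs
  refine Set.disjoint_left.2 ?_
  rintro z ⟨_, rfl, x, hx, hxz⟩ ⟨_, rfl, y, hy, hyz⟩
  have hmem : ∀ {m w}, u m • v + w = z → w ∈ s → -u m ∈ {c : ℝ | z + c • v ∈ s} := by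
    rintro m w rfl hw
    rwa [mem_ofPred_eq, neg_smul, add_assoc, add_neg_cancel_comm_assoc]
  have huij : u i = u j := neg_injective (h z (hmem hxz hx) (hmem hyz hy))
  exact hij (by simpa [u] using huij)

lemma integral_mul_eq_neg_integral_deriv_mul {θ f : ℝ → ℝ} (hθ : ContDiff ℝ 1 θ)
    (hc : HasCompactSupport θ) (hf : Continuous f) (a : ℝ) :
    ∫ t, θ t * f t = -∫ t, deriv θ t * ∫ s in a..t, f s := by
  have hF : ∀ t, HasDerivAt (fun t => ∫ s in a..t, f s) (f t) t := fun t =>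
    intervalIntegral.integral_hasDerivAt_right (hf.intervalIntegrable _ _)
      hf.stronglyMeasurable.stronglyMeasurableAtFilter hf.continuousAt
  have hFc : Continuous fun t => ∫ s in a..t, f s :=
    continuous_iff_continuousAt.2 fun t => (hF t).continuousAt
  exact integral_mul_deriv_eq_deriv_mul_of_integrable
    (fun t _ => (hθ.differentiable one_ne_zero t).hasDerivAt) (fun t _ => hF t)
    ((hθ.continuous.mul hf).integrable_of_hasCompactSupport hc.mul_right)
    (((hθ.continuous_deriv le_rfl).mul hFc).integrable_of_hasCompactSupport hc.deriv.mul_right)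
    ((hθ.continuous.mul hFc).integrable_of_hasCompactSupport hc.mul_right)

namespace Spacetime

variable {n : ℕ} {U : Set (Spacetime n)}

lemma IsGraphPatch.eq_of_mem_frontier {W : Set (Spacetime n)}
    {L : Spacetime n →L[ℝ] Spacetime n} {ψ : EuclideanSpace ℝ (Fin n) → ℝ} (hψ : Continuous ψ)
    (h : IsGraphPatch U W L ψ) (hU : IsOpen U) {q : Spacetime n} (hq : q ∈ W)
    (hqf : q ∈ frontier U) : (L q).1 = ψ (L q).2 := by
  rw [hU.frontier_eq] at hqf
  refine le_antisymm ?_ (not_lt.1 fun hlt => hqf.2 ((h.mem_iff q hq).2 hlt))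
  by_contra! hlt
  have hopen : IsOpen (W ∩ {z | ψ (L z).2 < (L z).1}) :=
    h.isOpen.inter (isOpen_lt (by fun_prop) (by fun_prop))
  obtain ⟨z, ⟨hzW, hz⟩, hzU⟩ := mem_closure_iff.1 hqf.1 _ hopen ⟨hq, hlt⟩
  exact lt_asymm hz ((h.mem_iff z hzW).1 hzU)

lemma volume_flip_graph_slice {ψ : EuclideanSpace ℝ (Fin n) → ℝ} (hψ : Continuous ψ) (k : Fin n)
    {ε : ℝ} (hε : ε ≠ 0) (τ : ℝ) :
    volume {z : EuclideanSpace ℝ (Fin n) |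
      (flip k ε (τ, z)).1 = ψ (flip k ε (τ, z)).2} = 0 := by
  refine measure_eq_zero_of_forall_line_subsingleton (v := EuclideanSpace.single k 1) volume
    (isClosed_eq (by fun_prop) (by fun_prop)).measurableSet fun z => ?_
  let line : ℝ → EuclideanSpace ℝ (Fin n) := fun c => z + c • EuclideanSpace.single k 1
  have hsnd : ∀ c, (flip k ε (τ, line c)).2 = (flip k ε (τ, z)).2 := fun c => by
    ext i
    simp only [flip_snd]
    split_ifs with hi
    · rfl
    · simp [line, hi]
  have hfst : ∀ c, (flip k ε (τ, line c)).1 = ε * (z k + c) := fun c => by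
    simp [flip_fst, line]
  intro c hc c' hc'
  have hc₁ : (flip k ε (τ, line c)).1 = ψ (flip k ε (τ, line c)).2 := hc
  have hc₂ : (flip k ε (τ, line c')).1 = ψ (flip k ε (τ, line c')).2 := hc'
  rw [hsnd, hfst] at hc₁ hc₂
  exact add_left_cancel (mul_left_cancel₀ hε (hc₁.trans hc₂.symm))

lemma IsGTC.volume_slice_frontier (hU : IsGTC U) (τ : ℝ) :
    volume {y : EuclideanSpace ℝ (Fin n) | (τ, y) ∈ frontier U} = 0 := by
  refine measure_null_of_locally_null _ fun y hy => ?_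
  obtain ⟨k, ε, ψ, W, hε, hψ, hyW, hW⟩ := hU.exists_graphPatch hy
  have hslice : Continuous fun z : EuclideanSpace ℝ (Fin n) => ((τ, z) : Spacetime n) := by
    fun_prop
  exact ⟨_, inter_mem_nhdsWithin _ (hslice.continuousAt (hW.isOpen.mem_nhds hyW)),
    measure_mono_null (fun z hz => hW.eq_of_mem_frontier hψ.continuous hU.isOpen hz.2 hz.1)
      (volume_flip_graph_slice hψ.continuous k (fun h => by simp [h] at hε) τ)⟩

/-- The integral of `G` over the time slice of `U` at time `t`. -/
noncomputable def sliceInt (U : Set (Spacetime n)) (G : Spacetime n → ℝ) (t : ℝ) : ℝ :=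
  ∫ y in slice U t, G (t, y)

lemma continuousOn_slice {G : Spacetime n → ℝ} (hG : ContinuousOn G (closure U)) (t : ℝ) :
    ContinuousOn (fun y => G (t, y)) (slice U t) :=
  hG.comp (by fun_prop) fun _ hy => subset_closure hy

namespace IsGTC

lemma exists_bound (hU : IsGTC U) (hn : 1 ≤ n) {F : Type*} [NormedAddCommGroup F]
    {G : Spacetime n → F} (hG : ContinuousOn G (closure U)) (a b : ℝ) :
    ∃ M : ℝ, 0 ≤ M ∧ ∀ p ∈ closure U, p.1 ∈ Icc a b → ‖G p‖ ≤ M := by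
  obtain ⟨M, hM⟩ := (hU.isCompact_slab hn a b).exists_bound_of_continuousOn
    (hG.mono inter_subset_left)
  exact ⟨max M 0, le_max_right _ _, fun p hp hpt => (hM p ⟨hp, hpt⟩).trans (le_max_left _ _)⟩

lemma aestronglyMeasurable_slice (hU : IsGTC U) {G : Spacetime n → ℝ}
    (hG : ContinuousOn G (closure U)) (t : ℝ) :
    AEStronglyMeasurable (fun y => G (t, y)) (volume.restrict (slice U t)) :=
  (continuousOn_slice hG t).aestronglyMeasurable (hU.slice_open t).measurableSet

lemma integrableOn_slice (hU : IsGTC U) (hn : 1 ≤ n) {G : Spacetime n → ℝ}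
    (hG : ContinuousOn G (closure U)) (t : ℝ) :
    IntegrableOn (fun y => G (t, y)) (slice U t) := by
  obtain ⟨M, -, hM⟩ := hU.exists_bound hn hG t t
  refine ⟨hU.aestronglyMeasurable_slice hG t,
    HasFiniteIntegral.restrict_of_bounded M (hU.slice_bounded t).measure_lt_top ?_⟩
  filter_upwards [ae_restrict_mem (hU.slice_open t).measurableSet] with y hy
  exact hM (t, y) (subset_closure hy) ⟨le_rfl, le_rfl⟩

lemma sliceInt_eq_integral_indicator (hU : IsGTC U) (G : Spacetime n → ℝ) (t : ℝ) :
    sliceInt U G t = ∫ y, U.indicator G (t, y) :=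
  (integral_indicator (hU.slice_open t).measurableSet).symm

lemma continuous_sliceInt (hU : IsGTC U) (hn : 1 ≤ n) {G : Spacetime n → ℝ}
    (hG : ContinuousOn G (closure U)) : Continuous (sliceInt U G) := by
  refine continuous_iff_continuousAt.2 fun t₀ => ?_
  rw [funext (hU.sliceInt_eq_integral_indicator G)]
  obtain ⟨M, hM0, hM⟩ := hU.exists_bound hn hG (t₀ - 1) (t₀ + 1)
  let K : Set (EuclideanSpace ℝ (Fin n)) :=
    Prod.snd '' (closure U ∩ Prod.fst ⁻¹' Icc (t₀ - 1) (t₀ + 1))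
  have hK : IsCompact K := (hU.isCompact_slab hn _ _).image continuous_snd
  refine continuousAt_of_dominated (bound := K.indicator fun _ => M)
    (Eventually.of_forall fun t => ?_) ?_ ?_ ?_
  · exact (aestronglyMeasurable_indicator_iff (hU.slice_open t).measurableSet).2
      (hU.aestronglyMeasurable_slice hG t)
  · filter_upwards [Icc_mem_nhds (sub_one_lt t₀) (lt_add_one t₀)] with t ht
    refine Eventually.of_forall fun y => ?_
    by_cases hy : (t, y) ∈ U
    · have hyK : y ∈ K := ⟨(t, y), ⟨subset_closure hy, ht⟩, rfl⟩
      rw [indicator_of_mem hy, indicator_of_mem hyK]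
      exact hM (t, y) (subset_closure hy) ht
    · rw [indicator_of_notMem hy, norm_zero]
      exact indicator_nonneg (fun _ _ => hM0) _
  · exact (integrable_indicator_iff hK.measurableSet).2 (integrableOn_const hK.measure_ne_top)
  · filter_upwards [measure_eq_zero_iff_ae_notMem.1 (hU.volume_slice_frontier t₀)] with y hy
    have hind : ContinuousAt (U.indicator G) (t₀, y) :=
      (hG.mono (interior_subset.trans subset_closure)).continuousAt_indicator hy
    exact hind.comp (f := fun t : ℝ => ((t, y) : Spacetime n)) (by fun_prop)

lemma sliceInt_mul_add_mul (hU : IsGTC U) (hn : 1 ≤ n) {F G : Spacetime n → ℝ}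
    (hF : ContinuousOn F (closure U)) (hG : ContinuousOn G (closure U)) (α β : ℝ → ℝ) (t : ℝ) :
    sliceInt U (fun p => α p.1 * F p + β p.1 * G p) t =
      α t * sliceInt U F t + β t * sliceInt U G t := by
  simp only [sliceInt]
  rw [integral_add ((hU.integrableOn_slice hn hF t).const_mul _)
    ((hU.integrableOn_slice hn hG t).const_mul _), integral_const_mul, integral_const_mul]

lemma integral_eq_integral_sliceInt (hU : IsGTC U) {G : Spacetime n → ℝ}
    (hG : IntegrableOn G U) : ∫ p in U, G p = ∫ t, sliceInt U G t := by
  have hind : Integrable (U.indicator G) (volume.prod volume) :=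
    (integrable_indicator_iff hU.isOpen.measurableSet).2 hG
  rw [← integral_indicator hU.isOpen.measurableSet, Measure.volume_eq_prod, integral_prod _ hind]
  simp only [hU.sliceInt_eq_integral_indicator G]

lemma integrableOn_of_continuousOn (hU : IsGTC U) (hn : 1 ≤ n) {G : Spacetime n → ℝ}
    (hG : ContinuousOn G (closure U)) {a b : ℝ} (h0 : ∀ p ∈ U, p.1 ∉ Icc a b → G p = 0) :
    IntegrableOn G U := by
  have hslab : IntegrableOn G (closure U ∩ Prod.fst ⁻¹' Icc a b) :=
    (hG.mono inter_subset_left).integrableOn_compact (hU.isCompact_slab hn a b)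
  exact hslab.of_forall_sdiff_eq_zero hU.isOpen.measurableSet fun p hp =>
    h0 p hp.1 fun h => hp.2 ⟨subset_closure hp.1, h⟩

end IsGTC

lemma diverg_smul {V : Spacetime n → Spacetime n} {f : Spacetime n → ℝ} {p : Spacetime n}
    (hf : DifferentiableAt ℝ f p) (hV : DifferentiableAt ℝ V p) :
    diverg (fun q => f q • V q) p = fderiv ℝ f p (V p) + f p * diverg V p := by
  rw [diverg, fderiv_fun_smul hf hV, clm_apply_eq_sum _ (V p), diverg]
  simp only [add_apply, smul_apply, ContinuousLinearMap.smulRight_apply, Prod.fst_add,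
    Prod.smul_fst, Prod.snd_add, Prod.smul_snd, PiLp.add_apply, PiLp.smul_apply, smul_eq_mul,
    mul_comm, mul_add, Finset.mul_sum, Finset.sum_add_distrib]
  ring

lemma diverg_time_smul {V : Spacetime n → Spacetime n} {θ : ℝ → ℝ} (hθ : ContDiff ℝ 1 θ)
    {p : Spacetime n} (hV : DifferentiableAt ℝ V p) :
    diverg (fun p => θ p.1 • V p) p = deriv θ p.1 * (V p).1 + θ p.1 * diverg V p := by
  have hθp : HasFDerivAt (fun p : Spacetime n => θ p.1)
      (deriv θ p.1 • ContinuousLinearMap.fst ℝ ℝ (EuclideanSpace ℝ (Fin n))) p :=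
    (hθ.differentiable one_ne_zero p.1).hasDerivAt.comp_hasFDerivAt p hasFDerivAt_fst
  rw [diverg_smul hθp.differentiableAt hV, hθp.fderiv]
  rfl

variable {V : Spacetime n → Spacetime n} {D : Spacetime n → ℝ} {θ : ℝ → ℝ}

lemma IsGTC.integral_diverg_time_smul (hU : IsGTC U) (hn : 1 ≤ n) (hθ : ContDiff ℝ 1 θ) {a b : ℝ}
    (hsupp : tsupport θ ⊆ Icc a b) (hV : ContDiffOn ℝ 1 V (closure U))
    (hD : ContinuousOn D (closure U)) (hdiv : ∀ p ∈ U, diverg V p = D p) :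
    ∫ p in U, diverg (fun p => θ p.1 • V p) p =
      ∫ t, deriv θ t * (sliceInt U (fun p => (V p).1) t - ∫ s in a..t, sliceInt U D s) := by
  have hV₁ : ContinuousOn (fun p => (V p).1) (closure U) := hV.continuousOn.fst
  have hEc := hU.continuous_sliceInt hn hV₁
  have hDc := hU.continuous_sliceInt hn hD
  have hθ' : Continuous (deriv θ) := hθ.continuous_deriv le_rfl
  have hc : HasCompactSupport θ := isCompact_Icc.of_isClosed_subset (isClosed_tsupport θ) hsupp
  let G : Spacetime n → ℝ := fun p => deriv θ p.1 * (V p).1 + θ p.1 * D p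
  have hG : IntegrableOn G U := by
    have hGc : ContinuousOn G (closure U) := by
      have := hθ.continuous
      fun_prop
    refine hU.integrableOn_of_continuousOn hn hGc (a := a) (b := b) fun p _ hpt => ?_
    have hnot : p.1 ∉ tsupport θ := fun h => hpt (hsupp h)
    simp only [G, image_eq_zero_of_notMem_tsupport hnot, zero_mul, add_zero,
      Function.notMem_support.1 fun h => hnot (support_deriv_subset h)]
  have hdivG : ∀ p ∈ U, diverg (fun p => θ p.1 • V p) p = G p := fun p hp => by
    have hVp : ContDiffAt ℝ 1 V p :=
      hV.contDiffAt (mem_of_superset (hU.isOpen.mem_nhds hp) subset_closure)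
    rw [diverg_time_smul hθ (hVp.differentiableAt one_ne_zero), hdiv p hp]
  have hint : ∀ {f : ℝ → ℝ}, Continuous f → Integrable fun t => deriv θ t * f t := fun hf =>
    (hθ'.mul hf).integrable_of_hasCompactSupport hc.deriv.mul_right
  have hθD : Integrable fun t => θ t * sliceInt U D t :=
    (hθ.continuous.mul hDc).integrable_of_hasCompactSupport hc.mul_right
  rw [setIntegral_congr_fun hU.isOpen.measurableSet hdivG, hU.integral_eq_integral_sliceInt hG]
  simp only [G, hU.sliceInt_mul_add_mul hn hV₁ hD, mul_sub]
  rw [integral_add (hint hEc) hθD, integral_mul_eq_neg_integral_deriv_mul hθ hc hDc a,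
    ← sub_eq_add_neg, integral_sub (hint hEc)
      (hint (intervalIntegral.continuous_primitive (fun _ _ => hDc.intervalIntegrable _ _) a))]

theorem IsGTC.exists_slab_bound (hU : IsGTC U) (hn : 1 ≤ n) (a b : ℝ) :
    ∃ C : ℝ≥0, ∀ (V : Spacetime n → Spacetime n) (D : Spacetime n → ℝ) (Γ : Set (Spacetime n))
      (h : Spacetime n → ℝ≥0∞) (τm τp : ℝ), a ≤ τm → τm < τp → τp ≤ b →
      ContDiffOn ℝ 1 V (closure U) → ContinuousOn D (closure U) → (∀ p ∈ U, diverg V p = D p) →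
      (∀ p ∈ frontier U, p.1 ∈ Ioo τm τp →
        ENNReal.ofReal (-edot (V p) (euclNormal U p)) ≤ Γ.indicator h p) →
      ENNReal.ofReal (sliceInt U (fun p => (V p).1) τp - sliceInt U (fun p => (V p).1) τm -
        ∫ t in τm..τp, sliceInt U D t) ≤ C * ∫⁻ p in Γ, h p ∂(euclSurfaceMeasure n) := by
  obtain ⟨C, hC⟩ := hU.exists_flux_bound hn a b
  refine ⟨C, fun V D Γ h τm τp ha hτ hb hV hD hdiv hflux => ?_⟩
  obtain ⟨θ, hθs, hθ0, hθ1, hθz, hθlim⟩ := exists_cutoff_seq hτ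
  let H : ℝ → ℝ := fun t => sliceInt U (fun p => (V p).1) t - ∫ s in τm..t, sliceInt U D s
  have hbound : ∀ k, ENNReal.ofReal (-∫ t, deriv (θ k) t * H t) ≤
      C * ∫⁻ p in Γ, h p ∂(euclSurfaceMeasure n) := by
    intro k
    have hsupp : tsupport (θ k) ⊆ Icc τm τp := closure_minimal
      (fun t ht => Ioo_subset_Icc_self (by_contra fun hnot => ht (hθz k t hnot))) isClosed_Icc
    rw [← hU.integral_diverg_time_smul hn (hθs k) hsupp hV hD hdiv]
    refine hC _ Γ h (((hθs k).comp contDiff_fst).contDiffOn.smul hV) (fun p hp => ?_)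
      fun p _ hpt => ?_
    · by_cases hpt : p.1 ∈ Ioo τm τp
      · rw [edot_comm, edot_smul_right, edot_comm, ← mul_neg, ENNReal.ofReal_mul (hθ0 k _)]
        exact (mul_le_of_le_one_left zero_le (ENNReal.ofReal_le_one.2 (hθ1 k p.1))).trans
          (hflux p hp hpt)
      · simp [hθz k _ hpt, edot]
    · rw [hθz k p.1 fun h => hpt ⟨ha.trans h.1.le, h.2.le.trans hb⟩, zero_smul]
  have hHc : Continuous H := (hU.continuous_sliceInt hn hV.continuousOn.fst).sub
    (intervalIntegral.continuous_primitive
      (fun _ _ => (hU.continuous_sliceInt hn hD).intervalIntegrable _ _) τm)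
  have hlim := (ENNReal.continuous_ofReal.tendsto _).comp (hθlim H hHc).neg
  have hdiff : -(H τm - H τp) = sliceInt U (fun p => (V p).1) τp -
      sliceInt U (fun p => (V p).1) τm - ∫ t in τm..τp, sliceInt U D t := by
    simp only [H, intervalIntegral.integral_same]
    ring
  rw [hdiff] at hlim
  exact le_of_tendsto' hlim hbound

end Spacetime

namespace Spacetime

variable {n : ℕ}

section Mink

/-- The reflection `(t, x) ↦ (-t, x)`, which turns the Euclidean inner product into the Minkowski
metric. -/
noncomputable def timeReflect : Spacetime n →L[ℝ] Spacetime n :=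
  (-ContinuousLinearMap.fst ℝ ℝ (EuclideanSpace ℝ (Fin n))).prod
    (ContinuousLinearMap.snd ℝ ℝ (EuclideanSpace ℝ (Fin n)))

/-- The vector metrically equivalent to a covector for the Minkowski metric. -/
noncomputable def sharp : (Spacetime n →L[ℝ] ℝ) →L[ℝ] Spacetime n :=
  -(ContinuousLinearMap.apply ℝ ℝ eT).smulRight eT +
    ∑ i, (ContinuousLinearMap.apply ℝ ℝ (eX i)).smulRight (eX i)

lemma mink_eq_edot (v w : Spacetime n) : mink v w = edot (timeReflect v) w := by
  simp [mink, edot, timeReflect]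

lemma mink_comm (v w : Spacetime n) : mink v w = mink w v := by
  simp only [mink, real_inner_comm, mul_comm]

lemma mink_smul_right (c : ℝ) (v w : Spacetime n) : mink v (c • w) = c * mink v w := by
  rw [mink_eq_edot, edot_smul_right, ← mink_eq_edot]

lemma mink_timeReflect (v w : Spacetime n) : mink v (timeReflect w) = edot v w := by
  simp [mink, edot, timeReflect]

lemma sharp_fst (A : Spacetime n →L[ℝ] ℝ) : (sharp A).1 = -A eT := by
  simp [sharp, eT, eX, Prod.fst_sum]

lemma sharp_snd (A : Spacetime n →L[ℝ] ℝ) (i : Fin n) : (sharp A).2 i = A (eX i) := by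
  simp [sharp, eT, eX, Prod.snd_sum, Pi.single_apply]

lemma mink_sharp (A : Spacetime n →L[ℝ] ℝ) (v : Spacetime n) : mink (sharp A) v = A v := by
  rw [mink, clm_apply_eq_sum A v, sharp_fst, PiLp.inner_apply]
  simp only [sharp_snd, RCLike.inner_apply, conj_trivial]
  ring

lemma norm_sq_le_edot_self (v : Spacetime n) : ‖v‖ ^ 2 ≤ edot v v := by
  rw [edot_self, Prod.norm_def, Real.norm_eq_abs]
  rcases max_choice |v.1| ‖v.2‖ with h | h <;> rw [h]
  · rw [sq_abs]
    nlinarith [sq_nonneg ‖v.2‖]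
  · nlinarith [sq_nonneg v.1]

lemma abs_mink_le (v w : Spacetime n) : |mink v w| ≤ 2 * (‖v‖ * ‖w‖) := by
  have htime : |v.1 * w.1| ≤ ‖v‖ * ‖w‖ := by
    rw [abs_mul]
    gcongr
    exacts [norm_fst_le v, norm_fst_le w]
  have hspace : |inner ℝ v.2 w.2| ≤ ‖v‖ * ‖w‖ := by
    refine (abs_real_inner_le_norm _ _).trans ?_
    gcongr
    exacts [norm_snd_le v, norm_snd_le w]
  calc |mink v w| ≤ |-(v.1 * w.1)| + |inner ℝ v.2 w.2| := abs_add_le _ _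
    _ ≤ _ := by
      rw [abs_neg]
      linarith

variable {E : Type*} [NormedAddCommGroup E] [NormedSpace ℝ E] {f g : E → Spacetime n} {s : Set E}

lemma fderiv_mink_apply {x : E} (hf : DifferentiableAt ℝ f x) (hg : DifferentiableAt ℝ g x)
    (v : E) : fderiv ℝ (fun y => mink (f y) (g y)) x v =
      mink (fderiv ℝ f x v) (g x) + mink (f x) (fderiv ℝ g x v) := by
  have htime := hf.hasFDerivAt.fst.mul hg.hasFDerivAt.fst
  have hspace := hf.hasFDerivAt.snd.inner ℝ hg.hasFDerivAt.snd
  have hmink : fderiv ℝ (fun y => mink (f y) (g y)) x = _ := (htime.neg.add hspace).fderiv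
  rw [hmink]
  simp only [mink, neg_add_rev, add_apply, neg_apply, smul_apply, smul_eq_mul,
    ContinuousLinearMap.comp_apply, ContinuousLinearMap.prod_apply, ContinuousLinearMap.coe_fst',
    ContinuousLinearMap.coe_snd', fderivInnerCLM_apply]
  ring

lemma differentiableAt_mink {x : E} (hf : DifferentiableAt ℝ f x) (hg : DifferentiableAt ℝ g x) :
    DifferentiableAt ℝ (fun y => mink (f y) (g y)) x :=
  (hf.fst.mul hg.fst).neg.add (hf.snd.inner ℝ hg.snd)

lemma contDiffOn_mink {k : WithTop ℕ∞} (hf : ContDiffOn ℝ k f s) (hg : ContDiffOn ℝ k g s) :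
    ContDiffOn ℝ k (fun y => mink (f y) (g y)) s :=
  (hf.fst.mul hg.fst).neg.add (hf.snd.inner ℝ hg.snd)

lemma continuousOn_mink (hf : ContinuousOn f s) (hg : ContinuousOn g s) :
    ContinuousOn (fun y => mink (f y) (g y)) s :=
  contDiffOn_zero.1 (contDiffOn_mink (contDiffOn_zero.2 hf) (contDiffOn_zero.2 hg))

end Mink

variable {U : Set (Spacetime n)} {φ : Spacetime n → ℝ} {X : Spacetime n → Spacetime n} {w : ℝ}
  {p : Spacetime n}

/-- The Dirichlet problem for the wave equation on `U`. Two derivatives suffice for the energy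
currents below to be `C¹` up to the boundary. -/
structure IsDirichletWave (U : Set (Spacetime n)) (φ : Spacetime n → ℝ) : Prop where
  contDiffOn : ContDiffOn ℝ 2 φ (closure U)
  box_eq_zero : ∀ p ∈ U, box φ p = 0
  eq_zero : ∀ p ∈ frontier U, φ p = 0

/-- The Minkowski gradient of `φ`, up to the boundary of `U`. -/
noncomputable def minkGrad (U : Set (Spacetime n)) (φ : Spacetime n → ℝ) (p : Spacetime n) :
    Spacetime n :=
  sharp (fderivWithin ℝ φ (closure U) p)

/-- The energy density `(|∂ₜφ|² + |∇φ|²) / 2`. -/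
noncomputable def energyDensity (U : Set (Spacetime n)) (φ : Spacetime n → ℝ)
    (p : Spacetime n) : ℝ :=
  edot (minkGrad U φ p) (minkGrad U φ p) / 2

/-- The energy current of `φ` for the multiplier `Xφ + wφ`: the vector field `-Q(X, ·) - wφ dφ`,
with `Q` the energy-momentum tensor `dφ ⊗ dφ - g(dφ, dφ) g / 2` and the index raised. -/
noncomputable def current (U : Set (Spacetime n)) (φ : Spacetime n → ℝ)
    (X : Spacetime n → Spacetime n) (w : ℝ) (p : Spacetime n) : Spacetime n :=
  (mink (minkGrad U φ p) (minkGrad U φ p) / 2) • X p -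
    (mink (minkGrad U φ p) (X p) + w * φ p) • minkGrad U φ p

/-- The divergence of a vector field, with derivatives taken within `s`. -/
noncomputable def divergWithin (X : Spacetime n → Spacetime n) (s : Set (Spacetime n))
    (p : Spacetime n) : ℝ :=
  (fderivWithin ℝ X s p eT).1 + ∑ i, (fderivWithin ℝ X s p (eX i)).2 i

/-- The divergence of `current U φ X w` for a solution `φ` of the wave equation. Unlike the
current, it involves no second derivatives of `φ` and extends continuously to the boundary. -/
noncomputable def currentDiv (U : Set (Spacetime n)) (φ : Spacetime n → ℝ)
    (X : Spacetime n → Spacetime n) (w : ℝ) (p : Spacetime n) : ℝ :=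
  mink (minkGrad U φ p) (minkGrad U φ p) / 2 * divergWithin X (closure U) p -
    mink (minkGrad U φ p) (fderivWithin ℝ X (closure U) p (minkGrad U φ p)) -
    w * mink (minkGrad U φ p) (minkGrad U φ p)

lemma mink_minkGrad (U : Set (Spacetime n)) (φ : Spacetime n → ℝ) (p v : Spacetime n) :
    mink (minkGrad U φ p) v = fderivWithin ℝ φ (closure U) p v :=
  mink_sharp _ v

lemma energyDensity_nonneg (U : Set (Spacetime n)) (φ : Spacetime n → ℝ) (p : Spacetime n) :
    0 ≤ energyDensity U φ p := by
  rw [energyDensity, edot_self]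
  positivity

lemma current_fst (U : Set (Spacetime n)) (φ : Spacetime n → ℝ) (X : Spacetime n → Spacetime n)
    (w : ℝ) (p : Spacetime n) :
    (current U φ X w p).1 = (X p).1 * energyDensity U φ p -
      (minkGrad U φ p).1 * (inner ℝ (minkGrad U φ p).2 (X p).2 + w * φ p) := by
  simp only [current, energyDensity, mink, edot, Prod.fst_sub, Prod.smul_fst, smul_eq_mul]
  ring

section Regularity

lemma IsGTC.contDiffOn_minkGrad (hU : IsGTC U) (hφ : ContDiffOn ℝ 2 φ (closure U)) :
    ContDiffOn ℝ 1 (minkGrad U φ) (closure U) :=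
  sharp.contDiff.comp_contDiffOn (hφ.fderivWithin hU.uniqueDiffOn (by norm_num))

lemma IsGTC.contDiffOn_current (hU : IsGTC U) (hφ : ContDiffOn ℝ 2 φ (closure U))
    (hX : ContDiffOn ℝ 1 X (closure U)) (w : ℝ) :
    ContDiffOn ℝ 1 (current U φ X w) (closure U) := by
  have hG := hU.contDiffOn_minkGrad hφ
  exact (((contDiffOn_mink hG hG).div_const 2).smul hX).sub
    (((contDiffOn_mink hG hX).add (contDiffOn_const.mul (hφ.of_le one_le_two))).smul hG)

lemma IsGTC.continuousOn_currentDiv (hU : IsGTC U) (hφ : ContDiffOn ℝ 2 φ (closure U))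
    (hX : ContDiffOn ℝ 1 X (closure U)) (w : ℝ) :
    ContinuousOn (currentDiv U φ X w) (closure U) := by
  have hG := (hU.contDiffOn_minkGrad hφ).continuousOn
  have hX' := hX.continuousOn_fderivWithin hU.uniqueDiffOn le_rfl
  have hdiv : ContinuousOn (divergWithin X (closure U)) (closure U) := by
    unfold divergWithin
    fun_prop
  have hGG := continuousOn_mink hG hG
  exact (((hGG.div_const 2).mul hdiv).sub (continuousOn_mink hG (hX'.clm_apply hG))).sub
    (continuousOn_const.mul hGG)

lemma IsGTC.continuousOn_energyDensity (hU : IsGTC U) (hφ : ContDiffOn ℝ 2 φ (closure U)) :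
    ContinuousOn (energyDensity U φ) (closure U) := by
  have hG := (hU.contDiffOn_minkGrad hφ).continuousOn
  exact ((hG.fst.mul hG.fst).add (hG.snd.inner hG.snd)).div_const 2

end Regularity

section Divergence

lemma divergWithin_of_mem_nhds {s : Set (Spacetime n)} (hs : s ∈ 𝓝 p) :
    divergWithin X s p = diverg X p := by
  rw [divergWithin, fderivWithin_of_mem_nhds hs, diverg]

lemma diverg_sub {Y : Spacetime n → Spacetime n} (hX : DifferentiableAt ℝ X p)
    (hY : DifferentiableAt ℝ Y p) :
    diverg (fun q => X q - Y q) p = diverg X p - diverg Y p := by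
  simp only [diverg, fderiv_fun_sub hX hY, sub_apply, Prod.fst_sub, Prod.snd_sub, PiLp.sub_apply,
    Finset.sum_sub_distrib]
  ring

lemma minkGrad_eventuallyEq (hU : IsOpen U) (hp : p ∈ U) :
    minkGrad U φ =ᶠ[𝓝 p] fun q => sharp (fderiv ℝ φ q) := by
  filter_upwards [hU.mem_nhds hp] with q hq
  rw [minkGrad, fderivWithin_of_mem_nhds (mem_of_superset (hU.mem_nhds hq) subset_closure)]

lemma fderiv_minkGrad (hU : IsOpen U) (hφ : ContDiffOn ℝ 2 φ (closure U)) (hp : p ∈ U)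
    (v : Spacetime n) : fderiv ℝ (minkGrad U φ) p v = sharp (fderiv ℝ (fderiv ℝ φ) p v) := by
  have hφp : ContDiffAt ℝ 2 φ p :=
    hφ.contDiffAt (mem_of_superset (hU.mem_nhds hp) subset_closure)
  have hd : DifferentiableAt ℝ (fderiv ℝ φ) p :=
    (hφp.fderiv_right (m := 1) (by norm_num)).differentiableAt one_ne_zero
  have hcomp : fderiv ℝ (fun q => sharp (fderiv ℝ φ q)) p = _ :=
    (sharp.hasFDerivAt.comp p hd.hasFDerivAt).fderiv
  rw [(minkGrad_eventuallyEq hU hp).fderiv_eq, hcomp]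
  rfl

lemma diverg_minkGrad (hU : IsOpen U) (hφ : ContDiffOn ℝ 2 φ (closure U)) (hp : p ∈ U) :
    diverg (minkGrad U φ) p = box φ p := by
  simp only [diverg, fderiv_minkGrad hU hφ hp, sharp_fst, sharp_snd, box]

lemma mink_fderiv_minkGrad_comm (hU : IsOpen U) (hφ : ContDiffOn ℝ 2 φ (closure U)) (hp : p ∈ U)
    (v u : Spacetime n) :
    mink (fderiv ℝ (minkGrad U φ) p v) u = mink (fderiv ℝ (minkGrad U φ) p u) v := by
  have hφp : ContDiffAt ℝ 2 φ p :=
    hφ.contDiffAt (mem_of_superset (hU.mem_nhds hp) subset_closure)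
  simp only [fderiv_minkGrad hU hφ hp, mink_sharp]
  exact (hφp.isSymmSndFDerivAt (by simp only [minSmoothness_of_isRCLikeNormedField]; rfl)).eq v u

lemma IsGTC.diverg_current (hU : IsGTC U) (hφ : ContDiffOn ℝ 2 φ (closure U))
    (hX : ContDiffOn ℝ 1 X (closure U)) (hp : p ∈ U) (hbox : box φ p = 0) :
    diverg (current U φ X w) p = currentDiv U φ X w p := by
  have hnhds : closure U ∈ 𝓝 p := hU.closure_mem_nhds hp
  have hG : DifferentiableAt ℝ (minkGrad U φ) p :=
    ((hU.contDiffOn_minkGrad hφ).contDiffAt hnhds).differentiableAt one_ne_zero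
  have hXp : DifferentiableAt ℝ X p := (hX.contDiffAt hnhds).differentiableAt one_ne_zero
  have hφp : DifferentiableAt ℝ φ p := (hφ.contDiffAt hnhds).differentiableAt two_ne_zero
  set G := minkGrad U φ with hGdef
  have hdG : diverg G p = 0 := (diverg_minkGrad hU.isOpen hφ hp).trans hbox
  have hGG : DifferentiableAt ℝ (fun q => 2⁻¹ * mink (G q) (G q)) p :=
    (differentiableAt_mink hG hG).const_mul 2⁻¹
  have hGX : DifferentiableAt ℝ (fun q => mink (G q) (X q) + w * φ q) p :=
    (differentiableAt_mink hG hXp).add (hφp.const_mul w)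
  have hGG' : fderiv ℝ (fun q => 2⁻¹ * mink (G q) (G q)) p (X p) =
      mink (fderiv ℝ G p (X p)) (G p) := by
    rw [fderiv_const_mul (differentiableAt_mink hG hG), smul_apply, fderiv_mink_apply hG hG,
      mink_comm (G p), smul_eq_mul]
    ring
  have hGX' : fderiv ℝ (fun q => mink (G q) (X q) + w * φ q) p (G p) =
      mink (fderiv ℝ G p (X p)) (G p) + mink (G p) (fderiv ℝ X p (G p)) +
        w * mink (G p) (G p) := by
    rw [fderiv_fun_add (differentiableAt_mink hG hXp) (hφp.const_mul w), add_apply,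
      fderiv_mink_apply hG hXp, mink_fderiv_minkGrad_comm hU.isOpen hφ hp, fderiv_const_mul hφp,
      smul_apply, smul_eq_mul, hGdef, mink_minkGrad U φ p (minkGrad U φ p),
      fderivWithin_of_mem_nhds hnhds]
  calc diverg (current U φ X w) p =
        diverg
          (fun q => (2⁻¹ * mink (G q) (G q)) • X q - (mink (G q) (X q) + w * φ q) • G q) p := by
        simp only [← div_eq_inv_mul]
        rfl
    _ = mink (fderiv ℝ G p (X p)) (G p) + 2⁻¹ * mink (G p) (G p) * diverg X p -
        (mink (fderiv ℝ G p (X p)) (G p) + mink (G p) (fderiv ℝ X p (G p)) +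
          w * mink (G p) (G p)) := by
      rw [diverg_sub (hGG.fun_smul hXp) (hGX.fun_smul hG), diverg_smul hGG hXp, diverg_smul hGX hG,
        hdG, hGG', hGX', mul_zero, add_zero]
    _ = currentDiv U φ X w p := by
      rw [currentDiv, divergWithin_of_mem_nhds hnhds, fderivWithin_of_mem_nhds hnhds]
      ring

end Divergence

lemma norm_eT : ‖(eT : Spacetime n)‖ = 1 := by simp [eT, Prod.norm_def]

lemma norm_eX (i : Fin n) : ‖(eX i : Spacetime n)‖ = 1 := by simp [eX, Prod.norm_def]

lemma abs_divergWithin_le (X : Spacetime n → Spacetime n) (s : Set (Spacetime n))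
    (p : Spacetime n) : |divergWithin X s p| ≤ (n + 1) * ‖fderivWithin ℝ X s p‖ := by
  set A := fderivWithin ℝ X s p
  have htime : |(A eT).1| ≤ ‖A‖ := by
    simpa [norm_eT] using (norm_fst_le _).trans (A.le_opNorm eT)
  have hspace (i : Fin n) : |(A (eX i)).2 i| ≤ ‖A‖ := by
    simpa [norm_eX] using
      ((PiLp.norm_apply_le (A (eX i)).2 i).trans (norm_snd_le _)).trans (A.le_opNorm (eX i))
  calc |divergWithin X s p| ≤ |(A eT).1| + ∑ i, |(A (eX i)).2 i| :=
        (abs_add_le _ _).trans (by gcongr; exact Finset.abs_sum_le_sum_abs _ _)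
    _ ≤ ‖A‖ + ∑ _i : Fin n, ‖A‖ := by
      gcongr with i
      exact hspace i
    _ = (n + 1) * ‖A‖ := by
      rw [Finset.sum_const, Finset.card_univ, Fintype.card_fin, nsmul_eq_mul]
      ring

lemma abs_currentDiv_le (U : Set (Spacetime n)) (φ : Spacetime n → ℝ)
    (X : Spacetime n → Spacetime n) (p : Spacetime n) :
    |currentDiv U φ X 0 p| ≤
      2 * (n + 3) * ‖fderivWithin ℝ X (closure U) p‖ * energyDensity U φ p := by
  have hdiv := abs_divergWithin_le X (closure U) p
  set A := fderivWithin ℝ X (closure U) p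
  set G := minkGrad U φ p
  have hnorm : ‖G‖ ^ 2 ≤ 2 * energyDensity U φ p := by
    linarith [norm_sq_le_edot_self G, show energyDensity U φ p = edot G G / 2 from rfl]
  have htrace : |mink G G / 2 * divergWithin X (closure U) p| ≤ ‖G‖ ^ 2 * ((n + 1) * ‖A‖) := by
    rw [abs_mul]
    gcongr
    rw [abs_div, abs_two]
    linarith [abs_mink_le G G]
  have hmink : |mink G (A G)| ≤ 2 * (‖G‖ * (‖A‖ * ‖G‖)) :=
    (abs_mink_le _ _).trans (by gcongr; exact A.le_opNorm G)
  calc |currentDiv U φ X 0 p| = |mink G G / 2 * divergWithin X (closure U) p - mink G (A G)| := by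
        rw [currentDiv, zero_mul, sub_zero]
    _ ≤ ‖G‖ ^ 2 * ((n + 1) * ‖A‖) + 2 * (‖G‖ * (‖A‖ * ‖G‖)) :=
        (abs_sub _ _).trans (add_le_add htrace hmink)
    _ = (n + 3) * ‖A‖ * ‖G‖ ^ 2 := by ring
    _ ≤ (n + 3) * ‖A‖ * (2 * energyDensity U φ p) := by gcongr
    _ = _ := by ring

end Spacetime

namespace Spacetime

variable {n : ℕ} {U : Set (Spacetime n)} {φ : Spacetime n → ℝ} {X : Spacetime n → Spacetime n}
  {w : ℝ} {p : Spacetime n}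

lemma IsGraphPatch.fderivWithin_tangent_eq_zero {k : Fin n} {ε : ℝ}
    {ψ : EuclideanSpace ℝ (Fin n) → ℝ} {W : Set (Spacetime n)} (hW : IsGraphPatch U W (flip k ε) ψ)
    (hε : ε * ε = 1) (hψ : ContDiff ℝ 1 ψ) (hφ : ∀ p ∈ frontier U, φ p = 0)
    {y : EuclideanSpace ℝ (Fin n)} (hy : flip k ε (ψ y, y) ∈ W)
    (hφd : DifferentiableWithinAt ℝ φ (closure U) (flip k ε (ψ y, y)))
    (v : EuclideanSpace ℝ (Fin n)) :
    fderivWithin ℝ φ (closure U) (flip k ε (ψ y, y)) (flip k ε (fderiv ℝ ψ y v, v)) = 0 := by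
  have hgraph : Continuous fun y => flip k ε (ψ y, y) := by
    have := hψ.continuous
    fun_prop
  have hmem : ∀ᶠ z in 𝓝 y, flip k ε (ψ z, z) ∈ frontier U :=
    (hgraph.tendsto y).eventually (hW.isOpen.mem_nhds hy) |>.mono fun z hz =>
      (hW.exists_eq_edot hε hz).1
  have hgraph' : HasFDerivAt (fun y => flip k ε (ψ y, y))
      (flip k ε ∘L (fderiv ℝ ψ y).prod (.id ℝ _)) y :=
    (flip k ε).hasFDerivAt.comp y
      ((hψ.differentiable one_ne_zero y).hasFDerivAt.prodMk (hasFDerivAt_id y))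
  have hcomp : HasFDerivAt (φ ∘ fun y => flip k ε (ψ y, y)) _ y :=
    hφd.hasFDerivWithinAt.comp_hasFDerivAt y hgraph'
      (hmem.mono fun z hz => frontier_subset_closure hz)
  have hzero : HasFDerivAt (φ ∘ fun y => flip k ε (ψ y, y)) (0 : _ →L[ℝ] ℝ) y :=
    (hasFDerivAt_const (0 : ℝ) y).congr_of_eventuallyEq (hmem.mono fun z hz => hφ _ hz)
  exact DFunLike.congr_fun (hcomp.unique hzero) v

lemma IsGTC.exists_fderivWithin_eq (hU : IsGTC U) (hφ : ∀ p ∈ frontier U, φ p = 0)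
    (hp : p ∈ frontier U) (hφp : DifferentiableWithinAt ℝ φ (closure U) p) :
    ∃ l : ℝ, ∀ v, fderivWithin ℝ φ (closure U) p v = l * edot v (euclNormal U p) := by
  obtain ⟨k, ε, ψ, W, hε, hψ, hpW, hW⟩ := hU.exists_graphPatch hp
  obtain ⟨y, rfl⟩ : ∃ y, flip k ε (ψ y, y) = p :=
    ⟨(flip k ε p).2, by
      rw [← hW.eq_of_mem_frontier hψ.continuous hU.isOpen hpW hp]
      exact flip_flip k hε p⟩
  obtain ⟨-, m, -, -, hm⟩ := hW.exists_eq_edot hε hpW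
  refine ⟨m * fderivWithin ℝ φ (closure U) (flip k ε (ψ y, y)) (flip k ε eT), fun v => ?_⟩
  set y' := (flip k ε v).2 with hy'
  have hdec : v = flip k ε (fderiv ℝ ψ y y', y') +
      ((flip k ε v).1 - fderiv ℝ ψ y y') • flip k ε eT := by
    conv_lhs => rw [← flip_flip k hε v]
    rw [← map_smul, ← map_add]
    congr 1
    ext1 <;> simp [eT, hy']
  conv_lhs => rw [hdec]
  rw [map_add, hW.fderivWithin_tangent_eq_zero hε (hψ.of_le one_le_two) hφ hpW hφp, map_smul,
    smul_eq_mul, zero_add, hm]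
  ring

lemma IsGTC.mink_euclNormal_pos (hU : IsGTC U) (hp : p ∈ frontier U) :
    0 < mink (euclNormal U p) (euclNormal U p) := by
  have hex : ∃ ρ, IsDefiningFunctionAt U p ρ := hU.smooth_boundary p hp
  have hρ := hex.choose_spec
  have hgrad : 0 < mink (grad hex.choose p) (grad hex.choose p) :=
    hU.timelike_boundary p hp _ hρ
  have hnorm : 0 < (√((grad hex.choose p).1 ^ 2 + ‖(grad hex.choose p).2‖ ^ 2))⁻¹ := by
    rw [← edot_self]
    exact inv_pos.2 (Real.sqrt_pos.2 (edot_self_pos hρ.grad_ne_zero))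
  rw [euclNormal, dif_pos hex, mink_smul_right, mink_comm, mink_smul_right]
  positivity

lemma minkNormal_eq (U : Set (Spacetime n)) (p : Spacetime n) :
    minkNormal U p = (√(mink (euclNormal U p) (euclNormal U p)))⁻¹ • timeReflect (euclNormal U p) :=
  rfl

lemma edot_timeReflect (v w : Spacetime n) : edot (timeReflect v) w = mink v w :=
  (mink_eq_edot v w).symm

lemma IsGTC.normalDeriv_sq (hU : IsGTC U) (hp : p ∈ frontier U) {l : ℝ}
    (hl : ∀ v, fderivWithin ℝ φ (closure U) p v = l * edot v (euclNormal U p)) :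
    normalDeriv U φ p ^ 2 = l ^ 2 * mink (euclNormal U p) (euclNormal U p) := by
  have hpos := hU.mink_euclNormal_pos hp
  rw [normalDeriv, minkNormal_eq, map_smul, hl, edot_timeReflect, smul_eq_mul, mul_pow, mul_pow,
    inv_pow, Real.sq_sqrt hpos.le]
  field_simp

lemma IsGTC.edot_current (hU : IsGTC U) (hφ : ∀ p ∈ frontier U, φ p = 0)
    (hp : p ∈ frontier U) (hφp : DifferentiableWithinAt ℝ φ (closure U) p) :
    -edot (current U φ X w p) (euclNormal U p) =
      normalDeriv U φ p ^ 2 * edot (X p) (euclNormal U p) / 2 := by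
  obtain ⟨l, hl⟩ := hU.exists_fderivWithin_eq hφ hp hφp
  set ν := euclNormal U p with hν
  have hGν : edot (minkGrad U φ p) ν = l * mink ν ν := by
    rw [← mink_timeReflect, mink_minkGrad, hl, edot_timeReflect]
  have hGG : mink (minkGrad U φ p) (minkGrad U φ p) = l ^ 2 * mink ν ν := by
    rw [mink_minkGrad, hl, hGν]
    ring
  have hlin : edot (current U φ X w p) ν =
      mink (minkGrad U φ p) (minkGrad U φ p) / 2 * edot (X p) ν -
        (mink (minkGrad U φ p) (X p) + w * φ p) * edot (minkGrad U φ p) ν := by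
    simp only [current, edot, Prod.fst_sub, Prod.snd_sub, Prod.smul_fst, Prod.smul_snd,
      inner_sub_left, real_inner_smul_left, smul_eq_mul]
    ring
  rw [hU.normalDeriv_sq hp hl, hlin, hGG, hGν, mink_minkGrad, hl, hφ p hp, ← hν]
  ring

/-- The scaling vector field centred at `P`. -/
noncomputable def scaling (P p : Spacetime n) : Spacetime n := p - P

lemma contDiff_scaling (P : Spacetime n) {m : WithTop ℕ∞} : ContDiff ℝ m (scaling P) :=
  contDiff_id.sub contDiff_const

lemma fderiv_hyp (P q v : Spacetime n) : fderiv ℝ (hyp P) q v = mink (scaling P q) v / 2 := by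
  have hd : DifferentiableAt ℝ (scaling P) q := (contDiff_scaling P).differentiable one_ne_zero q
  have hyp_eq : hyp P = fun q => 4⁻¹ * mink (scaling P q) (scaling P q) := by
    ext q
    rw [mink_self, hyp, scaling, Prod.fst_sub, Prod.snd_sub]
    ring
  have hscaling : fderiv ℝ (scaling P) q v = v := by
    have hid : HasFDerivAt (scaling P) (.id ℝ _) q := (hasFDerivAt_id q).sub_const P
    rw [hid.fderiv, ContinuousLinearMap.id_apply]
  rw [hyp_eq, fderiv_const_mul (differentiableAt_mink hd hd), smul_apply, fderiv_mink_apply hd hd,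
    hscaling, mink_comm v, smul_eq_mul]
  ring

lemma fderiv_hyp_minkNormal (P : Spacetime n) :
    fderiv ℝ (hyp P) p (minkNormal U p) = (√(mink (euclNormal U p) (euclNormal U p)))⁻¹ *
      edot (scaling P p) (euclNormal U p) / 2 := by
  rw [fderiv_hyp, minkNormal_eq, mink_smul_right, mink_timeReflect]

lemma IsGTC.currentDiv_scaling (hU : IsGTC U) (P : Spacetime n) (hp : p ∈ closure U) :
    currentDiv U φ (scaling P) ((n - 1) / 2) p = 0 := by
  have hid : fderivWithin ℝ (scaling P) (closure U) p = .id ℝ _ :=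
    ((hasFDerivAt_id p).sub_const P).hasFDerivWithinAt.fderivWithin (hU.uniqueDiffOn p hp)
  have hdiv : divergWithin (scaling P) (closure U) p = n + 1 := by
    simp [divergWithin, hid, eT, eX, add_comm]
  rw [currentDiv, hdiv, hid, ContinuousLinearMap.id_apply]
  ring

end Spacetime

section Calculus

lemma abs_le_exp_mul_abs_of_abs_deriv_le {f f' : ℝ → ℝ} {k a b : ℝ} (hab : a ≤ b)
    (hf : ∀ t, HasDerivAt f (f' t) t) (hf' : ∀ t ∈ Icc a b, |f' t| ≤ k * |f t|) :
    |f b| ≤ Real.exp (k * (b - a)) * |f a| := by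
  have hgronwall := norm_le_gronwallBound_of_norm_deriv_right_le (δ := |f a|) (ε := 0)
    (fun t _ => (hf t).continuousAt.continuousWithinAt) (fun t _ => (hf t).hasDerivWithinAt) le_rfl
    (fun t ht => (hf' t (Ico_subset_Icc_self ht)).trans_eq (add_zero _).symm) b
    (right_mem_Icc.2 hab)
  rwa [gronwallBound_ε0, mul_comm] at hgronwall

lemma abs_le_exp_mul_abs_of_abs_deriv_le' {f f' : ℝ → ℝ} {k a b : ℝ} (hab : a ≤ b)
    (hf : ∀ t, HasDerivAt f (f' t) t) (hf' : ∀ t ∈ Icc a b, |f' t| ≤ k * |f t|) :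
    |f a| ≤ Real.exp (k * (b - a)) * |f b| := by
  have hreflect := abs_le_exp_mul_abs_of_abs_deriv_le (f := fun t => f (-t))
    (f' := fun t => -f' (-t)) (neg_le_neg hab) (k := k)
    (fun t => by simpa [Function.comp_def] using (hf (-t)).comp t (hasDerivAt_neg t))
    (fun t ht => by
      rw [abs_neg]
      exact hf' (-t) ⟨le_neg.2 ht.2, neg_le.2 ht.1⟩)
  simpa [neg_add_eq_sub] using hreflect

lemma gronwall_two_sided {I D : ℝ → ℝ} (hD : Continuous D) {k a b : ℝ} (hab : a ≤ b)
    (hI : ∀ t ∈ Icc a b, I t - I a = ∫ s in a..t, D s) (hI₀ : ∀ t ∈ Icc a b, 0 ≤ I t)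
    (hDI : ∀ t ∈ Icc a b, |D t| ≤ k * I t) :
    I b ≤ Real.exp (k * (b - a)) * I a ∧ I a ≤ Real.exp (k * (b - a)) * I b := by
  have hJ : ∀ t, HasDerivAt (fun t => I a + ∫ s in a..t, D s) (D t) t := fun t =>
    (intervalIntegral.integral_hasDerivAt_right (hD.intervalIntegrable _ _)
      hD.stronglyMeasurable.stronglyMeasurableAtFilter hD.continuousAt).const_add _
  have hJI : ∀ t ∈ Icc a b, |I a + ∫ s in a..t, D s| = I t := fun t ht => by
    rw [← hI t ht, add_sub_cancel, abs_of_nonneg (hI₀ t ht)]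
  have hDJ : ∀ t ∈ Icc a b, |D t| ≤ k * |I a + ∫ s in a..t, D s| := fun t ht => by
    rw [hJI t ht]
    exact hDI t ht
  have hforward := abs_le_exp_mul_abs_of_abs_deriv_le hab hJ hDJ
  have hbackward := abs_le_exp_mul_abs_of_abs_deriv_le' hab hJ hDJ
  rw [hJI a (left_mem_Icc.2 hab), hJI b (right_mem_Icc.2 hab)] at hforward hbackward
  exact ⟨hforward, hbackward⟩

lemma eq_zero_of_forall_intervalIntegral_eq_zero {f : ℝ → ℝ} (hf : Continuous f)
    (h : ∀ a b, ∫ t in a..b, f t = 0) (t : ℝ) : f t = 0 := by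
  have hprim : HasDerivAt (fun b => ∫ s in t..b, f s) (f t) t :=
    intervalIntegral.integral_hasDerivAt_right (hf.intervalIntegrable _ _)
      hf.stronglyMeasurable.stronglyMeasurableAtFilter hf.continuousAt
  simp only [h] at hprim
  exact hprim.unique (hasDerivAt_const t 0)

end Calculus

namespace Spacetime

variable {n : ℕ} {U : Set (Spacetime n)} {φ : Spacetime n → ℝ} {p : Spacetime n}

lemma sliceInt_const_mul (c : ℝ) (G : Spacetime n → ℝ) (t : ℝ) :
    sliceInt U (fun p => c * G p) t = c * sliceInt U G t :=
  integral_const_mul _ _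

lemma sliceInt_nonneg {G : Spacetime n → ℝ} (hG : ∀ p, 0 ≤ G p) (t : ℝ) : 0 ≤ sliceInt U G t :=
  integral_nonneg fun _ => hG _

lemma IsGTC.sliceInt_mono (hU : IsGTC U) (hn : 1 ≤ n) {G₁ G₂ : Spacetime n → ℝ}
    (h₁ : ContinuousOn G₁ (closure U)) (h₂ : ContinuousOn G₂ (closure U)) {t : ℝ}
    (h : ∀ y, (t, y) ∈ U → G₁ (t, y) ≤ G₂ (t, y)) : sliceInt U G₁ t ≤ sliceInt U G₂ t :=
  setIntegral_mono_on (hU.integrableOn_slice hn h₁ t) (hU.integrableOn_slice hn h₂ t)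
    (hU.slice_open t).measurableSet h

lemma IsGTC.abs_sliceInt_le (hU : IsGTC U) (hn : 1 ≤ n) {G H : Spacetime n → ℝ}
    (hG : ContinuousOn G (closure U)) (hH : ContinuousOn H (closure U)) {t : ℝ}
    (h : ∀ y, (t, y) ∈ U → |G (t, y)| ≤ H (t, y)) : |sliceInt U G t| ≤ sliceInt U H t :=
  abs_integral_le_integral_abs.trans (hU.sliceInt_mono hn hG.abs hH h)

lemma diverg_neg (V : Spacetime n → Spacetime n) (p : Spacetime n) :
    diverg (fun p => -V p) p = -diverg V p := by
  simp [diverg, fderiv_fun_neg, add_comm]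

lemma IsGTC.sliceInt_sub_le (hU : IsGTC U) (hn : 1 ≤ n) {V : Spacetime n → Spacetime n}
    {D : Spacetime n → ℝ} (hV : ContDiffOn ℝ 1 V (closure U)) (hD : ContinuousOn D (closure U))
    (hdiv : ∀ p ∈ U, diverg V p = D p)
    (htan : ∀ p ∈ frontier U, edot (V p) (euclNormal U p) = 0) {τm τp : ℝ} (hτ : τm ≤ τp) :
    sliceInt U (fun p => (V p).1) τp - sliceInt U (fun p => (V p).1) τm ≤
      ∫ t in τm..τp, sliceInt U D t := by
  rcases hτ.eq_or_lt with rfl | hlt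
  · simp
  obtain ⟨C, hC⟩ := hU.exists_slab_bound hn τm τp
  have hslab := hC V D ∅ 0 τm τp le_rfl hlt le_rfl hV hD hdiv fun p hp _ => by simp [htan p hp]
  rwa [Measure.restrict_empty, lintegral_zero_measure, mul_zero, nonpos_iff_eq_zero,
    ENNReal.ofReal_eq_zero, sub_nonpos] at hslab

lemma IsGTC.sliceInt_sub_eq (hU : IsGTC U) (hn : 1 ≤ n) {V : Spacetime n → Spacetime n}
    {D : Spacetime n → ℝ} (hV : ContDiffOn ℝ 1 V (closure U)) (hD : ContinuousOn D (closure U))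
    (hdiv : ∀ p ∈ U, diverg V p = D p)
    (htan : ∀ p ∈ frontier U, edot (V p) (euclNormal U p) = 0) (τm τp : ℝ) :
    sliceInt U (fun p => (V p).1) τp - sliceInt U (fun p => (V p).1) τm =
      ∫ t in τm..τp, sliceInt U D t := by
  wlog hτ : τm ≤ τp generalizing τm τp
  · rw [intervalIntegral.integral_symm, ← this τp τm (le_of_not_ge hτ), neg_sub]
  refine le_antisymm (hU.sliceInt_sub_le hn hV hD hdiv htan hτ) ?_
  have hneg := hU.sliceInt_sub_le hn hV.neg hD.neg
    (fun p hp => (diverg_neg V p).trans (congrArg Neg.neg (hdiv p hp)))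
    (fun p hp => by
      rw [edot_comm, ← neg_one_smul ℝ (V p), edot_smul_right, edot_comm, htan p hp,
        mul_zero]) hτ
  simp only [sliceInt, Pi.neg_apply, Prod.fst_neg, integral_neg,
    intervalIntegral.integral_neg] at hneg ⊢
  linarith

/-- The slice divergence of `φ² (x - x₀)`, whose integral over each slice vanishes for `φ` vanishing
on the boundary. -/
noncomputable def virial (U : Set (Spacetime n)) (φ : Spacetime n → ℝ)
    (x₀ : EuclideanSpace ℝ (Fin n)) (p : Spacetime n) : ℝ :=
  n * φ p ^ 2 + 2 * φ p * inner ℝ (minkGrad U φ p).2 (p.2 - x₀)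

lemma IsGTC.continuousOn_virial (hU : IsGTC U) (hφ : ContDiffOn ℝ 2 φ (closure U))
    (x₀ : EuclideanSpace ℝ (Fin n)) : ContinuousOn (virial U φ x₀) (closure U) := by
  have hG := (hU.contDiffOn_minkGrad hφ).continuousOn
  have hφc := hφ.continuousOn
  have hx : ContinuousOn (fun p : Spacetime n => p.2 - x₀) (closure U) := by fun_prop
  exact (continuousOn_const.mul (hφc.pow 2)).add
    ((continuousOn_const.mul hφc).mul (hG.snd.inner hx))

lemma diverg_sq_smul_eq_virial (hU : IsOpen U) (hφ : DifferentiableOn ℝ φ (closure U)) (hp : p ∈ U)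
    (x₀ : EuclideanSpace ℝ (Fin n)) :
    diverg (fun q => φ q ^ 2 • ((0, q.2 - x₀) : Spacetime n)) p = virial U φ x₀ p := by
  have hnhds : closure U ∈ 𝓝 p := mem_of_superset (hU.mem_nhds hp) subset_closure
  have hφp : DifferentiableAt ℝ φ p := hφ.differentiableAt hnhds
  have hradial : HasFDerivAt (fun q : Spacetime n => ((0, q.2 - x₀) : Spacetime n))
      ((0 : Spacetime n →L[ℝ] ℝ).prod (.snd ℝ ℝ _)) p :=
    (hasFDerivAt_const _ _).prodMk (hasFDerivAt_snd.sub_const _)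
  have hdiv : diverg (fun q : Spacetime n => ((0, q.2 - x₀) : Spacetime n)) p = n := by
    simp [diverg, hradial.fderiv, eX]
  have hdφ : fderiv ℝ φ p (0, p.2 - x₀) = inner ℝ (minkGrad U φ p).2 (p.2 - x₀) := by
    rw [← fderivWithin_of_mem_nhds hnhds, ← mink_minkGrad]
    simp [mink]
  rw [diverg_smul (hφp.fun_pow 2) hradial.differentiableAt, fderiv_fun_pow 2 hφp, hdiv, virial]
  simp only [smul_apply, nsmul_eq_mul, smul_eq_mul, hdφ, Nat.add_one_sub_one, pow_one,
    Nat.cast_ofNat]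
  ring

lemma IsGTC.sliceInt_virial (hU : IsGTC U) (hn : 1 ≤ n) (hφ : ContDiffOn ℝ 2 φ (closure U))
    (hφ₀ : ∀ p ∈ frontier U, φ p = 0) (x₀ : EuclideanSpace ℝ (Fin n)) (t : ℝ) :
    sliceInt U (virial U φ x₀) t = 0 := by
  have hvirial := hU.continuousOn_virial hφ x₀
  refine eq_zero_of_forall_intervalIntegral_eq_zero (hU.continuous_sliceInt hn hvirial)
    (fun a b => ?_) t
  have hV : ContDiffOn ℝ 1 (fun q => φ q ^ 2 • ((0, q.2 - x₀) : Spacetime n)) (closure U) :=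
    ((hφ.of_le one_le_two).pow 2).smul
      (contDiff_const.prodMk (contDiff_snd.sub contDiff_const)).contDiffOn
  rw [← hU.sliceInt_sub_eq hn hV hvirial
    (fun p hp => diverg_sq_smul_eq_virial hU.isOpen (hφ.differentiableOn two_ne_zero) hp x₀)
    (fun p hp => by simp [edot, hφ₀ p hp]) a b]
  simp [sliceInt]

end Spacetime

namespace Spacetime

variable {n : ℕ} {U : Set (Spacetime n)} {φ : Spacetime n → ℝ} {Z : Spacetime n → Spacetime n}
  {p : Spacetime n}

section Boundary

lemma IsGenerator.edot_euclNormal (hZ : IsGenerator U Z) (hU : IsGTC U) (hp : p ∈ frontier U) :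
    edot (Z p) (euclNormal U p) = 0 := by
  obtain ⟨ρ, hρ⟩ := hU.smooth_boundary p hp
  obtain ⟨c, hc, hfderiv⟩ := hρ.exists_fderiv_eq_edot
  have htan := hZ.tangent p hp ρ hρ
  rw [hfderiv] at htan
  exact (mul_eq_zero.1 htan).resolve_left hc.ne'

lemma IsGTC.exists_pos_le (hU : IsGTC U) (hn : 1 ≤ n) {G : Spacetime n → ℝ}
    (hG : ContinuousOn G (closure U)) (hpos : ∀ p ∈ closure U, 0 < G p) (a b : ℝ) :
    ∃ c, 0 < c ∧ ∀ p ∈ closure U, p.1 ∈ Icc a b → c ≤ G p := by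
  obtain ⟨c, hc, hle⟩ := (hU.isCompact_slab hn a b).exists_forall_le' (a := 0)
    (hG.mono inter_subset_left) fun p hp => hpos p hp.1
  exact ⟨c, hc, fun p hp hpt => hle p ⟨hp, hpt⟩⟩

lemma le_mul_mink_self_of_edot_eq_zero {v ν : Spacetime n} {δ M : ℝ} (hν : edot ν ν = 1)
    (hνν : 0 ≤ mink ν ν) (hvν : edot v ν = 0) (hδ : 0 ≤ δ) (hv : mink v v ≤ -δ)
    (hM : |v.1| ≤ M) : δ ≤ 2 * M ^ 2 * mink ν ν := by
  have hcauchy : (v.1 * ν.1) ^ 2 ≤ ‖v.2‖ ^ 2 * ‖ν.2‖ ^ 2 := by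
    rw [eq_neg_of_add_eq_zero_left hvν, neg_sq, ← mul_pow, ← sq_abs]
    gcongr
    exact abs_real_inner_le_norm _ _
  have hfst : v.1 ^ 2 ≤ M ^ 2 := by
    rw [← sq_abs]
    gcongr
  have hslope : v.1 ^ 2 * mink ν ν ≤ M ^ 2 * mink ν ν := by gcongr
  rw [edot_self] at hν
  rw [mink_self] at *
  nlinarith [mul_nonneg hδ hνν, mul_le_mul_of_nonneg_right hv (sq_nonneg ‖ν.2‖)]

lemma IsGTC.exists_le_sqrt_mink (hU : IsGTC U) (hn : 1 ≤ n) (a b : ℝ) :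
    ∃ c, 0 < c ∧ ∀ p ∈ frontier U, p.1 ∈ Icc a b →
      c ≤ √(mink (euclNormal U p) (euclNormal U p)) := by
  obtain ⟨Z, hZ⟩ := hU.generator
  have hZc := hZ.smooth.continuousOn
  obtain ⟨δ, hδ, hδle⟩ := hU.exists_pos_le hn (continuousOn_mink hZc hZc).neg
    (fun p hp => neg_pos.2 (hZ.timelike p hp)) a b
  obtain ⟨M, hM₀, hM⟩ := hU.exists_bound hn hZc.fst a b
  refine ⟨√(δ / (2 * (M + 1) ^ 2)), Real.sqrt_pos.2 (by positivity), fun p hp hpt => ?_⟩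
  have hpc := frontier_subset_closure hp
  obtain ⟨ρ, hρ⟩ := hU.smooth_boundary p hp
  rw [Real.sqrt_le_sqrt_iff (hU.mink_euclNormal_pos hp).le, div_le_iff₀' (by positivity)]
  exact le_mul_mink_self_of_edot_eq_zero hρ.edot_euclNormal_self (hU.mink_euclNormal_pos hp).le
    (hZ.edot_euclNormal hU hp) hδ.le (le_neg_of_le_neg (hδle p hpc hpt))
    ((hM p hpc hpt).trans (le_add_of_nonneg_right zero_le_one))

lemma edot_le_two_mul_norm {ν : Spacetime n} (hν : edot ν ν = 1) (v : Spacetime n) :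
    edot v ν ≤ 2 * ‖v‖ := by
  obtain ⟨hfst, hsnd⟩ := abs_fst_le_one_and_norm_snd_le_one hν
  have htime : v.1 * ν.1 ≤ ‖v‖ * 1 := by
    refine (le_abs_self _).trans ?_
    rw [abs_mul]
    gcongr
    exact norm_fst_le v
  have hspace : inner ℝ v.2 ν.2 ≤ ‖v‖ * 1 := by
    refine (real_inner_le_norm _ _).trans ?_
    gcongr
    exact norm_snd_le v
  rw [edot]
  linarith

lemma IsGTC.ofReal_scaling_flux_le (hU : IsGTC U) (hφ : IsDirichletWave U φ) (P : Spacetime n)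
    {c M τm τp : ℝ} (hp : p ∈ frontier U) (hpt : p.1 ∈ Ioo τm τp) (hc : 0 < c)
    (hcp : c ≤ √(mink (euclNormal U p) (euclNormal U p))) (hM : ‖scaling P p‖ ≤ M) :
    ENNReal.ofReal (-edot (current U φ (scaling P) ((n - 1) / 2) p) (euclNormal U p)) ≤
      (observationRegion U P τm τp).indicator (fun q => ENNReal.ofReal (M / c) * ENNReal.ofReal
        (normalDeriv U φ q ^ 2 * √(mink (euclNormal U q) (euclNormal U q)))) p := by
  have hM₀ : 0 ≤ M := (norm_nonneg _).trans hM
  rw [hU.edot_current hφ.eq_zero hp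
    (hφ.contDiffOn.differentiableOn two_ne_zero p (frontier_subset_closure hp))]
  by_cases hΓ : p ∈ observationRegion U P τm τp
  · rw [indicator_of_mem hΓ, ← ENNReal.ofReal_mul (by positivity)]
    refine ENNReal.ofReal_le_ofReal ?_
    obtain ⟨ρ, hρ⟩ := hU.smooth_boundary p hp
    have hflux := edot_le_two_mul_norm hρ.edot_euclNormal_self (scaling P p)
    set μ := √(mink (euclNormal U p) (euclNormal U p))
    calc normalDeriv U φ p ^ 2 * edot (scaling P p) (euclNormal U p) / 2
        ≤ normalDeriv U φ p ^ 2 * (2 * M) / 2 := by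
          gcongr
          linarith
      _ = M / c * (normalDeriv U φ p ^ 2 * c) := by field_simp
      _ ≤ M / c * (normalDeriv U φ p ^ 2 * μ) := by gcongr
  · rw [indicator_of_notMem hΓ, nonpos_iff_eq_zero, ENNReal.ofReal_eq_zero]
    have hhyp : ¬ 0 < fderiv ℝ (hyp P) p (minkNormal U p) := fun h => hΓ ⟨hp, hpt.1, hpt.2, h⟩
    rw [fderiv_hyp_minkNormal] at hhyp
    have hflux : edot (scaling P p) (euclNormal U p) ≤ 0 := by
      by_contra! hpos
      exact hhyp (by have := hc.trans_le hcp; positivity)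
    exact div_nonpos_of_nonpos_of_nonneg (mul_nonpos_of_nonneg_of_nonpos (sq_nonneg _) hflux)
      zero_le_two

lemma IsGTC.exists_scaling_flux_le (hU : IsGTC U) (hn : 1 ≤ n) (P : Spacetime n) (a b : ℝ) :
    ∃ C : ℝ≥0, ∀ φ : Spacetime n → ℝ, IsDirichletWave U φ →
      ∀ τm τp, a ≤ τm → τm < τp → τp ≤ b →
        ENNReal.ofReal
          (sliceInt U (fun p => (current U φ (scaling P) ((n - 1) / 2) p).1) τp -
            sliceInt U (fun p => (current U φ (scaling P) ((n - 1) / 2) p).1) τm) ≤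
        C * boundaryIntegral U (observationRegion U P τm τp)
          (fun p => normalDeriv U φ p ^ 2) := by
  obtain ⟨C, hC⟩ := hU.exists_slab_bound hn a b
  obtain ⟨c, hc, hcle⟩ := hU.exists_le_sqrt_mink hn a b
  have hscaling : ContDiff ℝ 1 (scaling P) := contDiff_scaling P
  obtain ⟨M, _, hM⟩ := hU.exists_bound hn hscaling.continuous.continuousOn a b
  refine ⟨C * (M / c).toNNReal, fun φ hφ τm τp ha hτ hb => ?_⟩
  have hslab := hC (current U φ (scaling P) ((n - 1) / 2)) (fun _ => 0)
    (observationRegion U P τm τp) _ τm τp ha hτ hb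
    (hU.contDiffOn_current hφ.contDiffOn hscaling.contDiffOn _) continuousOn_const
    (fun p hp => by
      rw [hU.diverg_current hφ.contDiffOn hscaling.contDiffOn hp (hφ.box_eq_zero p hp),
        hU.currentDiv_scaling P (subset_closure hp)])
    (fun p hp hpt =>
      have hpab : p.1 ∈ Icc a b := ⟨ha.trans hpt.1.le, hpt.2.le.trans hb⟩
      hU.ofReal_scaling_flux_le hφ P hp hpt hc (hcle p hp hpab)
        (hM p (frontier_subset_closure hp) hpab))
  simp only [sliceInt, integral_zero, intervalIntegral.integral_zero, sub_zero] at hslab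
  refine hslab.trans_eq ?_
  rw [lintegral_const_mul' _ _ ENNReal.ofReal_ne_top, ← mul_assoc, ENNReal.coe_mul]
  rfl

end Boundary

section EnergyComparison

lemma abs_current_fst_sub_le (U : Set (Spacetime n)) (φ : Spacetime n → ℝ)
    (X : Spacetime n → Spacetime n) (p : Spacetime n) :
    |(current U φ X 0 p).1 - (X p).1 * energyDensity U φ p| ≤
      ‖(X p).2‖ * energyDensity U φ p := by
  set G := minkGrad U φ p
  have henergy : energyDensity U φ p = (G.1 ^ 2 + ‖G.2‖ ^ 2) / 2 := by
    rw [energyDensity, edot_self]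
  calc |(current U φ X 0 p).1 - (X p).1 * energyDensity U φ p|
      = |G.1| * |inner ℝ G.2 (X p).2| := by
        rw [current_fst, zero_mul, add_zero, sub_sub_cancel_left, abs_neg, abs_mul]
    _ ≤ |G.1| * (‖G.2‖ * ‖(X p).2‖) := by
        gcongr
        exact abs_real_inner_le_norm _ _
    _ = ‖(X p).2‖ * (|G.1| * ‖G.2‖) := by ring
    _ ≤ ‖(X p).2‖ * energyDensity U φ p := by
        gcongr
        rw [henergy, ← sq_abs G.1]
        linarith [two_mul_le_add_sq |G.1| ‖G.2‖]

lemma IsGenerator.norm_snd_lt_fst (hZ : IsGenerator U Z) (hp : p ∈ closure U) :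
    ‖(Z p).2‖ < (Z p).1 := by
  have htimelike := hZ.timelike p hp
  rw [mink_self, sub_neg] at htimelike
  exact lt_of_pow_lt_pow_left₀ 2 (hZ.future p hp).le htimelike

lemma IsGTC.exists_energy_le_flux (hU : IsGTC U) (hn : 1 ≤ n) (hZ : IsGenerator U Z) (a b : ℝ) :
    ∃ c, 0 < c ∧ ∀ φ : Spacetime n → ℝ, ContDiffOn ℝ 2 φ (closure U) → ∀ t ∈ Icc a b,
      c * sliceInt U (energyDensity U φ) t ≤ sliceInt U (fun p => (current U φ Z 0 p).1) t := by
  have hZc := hZ.smooth.continuousOn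
  obtain ⟨c, hc, hcle⟩ := hU.exists_pos_le hn (hZc.fst.sub hZc.snd.norm)
    (fun p hp => sub_pos.2 (hZ.norm_snd_lt_fst hp)) a b
  refine ⟨c, hc, fun φ hφ t ht => ?_⟩
  have hcE : ContinuousOn (fun p => c * energyDensity U φ p) (closure U) :=
    continuousOn_const.mul (hU.continuousOn_energyDensity hφ)
  rw [← sliceInt_const_mul]
  refine hU.sliceInt_mono hn hcE
    (hU.contDiffOn_current hφ (hZ.smooth.of_le (by norm_cast)) 0).continuousOn.fst fun y hy => ?_
  have hmargin : c * energyDensity U φ (t, y) ≤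
      ((Z (t, y)).1 - ‖(Z (t, y)).2‖) * energyDensity U φ (t, y) :=
    mul_le_mul_of_nonneg_right (hcle _ (subset_closure hy) ht) (energyDensity_nonneg U φ _)
  linarith [(abs_le.1 (abs_current_fst_sub_le U φ Z (t, y))).1]

lemma IsGTC.exists_flux_le_energy (hU : IsGTC U) (hn : 1 ≤ n) (hZ : IsGenerator U Z) (a b : ℝ) :
    ∃ M, 0 ≤ M ∧ ∀ φ : Spacetime n → ℝ, ContDiffOn ℝ 2 φ (closure U) → ∀ t ∈ Icc a b,
      sliceInt U (fun p => (current U φ Z 0 p).1) t ≤ M * sliceInt U (energyDensity U φ) t := by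
  have hZc := hZ.smooth.continuousOn
  obtain ⟨M, hM₀, hM⟩ := hU.exists_bound hn (hZc.fst.add hZc.snd.norm) a b
  refine ⟨M, hM₀, fun φ hφ t ht => ?_⟩
  have hME : ContinuousOn (fun p => M * energyDensity U φ p) (closure U) :=
    continuousOn_const.mul (hU.continuousOn_energyDensity hφ)
  rw [← sliceInt_const_mul]
  have hcurrent := (hU.contDiffOn_current hφ (hZ.smooth.of_le (by norm_cast)) 0).continuousOn
  refine hU.sliceInt_mono hn hcurrent.fst hME fun y hy => ?_
  have hbound : ((Z (t, y)).1 + ‖(Z (t, y)).2‖) * energyDensity U φ (t, y) ≤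
      M * energyDensity U φ (t, y) :=
    mul_le_mul_of_nonneg_right ((le_abs_self _).trans (hM _ (subset_closure hy) ht))
      (energyDensity_nonneg U φ _)
  linarith [(abs_le.1 (abs_current_fst_sub_le U φ Z (t, y))).2]

lemma IsGTC.exists_abs_sliceInt_currentDiv_le (hU : IsGTC U) (hn : 1 ≤ n)
    (hZ : ContDiffOn ℝ 1 Z (closure U)) (a b : ℝ) :
    ∃ N, 0 ≤ N ∧ ∀ φ : Spacetime n → ℝ, ContDiffOn ℝ 2 φ (closure U) → ∀ t ∈ Icc a b,
      |sliceInt U (currentDiv U φ Z 0) t| ≤ N * sliceInt U (energyDensity U φ) t := by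
  obtain ⟨N, hN₀, hN⟩ :=
    hU.exists_bound hn (hZ.continuousOn_fderivWithin hU.uniqueDiffOn le_rfl) a b
  refine ⟨2 * (n + 3) * N, by positivity, fun φ hφ t ht => ?_⟩
  have hNE : ContinuousOn (fun p => 2 * (n + 3) * N * energyDensity U φ p) (closure U) :=
    continuousOn_const.mul (hU.continuousOn_energyDensity hφ)
  rw [← sliceInt_const_mul]
  refine hU.abs_sliceInt_le hn (hU.continuousOn_currentDiv hφ hZ 0) hNE fun y hy => ?_
  refine (abs_currentDiv_le U φ Z (t, y)).trans ?_
  gcongr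
  exacts [energyDensity_nonneg U φ _, hN _ (subset_closure hy) ht]

lemma IsGTC.energy_flux_comparison (hU : IsGTC U) (hn : 1 ≤ n) (hZ : IsGenerator U Z)
    (hφ : IsDirichletWave U φ) {k τm τp : ℝ} (hτ : τm ≤ τp)
    (hflux : ∀ t ∈ Icc τm τp, 0 ≤ sliceInt U (fun p => (current U φ Z 0 p).1) t)
    (hdiv : ∀ t ∈ Icc τm τp, |sliceInt U (currentDiv U φ Z 0) t| ≤
      k * sliceInt U (fun p => (current U φ Z 0 p).1) t) :
    sliceInt U (fun p => (current U φ Z 0 p).1) τp ≤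
        Real.exp (k * (τp - τm)) * sliceInt U (fun p => (current U φ Z 0 p).1) τm ∧
      sliceInt U (fun p => (current U φ Z 0 p).1) τm ≤
        Real.exp (k * (τp - τm)) * sliceInt U (fun p => (current U φ Z 0 p).1) τp := by
  have hZ₁ : ContDiffOn ℝ 1 Z (closure U) := hZ.smooth.of_le (by norm_cast)
  have hD := hU.continuousOn_currentDiv hφ.contDiffOn hZ₁ 0
  have htan : ∀ p ∈ frontier U, edot (current U φ Z 0 p) (euclNormal U p) = 0 := fun p hp => by
    rw [← neg_eq_zero, hU.edot_current hφ.eq_zero hp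
      (hφ.contDiffOn.differentiableOn two_ne_zero p (frontier_subset_closure hp)),
      hZ.edot_euclNormal hU hp, mul_zero, zero_div]
  exact gronwall_two_sided (hU.continuous_sliceInt hn hD) hτ
    (fun t _ => hU.sliceInt_sub_eq hn (hU.contDiffOn_current hφ.contDiffOn hZ₁ 0) hD
      (fun p hp => hU.diverg_current hφ.contDiffOn hZ₁ hp (hφ.box_eq_zero p hp)) htan τm t)
    hflux hdiv

lemma IsGTC.exists_energy_comparison (hU : IsGTC U) (hn : 1 ≤ n) (a b : ℝ) :
    ∃ K : ℝ, 1 ≤ K ∧ ∀ φ : Spacetime n → ℝ, IsDirichletWave U φ →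
      ∀ τm τp, a ≤ τm → τm ≤ τp → τp ≤ b →
        sliceInt U (energyDensity U φ) τp ≤ K * sliceInt U (energyDensity U φ) τm ∧
        sliceInt U (energyDensity U φ) τm ≤ K * sliceInt U (energyDensity U φ) τp := by
  obtain ⟨Z, hZ⟩ := hU.generator
  obtain ⟨c, hc, hlower⟩ := hU.exists_energy_le_flux hn hZ a b
  obtain ⟨M, hM, hupper⟩ := hU.exists_flux_le_energy hn hZ a b
  obtain ⟨N, hN, hdiv⟩ :=
    hU.exists_abs_sliceInt_currentDiv_le hn (hZ.smooth.of_le (by norm_cast)) a b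
  refine ⟨max (Real.exp (N / c * (b - a)) * M / c) 1, le_max_right _ _,
    fun φ hφ τm τp ha hτ hb => ?_⟩
  set E := sliceInt U (energyDensity U φ)
  set I := sliceInt U (fun p => (current U φ Z 0 p).1)
  have hE : ∀ t, 0 ≤ E t := sliceInt_nonneg (energyDensity_nonneg U φ)
  have hEI : ∀ t ∈ Icc a b, c * E t ≤ I t := hlower φ hφ.contDiffOn
  have hsub : Icc τm τp ⊆ Icc a b := Icc_subset_Icc ha hb
  obtain ⟨hforward, hbackward⟩ := hU.energy_flux_comparison hn hZ hφ (k := N / c) hτ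
    (fun t ht => (mul_nonneg hc.le (hE t)).trans (hEI t (hsub ht)))
    (fun t ht => calc
      |sliceInt U (currentDiv U φ Z 0) t| ≤ N * E t := hdiv φ hφ.contDiffOn t (hsub ht)
      _ = N / c * (c * E t) := by field_simp
      _ ≤ N / c * I t := by gcongr; exact hEI t (hsub ht))
  have hcompare : ∀ s ∈ Icc a b, ∀ t ∈ Icc a b, I s ≤ Real.exp (N / c * (τp - τm)) * I t →
      E s ≤ max (Real.exp (N / c * (b - a)) * M / c) 1 * E t := fun s hs t ht hst => by
    have hscaled : c * E s ≤ Real.exp (N / c * (b - a)) * (M * E t) := calc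
      c * E s ≤ I s := hEI s hs
      _ ≤ Real.exp (N / c * (τp - τm)) * I t := hst
      _ ≤ Real.exp (N / c * (τp - τm)) * (M * E t) := by
        gcongr
        exact hupper φ hφ.contDiffOn t ht
      _ ≤ Real.exp (N / c * (b - a)) * (M * E t) := by
        have := hE t
        gcongr
    calc E s ≤ Real.exp (N / c * (b - a)) * (M * E t) / c := (le_div_iff₀' hc).2 hscaled
      _ = Real.exp (N / c * (b - a)) * M / c * E t := by ring
      _ ≤ _ := mul_le_mul_of_nonneg_right (le_max_left _ _) (hE t)
  have hm : τm ∈ Icc a b := hsub (left_mem_Icc.2 hτ)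
  have hp : τp ∈ Icc a b := hsub (right_mem_Icc.2 hτ)
  exact ⟨hcompare τp hp τm hm hforward, hcompare τm hm τp hp hbackward⟩

end EnergyComparison

end Spacetime

section Inequalities

lemma inner_sq_le_of_norm_le {E : Type*} [NormedAddCommGroup E] [InnerProductSpace ℝ E] (x : E)
    {y : E} {R : ℝ} (hy : ‖y‖ ≤ R) : inner ℝ x y ^ 2 ≤ R ^ 2 * ‖x‖ ^ 2 := by
  rw [← mul_pow, ← sq_abs, mul_comm R]
  gcongr
  exact (abs_real_inner_le_norm x y).trans (by gcongr)

lemma abs_mul_add_mul_le {a f m q R S w : ℝ} (hR : 0 < R) (hw : 0 ≤ w) (hwm : w ≤ m)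
    (hq : q ^ 2 ≤ R ^ 2 * S) :
    |a * (q + w * f)| ≤
      R * ((a ^ 2 + S) / 2) + w / (2 * R) * (m * f ^ 2 + 2 * f * q) := by
  have hsq : (q + w * f) ^ 2 ≤ R ^ 2 * S + w * (m * f ^ 2 + 2 * f * q) := by
    have : w * w * f ^ 2 ≤ w * m * f ^ 2 := by gcongr
    linarith
  have hamgm := two_mul_le_add_sq (R * |a|) |q + w * f|
  rw [mul_pow, sq_abs, sq_abs] at hamgm
  calc |a * (q + w * f)| = 2 * (R * |a|) * |q + w * f| / (2 * R) := by
        rw [abs_mul]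
        field_simp
    _ ≤ (R ^ 2 * a ^ 2 + (R ^ 2 * S + w * (m * f ^ 2 + 2 * f * q))) / (2 * R) := by
        gcongr
        exact hamgm.trans (by gcongr)
    _ = _ := by
        field_simp
        ring

lemma sq_le_mul_add_two_div_mul {f m q R S : ℝ} (hm : 1 ≤ m) (hq : q ^ 2 ≤ R ^ 2 * S) :
    f ^ 2 ≤ 4 * R ^ 2 * S + 2 / m * (m * f ^ 2 + 2 * f * q) := by
  have hdiv : (q / m) ^ 2 ≤ q ^ 2 := by
    rw [div_pow]
    exact div_le_self (sq_nonneg _) (one_le_pow₀ hm)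
  have hexpand : 2 / m * (m * f ^ 2 + 2 * f * q) = 2 * f ^ 2 + 4 * f * (q / m) := by
    field_simp
    ring
  rw [hexpand]
  linarith [sq_nonneg (f + 2 * (q / m))]

lemma mul_le_mul_of_gap {x y g h δ K F : ℝ} (hx : 0 ≤ x) (hy : 0 ≤ y) (hK : 1 ≤ K)
    (hyx : y ≤ K * x) (hδ : 0 ≤ δ) (hδg : δ ≤ g) (hh : 0 ≤ h) (hF : g * x + h * y ≤ F) :
    δ * x ≤ K * F ∧ δ * y ≤ K * F := by
  have hxF : δ * x ≤ F := by
    have : δ * x ≤ g * x := by gcongr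
    linarith [mul_nonneg hh hy]
  have hF₀ : 0 ≤ F := (mul_nonneg hδ hx).trans hxF
  refine ⟨hxF.trans (le_mul_of_one_le_left hF₀ hK), ?_⟩
  calc δ * y ≤ δ * (K * x) := by gcongr
    _ = K * (δ * x) := by ring
    _ ≤ K * F := by gcongr

end Inequalities

namespace Spacetime

variable {n : ℕ} {U : Set (Spacetime n)} {φ : Spacetime n → ℝ} {p : Spacetime n}

section Slices

lemma abs_current_scaling_fst_sub_le (hn : 1 ≤ n) (U : Set (Spacetime n)) (φ : Spacetime n → ℝ)
    {P p : Spacetime n} {R : ℝ} (hR : 0 < R) (hp : ‖p.2 - P.2‖ ≤ R) :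
    |(current U φ (scaling P) ((n - 1) / 2) p).1 - (p.1 - P.1) * energyDensity U φ p| ≤
      R * energyDensity U φ p + (n - 1) / 2 / (2 * R) * virial U φ P.2 p := by
  have hn' : (1 : ℝ) ≤ n := by exact_mod_cast hn
  rw [current_fst, scaling, Prod.fst_sub, Prod.snd_sub, sub_sub_cancel_left, abs_neg,
    energyDensity, edot_self, virial]
  exact abs_mul_add_mul_le hR (by linarith) (by linarith) (inner_sq_le_of_norm_le _ hp)

lemma IsGTC.abs_sliceInt_scaling_sub_le (hU : IsGTC U) (hn : 1 ≤ n)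
    (hφ : ContDiffOn ℝ 2 φ (closure U)) (hφ₀ : ∀ p ∈ frontier U, φ p = 0) (P : Spacetime n)
    (t : ℝ) :
    |sliceInt U (fun p => (current U φ (scaling P) ((n - 1) / 2) p).1) t -
      (t - P.1) * sliceInt U (energyDensity U φ) t| ≤
        boundaryRadius U P.2 t * sliceInt U (energyDensity U φ) t := by
  have hE := hU.continuousOn_energyDensity hφ
  have hvirial := hU.continuousOn_virial hφ P.2
  have hJ : ContinuousOn (fun p => (current U φ (scaling P) ((n - 1) / 2) p).1) (closure U) :=
    (hU.contDiffOn_current hφ (contDiff_scaling P).contDiffOn _).continuousOn.fst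
  set R := boundaryRadius U P.2 t
  have hslice := hU.abs_sliceInt_le hn (t := t)
    (G := fun p => (current U φ (scaling P) ((n - 1) / 2) p).1 -
      (p.1 - P.1) * energyDensity U φ p)
    (H := fun p => R * energyDensity U φ p + (n - 1) / 2 / (2 * R) * virial U φ P.2 p)
    (hJ.sub ((by fun_prop : ContinuousOn (fun p : Spacetime n => p.1 - P.1) _).mul hE))
    ((continuousOn_const.mul hE).add (continuousOn_const.mul hvirial))
    fun y hy => abs_current_scaling_fst_sub_le hn U φ (hU.boundaryRadius_pos hn P.2 t)
      (hU.norm_sub_le_boundaryRadius hn (subset_closure hy))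
  have hleft := hU.sliceInt_mul_add_mul hn hJ hE (fun _ => 1) (fun s => -(s - P.1)) t
  have hright := hU.sliceInt_mul_add_mul hn hE hvirial (fun _ => R)
    (fun _ => (n - 1) / 2 / (2 * R)) t
  simp only [one_mul, neg_mul, ← sub_eq_add_neg] at hleft
  rw [hU.sliceInt_virial hn hφ hφ₀, mul_zero, add_zero] at hright
  rwa [hleft, hright] at hslice

lemma gradSq_eq (hU : IsOpen U) (hp : p ∈ U) : gradSq φ p = 2 * energyDensity U φ p := by
  have hnhds : closure U ∈ 𝓝 p := mem_of_superset (hU.mem_nhds hp) subset_closure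
  rw [gradSq, energyDensity, edot_self, EuclideanSpace.real_norm_sq_eq]
  simp only [minkGrad, sharp_fst, sharp_snd, fderivWithin_of_mem_nhds hnhds]
  ring

lemma sq_le_energyDensity_add_virial (hn : 1 ≤ n) (U : Set (Spacetime n)) (φ : Spacetime n → ℝ)
    {x₀ : EuclideanSpace ℝ (Fin n)} {p : Spacetime n} {R : ℝ} (hp : ‖p.2 - x₀‖ ≤ R) :
    φ p ^ 2 ≤ 8 * R ^ 2 * energyDensity U φ p + 2 / n * virial U φ x₀ p := by
  have hpoincare := sq_le_mul_add_two_div_mul (f := φ p) (m := n) (by exact_mod_cast hn)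
    (inner_sq_le_of_norm_le (minkGrad U φ p).2 hp)
  rw [virial, energyDensity, edot_self]
  linarith [mul_nonneg (sq_nonneg R) (sq_nonneg (minkGrad U φ p).1)]

lemma IsGTC.sliceEnergy_eq (hU : IsGTC U) (hn : 1 ≤ n) (hφ : ContDiffOn ℝ 2 φ (closure U))
    (t : ℝ) : sliceEnergy U φ t =
      ENNReal.ofReal (sliceInt U (fun p => 2 * energyDensity U φ p + φ p ^ 2) t) := by
  have hcont : ContinuousOn (fun p => 2 * energyDensity U φ p + φ p ^ 2) (closure U) :=
    (continuousOn_const.mul (hU.continuousOn_energyDensity hφ)).add (hφ.continuousOn.pow 2)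
  rw [sliceInt, ofReal_integral_eq_lintegral_ofReal (hU.integrableOn_slice hn hcont t)
    (Eventually.of_forall fun y => add_nonneg
      (mul_nonneg zero_le_two (energyDensity_nonneg U φ _)) (sq_nonneg _)), sliceEnergy]
  refine setLIntegral_congr_fun (hU.slice_open t).measurableSet fun y hy => ?_
  rw [gradSq_eq hU.isOpen hy]

lemma IsGTC.sliceEnergy_le (hU : IsGTC U) (hn : 1 ≤ n) (hφ : ContDiffOn ℝ 2 φ (closure U))
    (hφ₀ : ∀ p ∈ frontier U, φ p = 0) (x₀ : EuclideanSpace ℝ (Fin n)) (t : ℝ) :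
    sliceEnergy U φ t ≤ ENNReal.ofReal
      ((2 + 8 * boundaryRadius U x₀ t ^ 2) * sliceInt U (energyDensity U φ) t) := by
  have hE := hU.continuousOn_energyDensity hφ
  have hvirial := hU.continuousOn_virial hφ x₀
  rw [hU.sliceEnergy_eq hn hφ]
  set R := boundaryRadius U x₀ t
  have hcomb := hU.sliceInt_mul_add_mul hn hE hvirial (fun _ => 2 + 8 * R ^ 2)
    (fun _ => 2 / n) t
  rw [hU.sliceInt_virial hn hφ hφ₀, mul_zero, add_zero] at hcomb
  rw [← hcomb]
  refine ENNReal.ofReal_le_ofReal (hU.sliceInt_mono hn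
    ((continuousOn_const.mul hE).add (hφ.continuousOn.pow 2))
    ((continuousOn_const.mul hE).add (continuousOn_const.mul hvirial)) fun y hy => ?_)
  have hpoincare := sq_le_energyDensity_add_virial hn U φ (p := (t, y))
    (hU.norm_sub_le_boundaryRadius (x₀ := x₀) hn (subset_closure hy))
  simp only [Pi.add_apply, Pi.mul_apply, Pi.pow_apply]
  linarith

end Slices

section Observability

lemma IsGTC.gap_mul_energy_le_flux (hU : IsGTC U) (hn : 1 ≤ n)
    (hφ : ContDiffOn ℝ 2 φ (closure U)) (hφ₀ : ∀ p ∈ frontier U, φ p = 0) (P : Spacetime n)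
    (τm τp : ℝ) :
    (τp - P.1 - boundaryRadius U P.2 τp) * sliceInt U (energyDensity U φ) τp +
        (P.1 - τm - boundaryRadius U P.2 τm) * sliceInt U (energyDensity U φ) τm ≤
      sliceInt U (fun p => (current U φ (scaling P) ((n - 1) / 2) p).1) τp -
        sliceInt U (fun p => (current U φ (scaling P) ((n - 1) / 2) p).1) τm := by
  have hfuture := (abs_le.1 (hU.abs_sliceInt_scaling_sub_le hn hφ hφ₀ P τp)).1
  have hpast := (abs_le.1 (hU.abs_sliceInt_scaling_sub_le hn hφ hφ₀ P τm)).2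
  linarith

lemma IsGTC.exists_energy_le_scaling_flux (hU : IsGTC U) (hn : 1 ≤ n) (P : Spacetime n) (a b : ℝ)
    {δ : ℝ} (hδ : 0 < δ) :
    ∃ L : ℝ≥0, ∀ τm τp : ℝ, a ≤ τm → τm ≤ τp → τp ≤ b →
      boundaryRadius U P.2 τp ≤ τp - P.1 → boundaryRadius U P.2 τm ≤ P.1 - τm →
      (δ ≤ τp - P.1 - boundaryRadius U P.2 τp ∨ δ ≤ P.1 - τm - boundaryRadius U P.2 τm) →
      ∀ φ : Spacetime n → ℝ, IsDirichletWave U φ → ∀ τ ∈ ({τp, τm} : Set ℝ),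
        sliceInt U (energyDensity U φ) τ ≤
          L * (sliceInt U (fun p => (current U φ (scaling P) ((n - 1) / 2) p).1) τp -
            sliceInt U (fun p => (current U φ (scaling P) ((n - 1) / 2) p).1) τm) := by
  obtain ⟨K, hK, hcompare⟩ := hU.exists_energy_comparison hn a b
  refine ⟨(K / δ).toNNReal, fun τm τp ha hτ hb hp hm hgap φ hφ τ hτmem => ?_⟩
  obtain ⟨hforward, hbackward⟩ := hcompare φ hφ τm τp ha hτ hb
  have hflux := hU.gap_mul_energy_le_flux hn hφ.contDiffOn hφ.eq_zero P τm τp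
  have hE : ∀ t, 0 ≤ sliceInt U (energyDensity U φ) t :=
    sliceInt_nonneg (energyDensity_nonneg U φ)
  rw [Real.coe_toNNReal _ (by positivity), div_mul_eq_mul_div, le_div_iff₀' hδ]
  rcases hgap with hgap | hgap
  · have h := mul_le_mul_of_gap (hE τp) (hE τm) hK hbackward hδ.le hgap (sub_nonneg.2 hm) hflux
    rcases hτmem with rfl | rfl
    exacts [h.1, h.2]
  · have h := mul_le_mul_of_gap (hE τm) (hE τp) hK hforward hδ.le hgap (sub_nonneg.2 hp)
      ((add_comm _ _).trans_le hflux)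
    rcases hτmem with rfl | rfl
    exacts [h.2, h.1]

lemma IsGTC.exists_observability (hU : IsGTC U) (hn : 1 ≤ n) (P : Spacetime n) (a b : ℝ) {δ : ℝ}
    (hδ : 0 < δ) :
    ∃ C : ℝ≥0, ∀ τm τp : ℝ, a ≤ τm → τm < τp → τp ≤ b →
      boundaryRadius U P.2 τp ≤ τp - P.1 → boundaryRadius U P.2 τm ≤ P.1 - τm →
      (δ ≤ τp - P.1 - boundaryRadius U P.2 τp ∨ δ ≤ P.1 - τm - boundaryRadius U P.2 τm) →
      ∀ φ : Spacetime n → ℝ, IsDirichletWave U φ → ∀ τ ∈ ({τp, τm} : Set ℝ),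
        sliceEnergy U φ τ ≤ C * boundaryIntegral U (observationRegion U P τm τp)
          (fun p => normalDeriv U φ p ^ 2) := by
  obtain ⟨C, hC⟩ := hU.exists_scaling_flux_le hn P a b
  obtain ⟨L, hL⟩ := hU.exists_energy_le_scaling_flux hn P a b hδ
  set R : ℝ := boundaryRadius U P.2 a + (b - a)
  set A : ℝ≥0 := (2 + 8 * R ^ 2).toNNReal
  have hA : (A : ℝ) = 2 + 8 * R ^ 2 := Real.coe_toNNReal _ (by positivity)
  refine ⟨A * L * C, fun τm τp ha hτ hb hp hm hgap φ hφ τ hτmem => ?_⟩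
  have hflux := hC φ hφ τm τp ha hτ hb
  have henergy := hL τm τp ha hτ.le hb hp hm hgap φ hφ τ hτmem
  set F := sliceInt U (fun p => (current U φ (scaling P) ((n - 1) / 2) p).1) τp -
    sliceInt U (fun p => (current U φ (scaling P) ((n - 1) / 2) p).1) τm
  have hτab : a ≤ τ ∧ τ ≤ b := by
    rcases hτmem with rfl | rfl
    exacts [⟨ha.trans hτ.le, hb⟩, ⟨ha, hτ.le.trans hb⟩]
  have hradius : boundaryRadius U P.2 τ ≤ R := by
    have hlip := hU.boundaryRadius_le_add hn P.2 τ a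
    rw [abs_sub_comm, abs_of_nonneg (sub_nonneg.2 hτab.1)] at hlip
    linarith
  calc sliceEnergy U φ τ ≤ ENNReal.ofReal
        ((2 + 8 * boundaryRadius U P.2 τ ^ 2) * sliceInt U (energyDensity U φ) τ) :=
        hU.sliceEnergy_le hn hφ.contDiffOn hφ.eq_zero P.2 τ
    _ ≤ ENNReal.ofReal ((A * L : ℝ≥0) * F) := by
        rw [NNReal.coe_mul, hA, mul_assoc]
        have hpos := hU.boundaryRadius_pos hn P.2 τ
        have hE : 0 ≤ sliceInt U (energyDensity U φ) τ :=
          sliceInt_nonneg (energyDensity_nonneg U φ) τ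
        gcongr
    _ = (A * L : ℝ≥0) * ENNReal.ofReal F := by
        rw [ENNReal.ofReal_mul NNReal.zero_le_coe, ENNReal.ofReal_coe_nnreal]
    _ ≤ (A * L : ℝ≥0) * (C * _) := by gcongr
    _ = _ := by rw [ENNReal.coe_mul _ C, mul_assoc]

/-- The pairs `(τ₋, τ₊)` of times at distance `T` whose slices lie strictly inside the past and the
future cone of `P`. -/
structure IsAdmissible (U : Set (Spacetime n)) (P : Spacetime n) (T τm τp : ℝ) : Prop where
  sub_eq : τp - τm = T
  radius_lt_future : boundaryRadius U P.2 τp < τp - P.1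
  radius_lt_past : boundaryRadius U P.2 τm < P.1 - τm

-- Both gaps are monotone in time, the first one increasing and the second one decreasing, because
-- the radius is `1`-Lipschitz.
lemma IsGTC.exists_le_gap (hU : IsGTC U) (hn : 1 ≤ n) (P : Spacetime n) (T : ℝ) :
    ∃ δ, 0 < δ ∧ ∀ τm τp, IsAdmissible U P T τm τp →
      δ ≤ τp - P.1 - boundaryRadius U P.2 τp ∨ δ ≤ P.1 - τm - boundaryRadius U P.2 τm := by
  by_cases hex : ∃ σm σp, IsAdmissible U P T σm σp
  · obtain ⟨σm, σp, hσ⟩ := hex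
    refine ⟨_, lt_min (sub_pos.2 hσ.radius_lt_future) (sub_pos.2 hσ.radius_lt_past),
      fun τm τp hτ => ?_⟩
    have hshift := hσ.sub_eq.trans hτ.sub_eq.symm
    rcases le_total σp τp with hle | hle
    · have hlip := hU.boundaryRadius_le_add hn P.2 τp σp
      rw [abs_sub_comm, abs_of_nonneg (sub_nonneg.2 hle)] at hlip
      exact Or.inl ((min_le_left _ _).trans (by linarith))
    · have hlip := hU.boundaryRadius_le_add hn P.2 τm σm
      rw [abs_of_nonneg (by linarith)] at hlip
      exact Or.inr ((min_le_right _ _).trans (by linarith))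
  · exact ⟨1, one_pos, fun τm τp hτ => absurd ⟨τm, τp, hτ⟩ hex⟩

end Observability

end Spacetime

open Spacetime in
theorem theorem2p14_general {n : ℕ} (hn : 1 ≤ n) (U : Set (Spacetime n)) (hU : IsGTC U)
    (t₀ : ℝ) (x₀ : EuclideanSpace ℝ (Fin n)) (T : ℝ) :
    ∃ C : ℝ≥0, 0 < C ∧
      ∀ τm τp : ℝ, τp - τm = T →
        boundaryRadius U x₀ τp < τp - t₀ → boundaryRadius U x₀ τm < t₀ - τm →
        ∀ φ : Spacetime n → ℝ, ContDiffOn ℝ 2 φ (closure U) →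
          (∀ p ∈ U, box φ p = 0) → (∀ p ∈ frontier U, φ p = 0) →
          sliceEnergy U φ τp ≤ C *
              boundaryIntegral U (observationRegion U (t₀, x₀) τm τp)
                (fun p => normalDeriv U φ p ^ 2) ∧
            sliceEnergy U φ τm ≤ C *
              boundaryIntegral U (observationRegion U (t₀, x₀) τm τp)
                (fun p => normalDeriv U φ p ^ 2) := by
  obtain ⟨δ, hδ, hgap⟩ := hU.exists_le_gap hn (t₀, x₀) T
  obtain ⟨C, hC⟩ := hU.exists_observability hn (t₀, x₀) (t₀ - T) (t₀ + T) hδ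
  refine ⟨C + 1, by positivity, fun τm τp hT hRp hRm φ hφ hbox hφ₀ => ?_⟩
  have hp : 0 < τp - t₀ := (hU.boundaryRadius_pos hn x₀ τp).trans hRp
  have hm : 0 < t₀ - τm := (hU.boundaryRadius_pos hn x₀ τm).trans hRm
  have hobs := hC τm τp (by linarith) (by linarith) (by linarith) hRp.le hRm.le
    (hgap τm τp ⟨hT, hRp, hRm⟩) φ ⟨hφ, hbox, hφ₀⟩
  have hle : (C : ℝ≥0∞) ≤ (C + 1 : ℝ≥0) := by exact_mod_cast le_self_add
  exact ⟨(hobs τp (by simp)).trans (by gcongr), (hobs τm (by simp)).trans (by gcongr)⟩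

open Spacetime in
theorem theorem2p14 {n : ℕ} (hn : 1 ≤ n) (U : Set (Spacetime n)) (hU : IsGTC U)
    (t₀ : ℝ) (x₀ : EuclideanSpace ℝ (Fin n)) (T : ℝ) :
    ∃ C : ℝ≥0, 0 < C ∧
      ∀ τm τp : ℝ, τm < τp → τp - τm = T →
        boundaryRadius U x₀ τp + boundaryRadius U x₀ τm < τp - τm →
        τm < t₀ → t₀ < τp →
        boundaryRadius U x₀ τp < τp - t₀ → boundaryRadius U x₀ τm < t₀ - τm →
        ∀ φ : Spacetime n → ℝ, ContDiffOn ℝ ∞ φ (closure U) →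
          (∀ p ∈ U, box φ p = 0) → (∀ p ∈ frontier U, φ p = 0) →
          sliceEnergy U φ τp ≤ C *
              boundaryIntegral U (observationRegion U (t₀, x₀) τm τp)
                (fun p => normalDeriv U φ p ^ 2) ∧
            sliceEnergy U φ τm ≤ C *
              boundaryIntegral U (observationRegion U (t₀, x₀) τm τp)
                (fun p => normalDeriv U φ p ^ 2) := by
  obtain ⟨C, hC, hobs⟩ := theorem2p14_general hn U hU t₀ x₀ T
  exact ⟨C, hC, fun τm τp _ hT _ _ _ hp hm φ hφ => hobs τm τp hT hp hm φ (hφ.of_le (by norm_cast))⟩
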